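/- **Setting.** Let $O$ be a countable set of object symbols; the sorts are the pairs $(u,v)\in O\times O$. A signature $\Sigma$ over $O$ consists of countably many constant symbols, each with a sort, and countably many function symbols, each with a sort $s_1\times\dots\times s_n\to s$, $n\ge 1$; in addition it contains, for all $u,v,w\in O$, a zero constant $0_{u,v}$ of sort $(u,v)$ and the arithmetic function symbols $-$, $+$ on the sort $(u,v)$ and $\cdot$ of sort $(w,v)\times(u,w)\to(u,v)$. There are infinitely many variables of every sort. Terms, (many-sorted, first-order) formulas with equality $\approx$ as the only predicate, structures (with a non-empty domain for every sort) and semantic consequence $\models$ are defined as usual. Let $\mathcal A$ be the set of axioms of preadditive semicategories in $\Sigma$: associativity of $\cdot$, the abelian group axioms for $+,-,0$ on every sort, and bilinearity of $\cdot$. **The procedure.** On input of a formula $\varphi$ over $\Sigma$: 1. Compute a Herbrand normal form $\varphi^H=\exists x_1,\dots,x_m\colon\varphi^*$ of $\varphi$: form the universal closure, bring it into prenex normal form, and replace, from left to right, every universally quantified variable $y$ by $f(x_1,\dots,x_j)$, where $x_1,\dots,x_j$ are the existentially quantified variables that precede it and $f$ is a new function symbol (a new constant symbol if $j=0$), which is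 added to the signature. 2. Let $\varphi_1,\varphi_2,\dots$ be an enumeration (repetitions allowed) of the Herbrand expansion of $\varphi^H$, that is, of all instances $\varphi^*[x_1\mapsto t_1,\dots,x_m\mapsto t_m]$ by ground terms $t_i$ of the appropriate sorts over the extended signature. Put $\psi_n=\varphi_1\vee\dots\vee\varphi_n$ (and $\psi_n=\varphi^H$ for all $n$ if $m=0$). 3. Let $\psi_n^{\mathrm{Ack}}$ be the result of Ackermann's reduction of $\psi_n$, applied successively to all non-arithmetic function symbols. For one function symbol $f$, every outermost occurrence of an instance of $f$ is replaced by a new constant $c_i$, the same one for syntactically equal instances, and the resulting formula becomes the conclusion of an implication whose premise is the conjunction, over all pairs $i<j$ of different instances of $f$ (nested ones included), of the formulas "if the arguments of the $i$-th and the $j$-th instance, after the replacement, are equal, then $c_i\approx c_j$". 4. For an arithmetic ground sentence $\psi$, translate its terms into noncommutative polynomials over $\mathbb Z$, with one indeterminate for every non-zero constant and with $0_{u,v}\mapsto 0$. The idealisation $I(\psi)$ is the statement that every clause $\bigvee_j s_j\not\approx t_j\vee\bigvee_k p_k\approx q_k$ of the conjunctive normal form of $\psi$ satisfies, for at least one $k$,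 $p_k-q_k\in(s_1-t_1,s_2-t_2,\dots)$, a two-sided ideal of the free algebra. 5. For $n=1,2,\dots$ and, for each $n$, for $k=1,\dots,n$: if $I(\psi_k^{\mathrm{Ack}})$ is verified with $n$ operations (for each single membership test) of a given semi-decision procedure for ideal membership in finitely generated ideals of the free algebra over $\mathbb Z$, return $\top$ and stop. Here a semi-decision procedure for ideal membership is one that accepts an instance "is $f\in(f_1,\dots,f_r)$?" after finitely many operations if and only if the membership holds. **Theorem.** The systematic search for representations $f=\sum_i a_if_{j_i}b_i$ is a semi-decision procedure for ideal membership in the free algebra over $\mathbb Z$, and the enumeration of the Herbrand expansion obtained by decoding ground terms from natural numbers is an enumeration as needed in step 2. For every signature $\Sigma$, every formula $\varphi$ over $\Sigma$, every enumeration of the Herbrand expansion of $\varphi^H$ and every semi-decision procedure for ideal membership, the procedure above terminates and returns $\top$ if and only if $\mathcal A\models\varphi$; otherwise it runs forever. Hence it is a semi-decision procedure for the universal truth of operator statements. -/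

import Mathlib

universe w

namespace OperatorLogic

/-! ### Syntax of many-sorted first-order logic for operators -/

/-- Sorts over the object symbols `O`: the sort `(u, v)` is that of morphisms `u → v`. -/
abbrev Srt (O : Type) : Type := O × O

/-- A signature over the object symbols `O`.
`Con s` are the non-zero constant symbols of sort `s`; `Fun d ds s` are the non-arithmetic
function symbols of sort `d × ds₁ × ⋯ × dsₖ → s`, so their arity is at least one.
The zero constants and the arithmetic function symbols belong to every signature and are built
into terms. All symbols come from enumerable alphabets, hence the `Encodable` fields. -/
structure Signature (O : Type) where
  Con : Srt O → Type
  Fun : Srt O → List (Srt O) → Srt O → Type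
  conDec : ∀ s, DecidableEq (Con s)
  conEnc : ∀ s, Encodable (Con s)
  funDec : ∀ d ds s, DecidableEq (Fun d ds s)
  funEnc : ∀ d ds s, Encodable (Fun d ds s)

attribute [instance] Signature.conDec Signature.conEnc Signature.funDec Signature.funEnc

/-- Variables: `(s, n)` is the `n`-th variable of sort `s`. -/
abbrev Var (O : Type) : Type := Srt O × ℕ

mutual
/-- Terms of a given sort. `var n : Term S s` is the variable `(s, n)`. -/
inductive Term {O : Type} (S : Signature O) : Srt O → Type
  | var {s : Srt O} (n : ℕ) : Term S s
  | con {s : Srt O} (c : S.Con s) : Term S s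
  | zero {s : Srt O} : Term S s
  | neg {s : Srt O} (t : Term S s) : Term S s
  | add {s : Srt O} (t₁ t₂ : Term S s) : Term S s
  | mul {u v o : O} (t₁ : Term S (o, v)) (t₂ : Term S (u, o)) : Term S (u, v)
  | app {d : Srt O} {ds : List (Srt O)} {s : Srt O} (f : S.Fun d ds s)
      (a : Args S (d :: ds)) : Term S s
  deriving DecidableEq
/-- Tuples of terms of given sorts. -/
inductive Args {O : Type} (S : Signature O) : List (Srt O) → Type
  | nil : Args S []
  | cons {s : Srt O} {l : List (Srt O)} (t : Term S s) (a : Args S l) : Args S (s :: l)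
  deriving DecidableEq
end

/-- First-order formulas; `ex s n φ` and `all s n φ` quantify the variable `(s, n)`. -/
inductive Formula {O : Type} (S : Signature O) : Type
  | eq {s : Srt O} (t₁ t₂ : Term S s) : Formula S
  | not (φ : Formula S) : Formula S
  | or (φ ψ : Formula S) : Formula S
  | and (φ ψ : Formula S) : Formula S
  | imp (φ ψ : Formula S) : Formula S
  | ex (s : Srt O) (n : ℕ) (φ : Formula S) : Formula S
  | all (s : Srt O) (n : ℕ) (φ : Formula S) : Formula S

/-- Quantifier-free formulas. -/
inductive QF {O : Type} (S : Signature O) : Type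
  | eq {s : Srt O} (t₁ t₂ : Term S s) : QF S
  | not (φ : QF S) : QF S
  | or (φ ψ : QF S) : QF S
  | and (φ ψ : QF S) : QF S
  | imp (φ ψ : QF S) : QF S

/-! ### The axioms of preadditive semicategories -/

/-- The axioms for fixed objects `u, u', v, v'`. -/
def axiomsAt {O : Type} (S : Signature O) (u u' v v' : O) : Set (Formula S) :=
  { .all (v', v) 0 (.all (u', v') 1 (.all (u, u') 2
      (.eq (.mul (.var 0 : Term S (v', v)) (.mul (.var 1 : Term S (u', v')) (.var 2 : Term S (u, u'))))
        (.mul (.mul (.var 0 : Term S (v', v)) (.var 1 : Term S (u', v')))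
          (.var 2 : Term S (u, u')))))),
    .all (u, v) 0 (.all (u, v) 1 (.all (u, v) 2
      (.eq (.add (.var 0 : Term S (u, v)) (.add (.var 1) (.var 2)))
        (.add (.add (.var 0) (.var 1)) (.var 2))))),
    .all (u, v) 0 (.eq (.add (.var 0 : Term S (u, v)) .zero) (.var 0)),
    .all (u, v) 0 (.eq (.add (.var 0 : Term S (u, v)) (.neg (.var 0))) .zero),
    .all (u, v) 0 (.all (u, v) 1
      (.eq (.add (.var 0 : Term S (u, v)) (.var 1)) (.add (.var 1) (.var 0)))),
    .all (v', v) 0 (.all (u, v') 1 (.all (u, v') 2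
      (.eq (.mul (.var 0 : Term S (v', v)) (.add (.var 1 : Term S (u, v')) (.var 2)))
        (.add (.mul (.var 0 : Term S (v', v)) (.var 1))
          (.mul (.var 0 : Term S (v', v)) (.var 2)))))),
    .all (v', v) 0 (.all (v', v) 1 (.all (u, v') 2
      (.eq (.mul (.add (.var 0 : Term S (v', v)) (.var 1)) (.var 2 : Term S (u, v')))
        (.add (.mul (.var 0 : Term S (v', v)) (.var 2))
          (.mul (.var 1 : Term S (v', v)) (.var 2)))))) }

/-- The set `𝒜` of axioms of preadditive semicategories in the signature `S`. -/
def axioms {O : Type} (S : Signature O) : Set (Formula S) :=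
  ⋃ (u : O) (u' : O) (v : O) (v' : O), axiomsAt S u u' v v'

/-! ### Semantics -/

/-- Tuples of elements of the domains `A` with the listed sorts. -/
def Tup {O : Type} (A : Srt O → Type w) : List (Srt O) → Type w
  | [] => PUnit
  | s :: l => A s × Tup A l

/-- Structures: one non-empty domain per sort and an interpretation of all symbols. -/
structure Struct {O : Type} (S : Signature O) where
  dom : Srt O → Type w
  nonempty : ∀ s, Nonempty (dom s)
  con : ∀ {s : Srt O}, S.Con s → dom s
  zero : ∀ s : Srt O, dom s
  neg : ∀ {s : Srt O}, dom s → dom s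
  add : ∀ {s : Srt O}, dom s → dom s → dom s
  mul : ∀ {u v o : O}, dom (o, v) → dom (u, o) → dom (u, v)
  app : ∀ {d : Srt O} {ds : List (Srt O)} {s : Srt O}, S.Fun d ds s → Tup dom (d :: ds) → dom s

/-- Assignments: every variable gets a value in the domain of its sort. -/
abbrev Struct.Assignment {O : Type} {S : Signature O} (A : Struct.{w} S) : Type w :=
  ∀ x : Var O, A.dom x.1

mutual
/-- The interpretation of a term. -/
def Term.eval {O : Type} {S : Signature O} (A : Struct.{w} S) (M : A.Assignment) :
    {s : Srt O} → Term S s → A.dom s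
  | s, .var n => M (s, n)
  | _, .con c => A.con c
  | s, .zero => A.zero s
  | _, .neg t => A.neg (Term.eval A M t)
  | _, .add t₁ t₂ => A.add (Term.eval A M t₁) (Term.eval A M t₂)
  | _, .mul t₁ t₂ => A.mul (Term.eval A M t₁) (Term.eval A M t₂)
  | _, .app f a => A.app f (Args.eval A M a)
/-- The interpretation of a tuple of terms. -/
def Args.eval {O : Type} {S : Signature O} (A : Struct.{w} S) (M : A.Assignment) :
    {l : List (Srt O)} → Args S l → Tup A.dom l
  | _, .nil => PUnit.unit
  | _, .cons t a => (Term.eval A M t, Args.eval A M a)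
end

/-- The truth value of a formula in an interpretation `(A, M)`. -/
def Formula.Holds {O : Type} [DecidableEq O] {S : Signature O} (A : Struct.{w} S) :
    A.Assignment → Formula S → Prop
  | M, .eq t₁ t₂ => t₁.eval A M = t₂.eval A M
  | M, .not φ => ¬ φ.Holds A M
  | M, .or φ ψ => φ.Holds A M ∨ ψ.Holds A M
  | M, .and φ ψ => φ.Holds A M ∧ ψ.Holds A M
  | M, .imp φ ψ => φ.Holds A M → ψ.Holds A M
  | M, .ex s n φ => ∃ a : A.dom s, φ.Holds A (Function.update M (s, n) a)
  | M, .all s n φ => ∀ a : A.dom s, φ.Holds A (Function.update M (s, n) a)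

/-- Semantic consequence `Φ ⊨ φ`. -/
def Entails {O : Type} [DecidableEq O] {S : Signature O} (Φ : Set (Formula S))
    (φ : Formula S) : Prop :=
  ∀ (A : Struct.{w} S) (M : A.Assignment), (∀ α ∈ Φ, α.Holds A M) → φ.Holds A M

/-! ### Variables and substitution -/

mutual
/-- The variables occurring in a term. -/
def Term.vars {O : Type} {S : Signature O} : {s : Srt O} → Term S s → List (Var O)
  | s, .var n => [(s, n)]
  | _, .con _ => []
  | _, .zero => []
  | _, .neg t => t.vars
  | _, .add t₁ t₂ => t₁.vars ++ t₂.vars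
  | _, .mul t₁ t₂ => t₁.vars ++ t₂.vars
  | _, .app _ a => a.vars
/-- The variables occurring in a tuple of terms. -/
def Args.vars {O : Type} {S : Signature O} : {l : List (Srt O)} → Args S l → List (Var O)
  | _, .nil => []
  | _, .cons t a => t.vars ++ a.vars
end

/-- A term without variables. -/
def Term.IsGround {O : Type} {S : Signature O} {s : Srt O} (t : Term S s) : Prop := t.vars = []

/-- Sort-preserving substitutions. -/
abbrev Subst {O : Type} (S : Signature O) : Type := ∀ x : Var O, Term S x.1

mutual
/-- Simultaneous substitution in a term. -/
def Term.subst {O : Type} {S : Signature O} (θ : Subst S) : {s : Srt O} → Term S s → Term S s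
  | s, .var n => θ (s, n)
  | _, .con c => .con c
  | _, .zero => .zero
  | _, .neg t => .neg (t.subst θ)
  | _, .add t₁ t₂ => .add (t₁.subst θ) (t₂.subst θ)
  | _, .mul t₁ t₂ => .mul (t₁.subst θ) (t₂.subst θ)
  | _, .app f a => .app f (a.subst θ)
/-- Simultaneous substitution in a tuple of terms. -/
def Args.subst {O : Type} {S : Signature O} (θ : Subst S) :
    {l : List (Srt O)} → Args S l → Args S l
  | _, .nil => .nil
  | _, .cons t a => .cons (t.subst θ) (a.subst θ)
end

/-- Simultaneous substitution in a quantifier-free formula. -/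
def QF.subst {O : Type} {S : Signature O} (θ : Subst S) : QF S → QF S
  | .eq t₁ t₂ => .eq (t₁.subst θ) (t₂.subst θ)
  | .not φ => .not (φ.subst θ)
  | .or φ ψ => .or (φ.subst θ) (ψ.subst θ)
  | .and φ ψ => .and (φ.subst θ) (ψ.subst θ)
  | .imp φ ψ => .imp (φ.subst θ) (ψ.subst θ)

/-- The substitution `[x ↦ t]`. -/
def Subst.single {O : Type} [DecidableEq O] {S : Signature O} (x : Var O) (t : Term S x.1) :
    Subst S :=
  Function.update (fun y => .var y.2) x t

/-! ### Herbrand normal form -/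

/-- The variables that occur free in a formula. -/
def Formula.freeVars {O : Type} [DecidableEq O] {S : Signature O} : Formula S → List (Var O)
  | .eq t₁ t₂ => t₁.vars ++ t₂.vars
  | .not φ => φ.freeVars
  | .or φ ψ => φ.freeVars ++ ψ.freeVars
  | .and φ ψ => φ.freeVars ++ ψ.freeVars
  | .imp φ ψ => φ.freeVars ++ ψ.freeVars
  | .ex s n φ => φ.freeVars.filter fun x => x ≠ (s, n)
  | .all s n φ => φ.freeVars.filter fun x => x ≠ (s, n)

/-- The universal closure of a formula. -/
def Formula.closure {O : Type} [DecidableEq O] {S : Signature O} (φ : Formula S) : Formula S :=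
  φ.freeVars.dedup.foldr (fun x ψ => .all x.1 x.2 ψ) φ

/-- Quantifiers. -/
inductive Quant : Type
  | ex : Quant
  | all : Quant

/-- The dual quantifier. -/
def Quant.dual : Quant → Quant
  | .ex => .all
  | .all => .ex

/-- Dualise all quantifiers of a prefix. -/
def dualPrefix {O : Type} (p : List (Quant × Var O)) : List (Quant × Var O) :=
  p.map fun q => (q.1.dual, q.2)

/-- Prenexing. Every bound variable is renamed to a variable of the same sort with a fresh index:
`ρ x` is the current index of the variable `x` and `k` is the first index that was not used yet.
Returns the prefix, the quantifier-free matrix and the next unused index. -/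
def Formula.prenexAux {O : Type} [DecidableEq O] {S : Signature O} :
    (Var O → ℕ) → ℕ → Formula S → List (Quant × Var O) × QF S × ℕ
  | ρ, k, .eq t₁ t₂ =>
    ([], .eq (t₁.subst fun x => .var (ρ x)) (t₂.subst fun x => .var (ρ x)), k)
  | ρ, k, .not φ =>
    let r := φ.prenexAux ρ k
    (dualPrefix r.1, .not r.2.1, r.2.2)
  | ρ, k, .or φ ψ =>
    let r := φ.prenexAux ρ k
    let q := ψ.prenexAux ρ r.2.2
    (r.1 ++ q.1, .or r.2.1 q.2.1, q.2.2)
  | ρ, k, .and φ ψ =>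
    let r := φ.prenexAux ρ k
    let q := ψ.prenexAux ρ r.2.2
    (r.1 ++ q.1, .and r.2.1 q.2.1, q.2.2)
  | ρ, k, .imp φ ψ =>
    let r := φ.prenexAux ρ k
    let q := ψ.prenexAux ρ r.2.2
    (dualPrefix r.1 ++ q.1, .imp r.2.1 q.2.1, q.2.2)
  | ρ, k, .ex s n φ =>
    let r := φ.prenexAux (Function.update ρ (s, n) k) (k + 1)
    ((.ex, (s, k)) :: r.1, r.2)
  | ρ, k, .all s n φ =>
    let r := φ.prenexAux (Function.update ρ (s, n) k) (k + 1)
    ((.all, (s, k)) :: r.1, r.2)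

/-- A prenex normal form (prefix and matrix) of a sentence. -/
def Formula.prenex {O : Type} [DecidableEq O] {S : Signature O} (φ : Formula S) :
    List (Quant × Var O) × QF S :=
  let r := φ.prenexAux (fun x => x.2) 0
  (r.1, r.2.1)

mutual
/-- Translate a term along maps of constant and function symbols. -/
def Term.map {O : Type} {S S' : Signature O} (c' : ∀ {s}, S.Con s → S'.Con s)
    (f' : ∀ {d ds s}, S.Fun d ds s → S'.Fun d ds s) : {s : Srt O} → Term S s → Term S' s
  | _, .var n => .var n
  | _, .con c => .con (c' c)
  | _, .zero => .zero
  | _, .neg t => .neg (t.map c' f')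
  | _, .add t₁ t₂ => .add (t₁.map c' f') (t₂.map c' f')
  | _, .mul t₁ t₂ => .mul (t₁.map c' f') (t₂.map c' f')
  | _, .app f a => .app (f' f) (a.map c' f')
/-- Translate a tuple of terms along maps of constant and function symbols. -/
def Args.map {O : Type} {S S' : Signature O} (c' : ∀ {s}, S.Con s → S'.Con s)
    (f' : ∀ {d ds s}, S.Fun d ds s → S'.Fun d ds s) : {l : List (Srt O)} → Args S l → Args S' l
  | _, .nil => .nil
  | _, .cons t a => .cons (t.map c' f') (a.map c' f')
end

/-- Translate a quantifier-free formula along maps of constant and function symbols. -/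
def QF.map {O : Type} {S S' : Signature O} (c' : ∀ {s}, S.Con s → S'.Con s)
    (f' : ∀ {d ds s}, S.Fun d ds s → S'.Fun d ds s) : QF S → QF S'
  | .eq t₁ t₂ => .eq (t₁.map c' f') (t₂.map c' f')
  | .not φ => .not (φ.map c' f')
  | .or φ ψ => .or (φ.map c' f') (ψ.map c' f')
  | .and φ ψ => .and (φ.map c' f') (ψ.map c' f')
  | .imp φ ψ => .imp (φ.map c' f') (ψ.map c' f')

/-- Extend a signature by one new constant symbol of sort `r`. -/
def Signature.addCon {O : Type} [DecidableEq O] (S : Signature O) (r : Srt O) : Signature O where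
  Con s := S.Con s ⊕ {_x : Unit // s = r}
  Fun := S.Fun
  conDec _ := inferInstance
  conEnc _ := inferInstance
  funDec := S.funDec
  funEnc := S.funEnc

/-- Extend a signature by one new function symbol of sort `e × es₁ × ⋯ × esₖ → r`. -/
def Signature.addFun {O : Type} [DecidableEq O] (S : Signature O) (e : Srt O)
    (es : List (Srt O)) (r : Srt O) : Signature O where
  Con := S.Con
  Fun d ds s := S.Fun d ds s ⊕ {_x : Unit // d = e ∧ ds = es ∧ s = r}
  conDec := S.conDec
  conEnc := S.conEnc
  funDec _ _ _ := inferInstance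
  funEnc _ _ _ := inferInstance

/-- The tuple of the listed variables. -/
def varArgs {O : Type} (S : Signature O) : (xs : List (Var O)) → Args S (xs.map Prod.fst)
  | [] => .nil
  | x :: xs => .cons (.var x.2) (varArgs S xs)

/-- A sentence `∃ x₁, …, xₙ : matrix` in Herbrand normal form, with its signature. -/
structure HerbrandForm (O : Type) where
  sig : Signature O
  vars : List (Var O)
  matrix : QF sig

/-- Herbrandisation of `∃ xs, p : m` where `xs` are the existential variables passed so far.
A leading `∀ y` becomes a new constant, and `∃ x₁, …, xₙ ∀ y` with `n ≥ 1` turns `y` into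
`f(x₁, …, xₙ)` with a new function symbol `f`. -/
def herbrandise {O : Type} [DecidableEq O] :
    (S : Signature O) → (xs : List (Var O)) → (p : List (Quant × Var O)) → QF S → HerbrandForm O
  | S, xs, [], m => ⟨S, xs, m⟩
  | S, xs, (.ex, x) :: p, m => herbrandise S (xs ++ [x]) p m
  | S, [], (.all, y) :: p, m =>
    herbrandise (S.addCon y.1) [] p
      ((m.map (S := S) (S' := S.addCon y.1) Sum.inl id).subst
        (Subst.single y (.con (Sum.inr ⟨(), rfl⟩))))
  | S, x :: xs, (.all, y) :: p, m =>
    herbrandise (S.addFun x.1 (xs.map Prod.fst) y.1) (x :: xs) p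
      ((m.map (S := S) (S' := S.addFun x.1 (xs.map Prod.fst) y.1) id Sum.inl).subst
        (Subst.single y
          (.app (d := x.1) (ds := xs.map Prod.fst) (Sum.inr ⟨(), rfl, rfl, rfl⟩)
            (varArgs _ (x :: xs)))))

/-- The Herbrand normal form `φᴴ` of a formula: universal closure, prenexing, Herbrandisation. -/
def Formula.herbrandForm {O : Type} [DecidableEq O] {S : Signature O} (φ : Formula S) :
    HerbrandForm O :=
  herbrandise S [] φ.closure.prenex.1 φ.closure.prenex.2

/-- The Herbrand expansion: all ground instances of the matrix. -/
def HerbrandForm.expansion {O : Type} (h : HerbrandForm O) : Set (QF h.sig) :=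
  {ψ | ∃ θ : Subst h.sig, (∀ x ∈ h.vars, (θ x).IsGround) ∧ (∀ x ∉ h.vars, θ x = .var x.2) ∧
    ψ = h.matrix.subst θ}

/-- `e 0, e 1, …` is an enumeration (possibly with repetitions) of the Herbrand expansion. -/
def HerbrandForm.IsEnumeration {O : Type} (h : HerbrandForm O) (e : ℕ → QF h.sig) : Prop :=
  Set.range e = h.expansion

/-! ### A concrete enumeration of the Herbrand expansion -/

/-- The tuple of terms with code `m`, given a term for every code. -/
def decodeArgs {O : Type} {S : Signature O} (g : (s : Srt O) → ℕ → Term S s) :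
    (l : List (Srt O)) → ℕ → Args S l
  | [], _ => .nil
  | s :: l, m => .cons (g s m.unpair.1) (decodeArgs g l m.unpair.2)

/-- The ground term of sort `s` with code `m`, cut off by zeros at depth `n`. The first component
of a code selects the outermost symbol. -/
def groundTerm {O : Type} [Encodable O] (S : Signature O) :
    (n : ℕ) → (s : Srt O) → (m : ℕ) → Term S s
  | 0, _, _ => .zero
  | n + 1, s, m =>
    let r := m.unpair.2
    match m.unpair.1 with
    | 0 => .zero
    | 1 =>
      match (Encodable.decode r : Option (S.Con s)) with
      | some c => .con c
      | none => .zero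
    | 2 => .neg (groundTerm S n s r)
    | 3 => .add (groundTerm S n s r.unpair.1) (groundTerm S n s r.unpair.2)
    | 4 =>
      match (Encodable.decode r.unpair.1 : Option O) with
      | some o =>
        .mul (groundTerm S n (o, s.2) r.unpair.2.unpair.1)
          (groundTerm S n (s.1, o) r.unpair.2.unpair.2)
      | none => .zero
    | _ =>
      match (Encodable.decode r.unpair.1 :
          Option ((d : Srt O) × (ds : List (Srt O)) × S.Fun d ds s)) with
      | some f => .app f.2.2 (decodeArgs (fun s' m' => groundTerm S n s' m') (f.1 :: f.2.1)
          r.unpair.2)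
      | none => .zero

/-- The substitution of the listed variables with code `m`, given a term for every code. -/
def decodeSubst {O : Type} [DecidableEq O] {S : Signature O} (g : (s : Srt O) → ℕ → Term S s) :
    List (Var O) → ℕ → Subst S
  | [], _ => fun x => .var x.2
  | x :: xs, m => Function.update (decodeSubst g xs m.unpair.2) x (g x.1 m.unpair.1)

/-- A concrete enumeration of the Herbrand expansion: the number `⟨n, m⟩` stands for the instance
by the ground terms that are coded in `m` and cut off at depth `n`. -/
def HerbrandForm.enumerate {O : Type} [DecidableEq O] [Encodable O] (h : HerbrandForm O) (i : ℕ) :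
    QF h.sig :=
  h.matrix.subst (decodeSubst (groundTerm h.sig i.unpair.1) h.vars i.unpair.2)

/-! ### Ackermann's reduction -/

/-- Extend a signature by a supply `d₀, d₁, …` of new constant symbols of every sort. -/
def Signature.fresh {O : Type} (S : Signature O) : Signature O where
  Con s := S.Con s ⊕ ℕ
  Fun := S.Fun
  conDec _ := inferInstance
  conEnc _ := inferInstance
  funDec := S.funDec
  funEnc := S.funEnc

/-- The new constant symbol `dᵢ` of sort `s`. -/
def freshCon {O : Type} (S : Signature O) {s : Srt O} (i : ℕ) : Term S.fresh s :=
  .con (Sum.inr i)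

/-- Non-arithmetic function symbols together with their sorts. -/
abbrev Sym {O : Type} (S : Signature O) : Type :=
  (d : Srt O) × (ds : List (Srt O)) × (s : Srt O) × S.Fun d ds s

mutual
/-- The non-arithmetic function symbols occurring in a term. -/
def Term.syms {O : Type} {S : Signature O} : {s : Srt O} → Term S s → List (Sym S)
  | _, .var _ => []
  | _, .con _ => []
  | _, .zero => []
  | _, .neg t => t.syms
  | _, .add t₁ t₂ => t₁.syms ++ t₂.syms
  | _, .mul t₁ t₂ => t₁.syms ++ t₂.syms
  | _, .app f a => ⟨_, _, _, f⟩ :: a.syms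
/-- The non-arithmetic function symbols occurring in a tuple of terms. -/
def Args.syms {O : Type} {S : Signature O} : {l : List (Srt O)} → Args S l → List (Sym S)
  | _, .nil => []
  | _, .cons t a => t.syms ++ a.syms
end

/-- The non-arithmetic function symbols occurring in a quantifier-free formula. -/
def QF.syms {O : Type} {S : Signature O} : QF S → List (Sym S)
  | .eq t₁ t₂ => t₁.syms ++ t₂.syms
  | .not φ => φ.syms
  | .or φ ψ => φ.syms ++ ψ.syms
  | .and φ ψ => φ.syms ++ ψ.syms
  | .imp φ ψ => φ.syms ++ ψ.syms

/-- The argument tuples that the function symbol `F` takes. -/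
abbrev SymArgs {O : Type} {S : Signature O} (F : Sym S) : Type := Args S (F.1 :: F.2.1)

mutual
/-- The argument tuples of all instances of the function symbol `F` in a term, nested instances
included. -/
def Term.insts {O : Type} [DecidableEq O] {S : Signature O} (F : Sym S) :
    {s : Srt O} → Term S s → List (SymArgs F)
  | _, .var _ => []
  | _, .con _ => []
  | _, .zero => []
  | _, .neg t => t.insts F
  | _, .add t₁ t₂ => t₁.insts F ++ t₂.insts F
  | _, .mul t₁ t₂ => t₁.insts F ++ t₂.insts F
  | _, @Term.app _ _ d ds s f a =>
    (if h : (⟨d, ds, s, f⟩ : Sym S) = F then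
      [cast (congrArg SymArgs h) (a : SymArgs ⟨d, ds, s, f⟩)] else []) ++ a.insts F
/-- The argument tuples of all instances of the function symbol `F` in a tuple of terms. -/
def Args.insts {O : Type} [DecidableEq O] {S : Signature O} (F : Sym S) :
    {l : List (Srt O)} → Args S l → List (SymArgs F)
  | _, .nil => []
  | _, .cons t a => t.insts F ++ a.insts F
end

/-- The argument tuples of all instances of `F` in a quantifier-free formula. -/
def QF.insts {O : Type} [DecidableEq O] {S : Signature O} (F : Sym S) : QF S → List (SymArgs F)
  | .eq t₁ t₂ => t₁.insts F ++ t₂.insts F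
  | .not φ => φ.insts F
  | .or φ ψ => φ.insts F ++ ψ.insts F
  | .and φ ψ => φ.insts F ++ ψ.insts F
  | .imp φ ψ => φ.insts F ++ ψ.insts F

mutual
/-- Replace every outermost instance of `F` by the new constant `d_{k+i}`, where `i` is the index
of that instance in the list `L`. -/
def Term.ack {O : Type} [DecidableEq O] {S : Signature O} (F : Sym S.fresh)
    (L : List (SymArgs F)) (k : ℕ) : {s : Srt O} → Term S.fresh s → Term S.fresh s
  | _, .var n => .var n
  | _, .con c => .con c
  | _, .zero => .zero
  | _, .neg t => .neg (t.ack F L k)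
  | _, .add t₁ t₂ => .add (t₁.ack F L k) (t₂.ack F L k)
  | _, .mul t₁ t₂ => .mul (t₁.ack F L k) (t₂.ack F L k)
  | _, @Term.app _ _ d ds s f a =>
    if h : (⟨d, ds, s, f⟩ : Sym S.fresh) = F then
      freshCon S (k + L.idxOf (cast (congrArg SymArgs h) (a : SymArgs ⟨d, ds, s, f⟩)))
    else .app f (a.ack F L k)
/-- The same replacement in a tuple of terms. -/
def Args.ack {O : Type} [DecidableEq O] {S : Signature O} (F : Sym S.fresh)
    (L : List (SymArgs F)) (k : ℕ) : {l : List (Srt O)} → Args S.fresh l → Args S.fresh l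
  | _, .nil => .nil
  | _, .cons t a => .cons (t.ack F L k) (a.ack F L k)
end

/-- The same replacement in a quantifier-free formula; this gives `φ^flat`. -/
def QF.ack {O : Type} [DecidableEq O] {S : Signature O} (F : Sym S.fresh)
    (L : List (SymArgs F)) (k : ℕ) : QF S.fresh → QF S.fresh
  | .eq t₁ t₂ => .eq (t₁.ack F L k) (t₂.ack F L k)
  | .not φ => .not (φ.ack F L k)
  | .or φ ψ => .or (φ.ack F L k) (ψ.ack F L k)
  | .and φ ψ => .and (φ.ack F L k) (ψ.ack F L k)
  | .imp φ ψ => .imp (φ.ack F L k) (ψ.ack F L k)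

/-- The conjunction of a non-empty list of formulas, given by its head and its tail. -/
def conj {O : Type} {S : Signature O} : QF S → List (QF S) → QF S
  | φ, [] => φ
  | φ, ψ :: l => .and φ (conj ψ l)

/-- `(φ₁ ∧ ⋯ ∧ φₙ) → ψ`, which is `ψ` if there are no premises. -/
def impList {O : Type} {S : Signature O} : List (QF S) → QF S → QF S
  | [], ψ => ψ
  | φ :: l, ψ => .imp (conj φ l) ψ

/-- The componentwise equations between two tuples. -/
def argEqs {O : Type} {S : Signature O} : {l : List (Srt O)} → Args S l → Args S l → List (QF S)
  | _, .nil, .nil => []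
  | _, .cons t a, .cons t' a' => .eq t t' :: argEqs a a'

/-- Functional consistency: for all pairs of indexed argument tuples, equality of the (flattened)
arguments implies equality of the new constants. -/
def consistency {O : Type} [DecidableEq O] {S : Signature O} (F : Sym S.fresh)
    (L : List (SymArgs F)) (k : ℕ) : List (SymArgs F × ℕ) → List (QF S.fresh)
  | [] => []
  | (a, i) :: r =>
    (r.map fun b => impList (argEqs (a.ack F L k) (b.1.ack F L k))
      (.eq (freshCon S (s := F.2.2.1) i) (freshCon S (s := F.2.2.1) b.2))) ++ consistency F L k r

/-- Ackermann's reduction for one function symbol `F`; `k` is the index of the first unused new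
constant. Returns the next unused index and `φ^FC → φ^flat`. -/
def ackStep {O : Type} [DecidableEq O] {S : Signature O} (p : ℕ × QF S.fresh) (F : Sym S.fresh) :
    ℕ × QF S.fresh :=
  let L := (p.2.insts F).dedup
  (p.1 + L.length, impList (consistency F L p.1 (L.zipIdx p.1)) (p.2.ack F L p.1))

/-- Ackermann's reduction, removing all non-arithmetic function symbols one after the other. -/
def QF.ackermann {O : Type} [DecidableEq O] {S : Signature O} (ψ : QF S) : QF S.fresh :=
  let ψ' : QF S.fresh := ψ.map (S' := S.fresh) Sum.inl id
  (ψ'.syms.dedup.foldl ackStep (0, ψ')).2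

/-! ### Conjunctive normal form and idealisation -/

/-- Literals: the equation `lhs ≈ rhs`, or its negation if `positive` is false. -/
structure Literal {O : Type} (S : Signature O) where
  positive : Bool
  sort : Srt O
  lhs : Term S sort
  rhs : Term S sort

/-- Distribution of disjunction over conjunction. -/
def distribute {O : Type} {S : Signature O} (A B : List (List (Literal S))) :
    List (List (Literal S)) :=
  A.flatMap fun C => B.map fun D => C ++ D

/-- `ψ.cnf true` is the list of the clauses of `CNF(ψ)` and `ψ.cnf false` that of `CNF(¬ψ)`;
a clause is the list of its literals. -/
def QF.cnf {O : Type} {S : Signature O} : Bool → QF S → List (List (Literal S))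
  | b, .eq t₁ t₂ => [[⟨b, _, t₁, t₂⟩]]
  | b, .not φ => φ.cnf (!b)
  | true, .or φ ψ => distribute (φ.cnf true) (ψ.cnf true)
  | false, .or φ ψ => φ.cnf false ++ ψ.cnf false
  | true, .and φ ψ => φ.cnf true ++ ψ.cnf true
  | false, .and φ ψ => distribute (φ.cnf false) (ψ.cnf false)
  | true, .imp φ ψ => distribute (φ.cnf false) (ψ.cnf true)
  | false, .imp φ ψ => φ.cnf true ++ ψ.cnf false

/-- Noncommutative polynomials over `ℤ` in the indeterminates `x₀, x₁, …`, written as lists of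
coefficients with words. -/
abbrev Poly : Type := List (ℤ × List ℕ)

/-- The element of the free algebra that a list of coefficients and words stands for. -/
noncomputable def Poly.toFree (p : Poly) : FreeAlgebra ℤ ℕ :=
  (p.map fun m => m.1 • (m.2.map (FreeAlgebra.ι ℤ)).prod).sum

/-- The negative of a polynomial. -/
def Poly.neg (p : Poly) : Poly := p.map fun m => (-m.1, m.2)

/-- The product of two polynomials. -/
def Poly.mul (p q : Poly) : Poly :=
  p.flatMap fun m => q.map fun m' => (m.1 * m'.1, m.2 ++ m'.2)

/-- The coefficient of a word in a polynomial. -/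
def Poly.coeff (p : Poly) (w : List ℕ) : ℤ :=
  (p.map fun m => if m.2 = w then m.1 else 0).sum

/-- Test whether a polynomial is zero. -/
def Poly.isZero (p : Poly) : Bool := p.all fun m => p.coeff m.2 == 0

/-- Translation of arithmetic ground terms into polynomials. The indeterminate of a constant
symbol is numbered by the code of the symbol. (Variables and non-arithmetic function symbols do
not occur in arithmetic ground terms; they are sent to zero.) -/
def Term.toPoly {O : Type} [Encodable O] {S : Signature O} : {s : Srt O} → Term S s → Poly
  | _, .var _ => []
  | s, .con c => [(1, [Encodable.encode (⟨s, c⟩ : (s : Srt O) × S.Con s)])]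
  | _, .zero => []
  | _, .neg t => t.toPoly.neg
  | _, .add t₁ t₂ => t₁.toPoly ++ t₂.toPoly
  | _, .mul t₁ t₂ => t₁.toPoly.mul t₂.toPoly
  | _, .app _ _ => []

/-- The polynomial `t₁ - t₂` of a literal `t₁ ≈ t₂` or `¬ t₁ ≈ t₂`. -/
def Literal.toPoly {O : Type} [Encodable O] {S : Signature O} (l : Literal S) : Poly :=
  l.lhs.toPoly ++ l.rhs.toPoly.neg

/-! ### Semi-decision procedures for ideal membership -/

/-- An instance of the ideal membership problem: is `target` in the two-sided ideal generated by
`gens`? -/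
structure Query where
  gens : List Poly
  target : Poly

/-- The ideal membership holds. -/
def Query.Holds (q : Query) : Prop :=
  q.target.toFree ∈ TwoSidedIdeal.span {f : FreeAlgebra ℤ ℕ | ∃ g ∈ q.gens, f = g.toFree}

/-- A procedure for ideal membership queries, given by its states and its single operation. -/
structure MembershipProcedure where
  State : Type
  start : Query → State
  step : State → State
  accepts : State → Bool

/-- The procedure accepts the query after at most `n` operations. -/
def MembershipProcedure.verifies (P : MembershipProcedure) (n : ℕ) (q : Query) : Bool :=
  (List.range (n + 1)).any fun m => P.accepts (P.step^[m] (P.start q))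

/-- `P` is a semi-decision procedure for ideal membership: it accepts a query after finitely many
operations if and only if the membership holds. -/
def MembershipProcedure.IsSemiDecision (P : MembershipProcedure) : Prop :=
  ∀ q : Query, (∃ n, P.verifies n q = true) ↔ q.Holds

/-- `c` lists triples `(a, i, b)`, and the sum of all `a * gᵢ * b` is the target of the query. -/
def Query.checkCertificate (q : Query) (c : List (Poly × ℕ × Poly)) : Bool :=
  Poly.isZero (c.flatMap (fun t => (t.1.mul (q.gens.getD t.2.1 [])).mul t.2.2) ++ q.target.neg)

/-- The procedure that tests all potential certificates (representations of the target as a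
combination of the generators), one per operation. -/
def certificateSearch : MembershipProcedure where
  State := Query × ℕ × Bool
  start q := (q, 0, false)
  step σ := (σ.1, σ.2.1 + 1, σ.2.2 ||
    ((Encodable.decode (α := List (Poly × ℕ × Poly)) σ.2.1).map σ.1.checkCertificate).getD false)
  accepts σ := σ.2.2

/-- `I(C)` is verified with `n` operations of `P`, for a clause `C`: for some positive literal
`p ≈ q` of `C`, the procedure verifies within `n` operations that `p - q` lies in the ideal
generated by all `s - t` with `¬ s ≈ t` in `C`. -/
def verifiesClause {O : Type} [Encodable O] {S : Signature O} (P : MembershipProcedure) (n : ℕ)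
    (C : List (Literal S)) : Bool :=
  C.any fun l => l.positive &&
    P.verifies n ⟨(C.filter fun l' => !l'.positive).map Literal.toPoly, l.toPoly⟩

/-- `I(ψ) = ⊤` is verified with `n` operations of `P` (for each membership test). -/
def verifiesIdealisation {O : Type} [Encodable O] {S : Signature O} (P : MembershipProcedure)
    (n : ℕ) (ψ : QF S) : Bool :=
  (ψ.cnf true).all fun C => verifiesClause P n C

/-! ### The procedure -/

/-- The formulas `ψ₁, ψ₂, …` (here `h.psi e n` is `ψₙ₊₁`), where `e 0, e 1, …` enumerates the
Herbrand expansion of `h`. -/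
def HerbrandForm.psi {O : Type} (h : HerbrandForm O) (e : ℕ → QF h.sig) : ℕ → QF h.sig
  | 0 => e 0
  | n + 1 => if h.vars.isEmpty then h.psi e n else .or (h.psi e n) (e (n + 1))

/-- Configurations of the procedure: in the round `n` of the outer loop, with `k` passes through
the inner loop done; or terminated with output `⊤`. -/
inductive Config : Type
  | running (n k : ℕ) : Config
  | returnedTop : Config

/-- One step of the procedure: test `ψ_{k+1}^Ack` with `n` operations, or, if the inner loop of
round `n` is finished, enter round `n + 1`. -/
def HerbrandForm.step {O : Type} [DecidableEq O] [Encodable O] (h : HerbrandForm O)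
    (e : ℕ → QF h.sig) (P : MembershipProcedure) : Config → Config
  | .running n k =>
    if k < n then
      if verifiesIdealisation P n (h.psi e k).ackermann then .returnedTop else .running n (k + 1)
    else .running (n + 1) 0
  | .returnedTop => .returnedTop

/-- The configuration after `N` steps of the procedure on input `φ`, run with the enumeration `e`
of the Herbrand expansion of `φᴴ` and the ideal membership procedure `P`. -/
def Formula.run {O : Type} [DecidableEq O] [Encodable O] {S : Signature O} (φ : Formula S)
    (e : ℕ → QF φ.herbrandForm.sig) (P : MembershipProcedure) (N : ℕ) : Config :=
  (φ.herbrandForm.step e P)^[N] (.running 1 0)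

/-- The procedure terminates and outputs `⊤`. -/
def Formula.ReturnsTop {O : Type} [DecidableEq O] [Encodable O] {S : Signature O} (φ : Formula S)
    (e : ℕ → QF φ.herbrandForm.sig) (P : MembershipProcedure) : Prop :=
  ∃ N, φ.run e P N = .returnedTop

end OperatorLogic

namespace OperatorLogic

/-! ### Polynomials as lists and the certificate search -/

namespace Poly

-- The proof is a chain of equivalences from `Entails (axioms S) φ` to a finite verification. Each
-- link preserves validity in all preadditive semicategories, with unbound variables read as zero so
-- that one assignment suffices.
--
-- Herbrandisation is dual Skolemisation (`prefixValid_herbrandise`): if `∃ xs ∀ y` fails in a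
-- structure, the counterexamples `y` form a function of `xs`, and interpreting the new symbol by
-- this function refutes the Herbrandised sentence as well. Herbrand's theorem
-- (`HerbrandForm.prefixValid_iff`) is proved semantically. If no `ψₙ` is valid, take countermodels
-- `Bₙ` and, in a non-principal ultraproduct of them, the substructure consisting of the values of
-- terms. The axioms are equations, so they survive. Every witness there is named by a ground term,
-- so one instance of the matrix holds in almost all `Bₙ`; it is a disjunct of `ψₙ` for large `n`, a
-- contradiction.
--
-- Ackermann's reduction (`valid_ackStep_iff`) passes between an interpretation of `f` and values of
-- the new constants: constants can be set to the values of the instances, and constants that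
-- satisfy functional consistency define an `f`.
--
-- What remains is a conjunction of clauses of equations and disequations between arithmetic terms.
-- A valid clause is tested in one generic model, the quotient of the free algebra by the ideal of
-- the negative literals; the literal that is true there is positive and gives the membership
-- (`clauseIdealisation_of_valid`). Conversely, a membership in the free algebra may involve
-- products that are not well sorted and hence mean nothing in a semicategory. This is repaired by a
-- representation in an endomorphism ring that is faithful on a prescribed sort
-- (`Struct.IsPreadditive.exists_ring_representation`). A morphism acts by multiplication on columns
-- of morphisms with a fixed source, and a copy of `ℤ` supplies the missing identity.
--
-- Finally, verification is monotone in the number of operations, so the rounds of the procedure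
-- dovetail over all pairs of a formula `ψₖ` and a bound on operations (`Formula.returnsTop_iff`).

@[simp] theorem toFree_nil : Poly.toFree [] = 0 := rfl

theorem toFree_cons (m : ℤ × List ℕ) (p : Poly) :
    Poly.toFree (m :: p) = m.1 • (m.2.map (FreeAlgebra.ι ℤ)).prod + Poly.toFree p := by
  simp [Poly.toFree]

theorem toFree_append (p q : Poly) :
    Poly.toFree (p ++ q) = Poly.toFree p + Poly.toFree q := by
  simp [Poly.toFree]

theorem toFree_neg (p : Poly) : p.neg.toFree = -p.toFree := by
  induction p with
  | nil => simp [Poly.neg]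
  | cons m p ih =>
    have : Poly.neg (m :: p) = (-m.1, m.2) :: Poly.neg p := rfl
    rw [this, toFree_cons, toFree_cons, ih]
    simp only [neg_smul]
    abel

theorem toFree_monomial_mul (m : ℤ × List ℕ) (q : Poly) :
    Poly.toFree (q.map fun m' => (m.1 * m'.1, m.2 ++ m'.2)) =
      (m.1 • (m.2.map (FreeAlgebra.ι ℤ)).prod) * q.toFree := by
  induction q with
  | nil => simp
  | cons m' q ih =>
    rw [List.map_cons, toFree_cons, toFree_cons, ih, mul_add, List.map_append, List.prod_append,
      smul_mul_smul_comm]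

theorem toFree_mul (p q : Poly) : (p.mul q).toFree = p.toFree * q.toFree := by
  induction p with
  | nil => simp [Poly.mul]
  | cons m p ih =>
    have : Poly.mul (m :: p) q = (q.map fun m' => (m.1 * m'.1, m.2 ++ m'.2)) ++ Poly.mul p q := rfl
    rw [this, toFree_append, toFree_monomial_mul, toFree_cons, ih, add_mul]

theorem toFree_flatMap {α : Type} (l : List α) (f : α → Poly) :
    Poly.toFree (l.flatMap f) = (l.map fun a => (f a).toFree).sum := by
  induction l with
  | nil => simp
  | cons a l ih => rw [List.flatMap_cons, toFree_append, ih]; simp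

/-- Certificates consist of lists, so the cofactors of an arbitrary representation must be available
as lists. -/
theorem toFree_surjective : Function.Surjective Poly.toFree := by
  intro f
  induction f using FreeAlgebra.induction with
  | grade0 r => exact ⟨[(r, [])], by simp [Poly.toFree]⟩
  | grade1 x => exact ⟨[(1, [x])], by simp [Poly.toFree]⟩
  | mul a b ha hb =>
    obtain ⟨p, rfl⟩ := ha
    obtain ⟨q, rfl⟩ := hb
    exact ⟨p.mul q, toFree_mul p q⟩
  | add a b ha hb =>
    obtain ⟨p, rfl⟩ := ha
    obtain ⟨q, rfl⟩ := hb
    exact ⟨p ++ q, toFree_append p q⟩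

theorem equiv_prod_ι (w : List ℕ) :
    FreeAlgebra.equivMonoidAlgebraFreeMonoid (R := ℤ) ((w.map (FreeAlgebra.ι ℤ)).prod) =
      MonoidAlgebra.single (FreeMonoid.ofList w) 1 := by
  induction w with
  | nil => simp [MonoidAlgebra.one_def]
  | cons x w ih =>
    rw [List.map_cons, List.prod_cons, map_mul, ih]
    have : FreeAlgebra.equivMonoidAlgebraFreeMonoid (R := ℤ) (FreeAlgebra.ι ℤ x) =
        MonoidAlgebra.single (FreeMonoid.of x) 1 := by
      simp [FreeAlgebra.equivMonoidAlgebraFreeMonoid]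
    rw [this, MonoidAlgebra.single_mul_single]
    simp [FreeMonoid.ofList_cons]

/-- The words are a basis of the free algebra, seen through its isomorphism with the monoid algebra
of the free monoid; this makes list coefficients meaningful. -/
theorem equiv_toFree_apply (p : Poly) (w : List ℕ) :
    (FreeAlgebra.equivMonoidAlgebraFreeMonoid (R := ℤ) p.toFree).coeff (FreeMonoid.ofList w) =
      p.coeff w := by
  induction p with
  | nil => simp [Poly.coeff]
  | cons m p ih =>
    have hc : Poly.coeff (m :: p) w = (if m.2 = w then m.1 else 0) + Poly.coeff p w := rfl
    rw [toFree_cons, map_add, map_zsmul, equiv_prod_ι, hc, ← ih]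
    rcases eq_or_ne m.2 w with rfl | h
    · simp
    · simp [h, Finsupp.single_eq_of_ne' (FreeMonoid.ofList.injective.ne h)]

theorem coeff_eq_zero_of_forall_ne {p : Poly} {w : List ℕ} (h : ∀ m ∈ p, m.2 ≠ w) :
    p.coeff w = 0 := by
  unfold Poly.coeff
  apply List.sum_eq_zero
  intro x hx
  obtain ⟨m, hm, rfl⟩ := List.mem_map.1 hx
  simp [h m hm]

/-- Only the words occurring in the list need testing, since all other coefficients are empty sums.
Repeated words do no harm because `Poly.coeff` adds them up. -/
theorem isZero_iff (p : Poly) : p.isZero = true ↔ p.toFree = 0 := by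
  constructor
  · intro h
    apply (FreeAlgebra.equivMonoidAlgebraFreeMonoid (R := ℤ) (X := ℕ)).injective
    rw [map_zero]
    ext w
    have h2 := equiv_toFree_apply p w.toList
    rw [FreeMonoid.ofList_toList] at h2
    rw [h2]
    by_cases hw : ∃ m ∈ p, m.2 = w.toList
    · obtain ⟨m, hm, hmw⟩ := hw
      have := List.all_eq_true.1 h m hm
      rw [← hmw]
      simpa using this
    · push Not at hw
      simpa using coeff_eq_zero_of_forall_ne hw
  · intro h
    apply List.all_eq_true.2
    intro m _
    have := equiv_toFree_apply p m.2
    rw [h] at this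
    simpa using this.symm

end Poly

-- Certificates for ideal membership

theorem Query.checkCertificate_iff (q : Query) (c : List (Poly × ℕ × Poly)) :
    q.checkCertificate c = true ↔
      (c.map fun t => t.1.toFree * (q.gens.getD t.2.1 []).toFree * t.2.2.toFree).sum =
        q.target.toFree := by
  unfold Query.checkCertificate
  rw [Poly.isZero_iff, Poly.toFree_append, Poly.toFree_flatMap, Poly.toFree_neg,
    ← sub_eq_add_neg, sub_eq_zero]
  simp only [Poly.toFree_mul]

theorem mem_span_of_certificate (gens : List Poly) (c : List (Poly × ℕ × Poly)) :
    (c.map fun t => t.1.toFree * (gens.getD t.2.1 []).toFree * t.2.2.toFree).sum ∈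
      TwoSidedIdeal.span {f : FreeAlgebra ℤ ℕ | ∃ g ∈ gens, f = g.toFree} := by
  induction c with
  | nil => simp
  | cons t c ih =>
    rw [List.map_cons, List.sum_cons]
    refine TwoSidedIdeal.add_mem _ ?_ ih
    apply TwoSidedIdeal.mul_mem_right
    apply TwoSidedIdeal.mul_mem_left
    by_cases h : t.2.1 < gens.length
    · apply TwoSidedIdeal.subset_span
      refine ⟨_, List.getElem_mem h, ?_⟩
      rw [List.getD_eq_getElem _ _ h]
    -- An index out of range selects the zero polynomial, so malformed certificates are harmless.
    · rw [List.getD_eq_default _ _ (not_lt.1 h)]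
      exact TwoSidedIdeal.zero_mem _

/-- The two-sided ideal is the additive closure of the products `a * g * b`; sums concatenate
certificates, and a sign is absorbed by the left cofactor. -/
theorem exists_certificate {gens : List Poly} {f : FreeAlgebra ℤ ℕ}
    (hf : f ∈ TwoSidedIdeal.span {f : FreeAlgebra ℤ ℕ | ∃ g ∈ gens, f = g.toFree}) :
    ∃ c : List (Poly × ℕ × Poly),
      (c.map fun t => t.1.toFree * (gens.getD t.2.1 []).toFree * t.2.2.toFree).sum = f := by
  rw [TwoSidedIdeal.mem_span_iff_mem_addSubgroup_closure] at hf
  induction hf using AddSubgroup.closure_induction with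
  | mem x hx =>
    obtain ⟨y, ⟨a, -, g, ⟨p, hp, rfl⟩, rfl⟩, b, -, rfl⟩ := hx
    obtain ⟨a, rfl⟩ := Poly.toFree_surjective a
    obtain ⟨b, rfl⟩ := Poly.toFree_surjective b
    obtain ⟨i, hi, rfl⟩ := List.getElem_of_mem hp
    refine ⟨[(a, i, b)], ?_⟩
    simp [List.getElem?_eq_getElem hi]
  | zero => exact ⟨[], rfl⟩
  | add x y _ _ hx hy =>
    obtain ⟨c, rfl⟩ := hx
    obtain ⟨d, rfl⟩ := hy
    exact ⟨c ++ d, by simp⟩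
  | neg x _ hx =>
    obtain ⟨c, rfl⟩ := hx
    refine ⟨c.map fun t => (t.1.neg, t.2), ?_⟩
    rw [List.map_map, List.sum_neg]
    simp [Poly.toFree_neg, Function.comp_def]

theorem Query.holds_iff_exists_certificate (q : Query) :
    q.Holds ↔ ∃ c, q.checkCertificate c = true := by
  simp only [Query.checkCertificate_iff]
  constructor
  · exact exists_certificate
  · rintro ⟨c, hc⟩
    unfold Query.Holds
    rw [← hc]
    exact mem_span_of_certificate _ c

theorem MembershipProcedure.verifies_iff (P : MembershipProcedure) (n : ℕ) (q : Query) :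
    P.verifies n q = true ↔ ∃ m ≤ n, P.accepts (P.step^[m] (P.start q)) = true := by
  simp [MembershipProcedure.verifies]

theorem MembershipProcedure.verifies_mono (P : MembershipProcedure) {n n' : ℕ} (h : n ≤ n')
    {q : Query} (hq : P.verifies n q = true) : P.verifies n' q = true := by
  rw [MembershipProcedure.verifies_iff] at hq ⊢
  obtain ⟨m, hm, ha⟩ := hq
  exact ⟨m, hm.trans h, ha⟩

/-- Loop invariant of the search: after `n` operations exactly the codes below `n` have been tested.
-/
theorem certificateSearch_iterate (q : Query) (n : ℕ) :
    (certificateSearch.step^[n] (certificateSearch.start q) : Query × ℕ × Bool).1 = q ∧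
    (certificateSearch.step^[n] (certificateSearch.start q) : Query × ℕ × Bool).2.1 = n ∧
    ((certificateSearch.step^[n] (certificateSearch.start q) : Query × ℕ × Bool).2.2 = true ↔
      ∃ m < n, ((Encodable.decode (α := List (Poly × ℕ × Poly)) m).map
        q.checkCertificate).getD false = true) := by
  induction n with
  | zero => exact ⟨rfl, rfl, by simp [certificateSearch]⟩
  | succ n ih =>
    rw [Function.iterate_succ_apply']
    generalize certificateSearch.step^[n] (certificateSearch.start q) = σ at ih
    obtain ⟨q', n', b⟩ := σ
    obtain ⟨rfl, rfl, h⟩ := ih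
    refine ⟨rfl, rfl, ?_⟩
    change (b || _) = true ↔ _
    rw [Bool.or_eq_true]
    change b = true ↔ _ at h
    rw [h]
    constructor
    · rintro (⟨m, hm, hc⟩ | hc)
      · exact ⟨m, by omega, hc⟩
      · exact ⟨_, Nat.lt_succ_self _, hc⟩
    · rintro ⟨m, hm, hc⟩
      rcases Nat.lt_succ_iff_lt_or_eq.1 hm with hm | rfl
      · exact Or.inl ⟨m, hm, hc⟩
      · exact Or.inr hc

theorem certificateSearch_isSemiDecision : certificateSearch.IsSemiDecision := by
  intro q
  rw [Query.holds_iff_exists_certificate]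
  constructor
  · rintro ⟨n, hn⟩
    obtain ⟨m, -, hm⟩ := (MembershipProcedure.verifies_iff _ _ _).1 hn
    obtain ⟨j, -, hj⟩ := (certificateSearch_iterate q m).2.2.1 hm
    cases hd : (Encodable.decode (α := List (Poly × ℕ × Poly)) j) with
    | none => rw [hd] at hj; simp at hj
    | some c => exact ⟨c, by rw [hd] at hj; simpa using hj⟩
  · rintro ⟨c, hc⟩
    -- The certificate with code `j` is tested by the transition from state `j` to state `j + 1`.
    refine ⟨Encodable.encode c + 1, (MembershipProcedure.verifies_iff _ _ _).2 ⟨_, le_rfl, ?_⟩⟩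
    exact (certificateSearch_iterate q _).2.2.2
      ⟨_, Nat.lt_succ_self _, by simp [hc]⟩

/-! ### The enumeration of the Herbrand expansion -/

section Enumeration

variable {O : Type} {S : Signature O}

theorem decodeArgs_vars {g : (s : Srt O) → ℕ → Term S s} (hg : ∀ s m, (g s m).vars = []) :
    ∀ (l : List (Srt O)) (m : ℕ), (decodeArgs g l m).vars = []
  | [], _ => rfl
  | s :: l, m => by
    simp [decodeArgs, Args.vars, hg, decodeArgs_vars hg l]

theorem groundTerm_isGround [Encodable O] (n : ℕ) :
    ∀ (s : Srt O) (m : ℕ), (groundTerm S n s m).IsGround := by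
  unfold Term.IsGround
  induction n with
  | zero => intro s m; simp [groundTerm, Term.vars]
  | succ n ih =>
    intro s m
    rw [groundTerm]
    split
    · rfl
    · split <;> rfl
    · simp [Term.vars, ih]
    · simp [Term.vars, ih]
    · split
      · simp [Term.vars, ih]
      · rfl
    · split
      · rw [Term.vars]
        exact decodeArgs_vars ih _ _
      · rfl

mutual
-- The code must work at every sufficiently large depth, not just at one: subterms have different
-- depths, and a common cut-off is needed to combine them.
theorem Term.exists_code [Encodable O] : ∀ {s : Srt O} (t : Term S s), t.vars = [] →
    ∃ m n₀, ∀ n ≥ n₀, groundTerm S n s m = t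
  | _, .var _, h => by simp [Term.vars] at h
  | _, .con c, _ => by
    refine ⟨Nat.pair 1 (Encodable.encode c), 1, fun n hn => ?_⟩
    obtain ⟨n, rfl⟩ := Nat.exists_eq_add_of_le' hn
    simp [groundTerm]
  | _, .zero, _ => by
    refine ⟨Nat.pair 0 0, 0, fun n _ => ?_⟩
    cases n <;> simp [groundTerm]
  | _, .neg t, h => by
    obtain ⟨m, n₀, hm⟩ := Term.exists_code t (by simpa [Term.vars] using h)
    refine ⟨Nat.pair 2 m, n₀ + 1, fun n hn => ?_⟩
    obtain ⟨n, rfl⟩ := Nat.exists_eq_add_of_le' (le_of_add_le_right hn)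
    simp [groundTerm, hm n (by omega)]
  | _, .add t₁ t₂, h => by
    simp only [Term.vars, List.append_eq_nil_iff] at h
    obtain ⟨m₁, n₁, h₁⟩ := Term.exists_code t₁ h.1
    obtain ⟨m₂, n₂, h₂⟩ := Term.exists_code t₂ h.2
    refine ⟨Nat.pair 3 (Nat.pair m₁ m₂), n₁ + n₂ + 1, fun n hn => ?_⟩
    obtain ⟨n, rfl⟩ := Nat.exists_eq_add_of_le' (le_of_add_le_right hn)
    simp [groundTerm, h₁ n (by omega), h₂ n (by omega)]
  | _, @Term.mul _ _ u v o t₁ t₂, h => by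
    simp only [Term.vars, List.append_eq_nil_iff] at h
    obtain ⟨m₁, n₁, h₁⟩ := Term.exists_code t₁ h.1
    obtain ⟨m₂, n₂, h₂⟩ := Term.exists_code t₂ h.2
    refine ⟨Nat.pair 4 (Nat.pair (Encodable.encode o) (Nat.pair m₁ m₂)), n₁ + n₂ + 1,
      fun n hn => ?_⟩
    obtain ⟨n, rfl⟩ := Nat.exists_eq_add_of_le' (le_of_add_le_right hn)
    simp [groundTerm, h₁ n (by omega), h₂ n (by omega)]
  | s, @Term.app _ _ d ds _ f a, h => by
    obtain ⟨m, n₀, hm⟩ := Args.exists_code a (by simpa [Term.vars] using h)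
    refine ⟨Nat.pair 5 (Nat.pair (Encodable.encode
      (⟨d, ds, f⟩ : (d : Srt O) × (ds : List (Srt O)) × S.Fun d ds s)) m), n₀ + 1,
      fun n hn => ?_⟩
    obtain ⟨n, rfl⟩ := Nat.exists_eq_add_of_le' (le_of_add_le_right hn)
    have := hm n (by omega)
    rw [groundTerm]
    simp only [Nat.unpair_pair, Encodable.encodek]
    exact congrArg _ this
theorem Args.exists_code [Encodable O] : ∀ {l : List (Srt O)} (a : Args S l), a.vars = [] →
    ∃ m n₀, ∀ n ≥ n₀, decodeArgs (groundTerm S n) l m = a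
  | _, .nil, _ => ⟨0, 0, fun _ _ => rfl⟩
  | _, .cons t a, h => by
    simp only [Args.vars, List.append_eq_nil_iff] at h
    obtain ⟨m₁, n₁, h₁⟩ := Term.exists_code t h.1
    obtain ⟨m₂, n₂, h₂⟩ := Args.exists_code a h.2
    refine ⟨Nat.pair m₁ m₂, n₁ + n₂, fun n hn => ?_⟩
    simp [decodeArgs, h₁ n (by omega), h₂ n (by omega)]
end

theorem decodeSubst_isGround [DecidableEq O] {g : (s : Srt O) → ℕ → Term S s}
    (hg : ∀ s m, (g s m).IsGround) (xs : List (Var O)) (m : ℕ) :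
    ∀ x ∈ xs, (decodeSubst g xs m x).IsGround := by
  induction xs generalizing m with
  | nil => simp
  | cons y xs ih =>
    intro x hx
    rw [decodeSubst]
    rcases eq_or_ne x y with rfl | hxy
    · simpa using hg _ _
    · rw [Function.update_of_ne hxy]
      exact ih _ x ((List.mem_cons.1 hx).resolve_left hxy)

theorem decodeSubst_of_notMem [DecidableEq O] (g : (s : Srt O) → ℕ → Term S s)
    (xs : List (Var O)) (m : ℕ) : ∀ x ∉ xs, decodeSubst g xs m x = .var x.2 := by
  induction xs generalizing m with
  | nil => intro x _; rfl
  | cons y xs ih =>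
    intro x hx
    rw [List.mem_cons, not_or] at hx
    rw [decodeSubst, Function.update_of_ne hx.1, ih _ x hx.2]

theorem exists_decodeSubst [DecidableEq O] [Encodable O] (xs : List (Var O)) (θ : Subst S)
    (hθ : ∀ x ∈ xs, (θ x).IsGround) :
    ∃ m n₀, ∀ n ≥ n₀, ∀ x ∈ xs, decodeSubst (groundTerm S n) xs m x = θ x := by
  induction xs with
  | nil => exact ⟨0, 0, by simp⟩
  | cons y xs ih =>
    obtain ⟨m₁, n₁, h₁⟩ := ih fun x hx => hθ x (List.mem_cons_of_mem _ hx)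
    obtain ⟨m₂, n₂, h₂⟩ := Term.exists_code (θ y) (hθ y List.mem_cons_self)
    refine ⟨Nat.pair m₂ m₁, n₁ + n₂, fun n hn x hx => ?_⟩
    rw [decodeSubst, Nat.unpair_pair]
    rcases eq_or_ne x y with rfl | hxy
    · simpa using h₂ n (by omega)
    · rw [Function.update_of_ne hxy]
      exact h₁ n (by omega) x ((List.mem_cons.1 hx).resolve_left hxy)

theorem HerbrandForm.isEnumeration_enumerate [DecidableEq O] [Encodable O] (h : HerbrandForm O) :
    h.IsEnumeration h.enumerate := by
  ext ψ
  constructor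
  · rintro ⟨i, rfl⟩
    exact ⟨_, decodeSubst_isGround (groundTerm_isGround _) _ _, decodeSubst_of_notMem _ _ _, rfl⟩
  · rintro ⟨θ, hθ, hθ', rfl⟩
    obtain ⟨m, n, hm⟩ := exists_decodeSubst h.vars θ hθ
    refine ⟨Nat.pair n m, ?_⟩
    rw [HerbrandForm.enumerate, Nat.unpair_pair]
    congr 1
    funext x
    by_cases hx : x ∈ h.vars
    · exact hm n le_rfl x hx
    · rw [hθ' x hx, decodeSubst_of_notMem _ _ _ x hx]

end Enumeration

/-! ### Semantics of terms and quantifier-free formulas -/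

section Semantics

variable {O : Type} {S : Signature O}

/-- The truth value of a quantifier-free formula. -/
def QF.Holds (A : Struct.{w} S) (M : A.Assignment) : QF S → Prop
  | .eq t₁ t₂ => t₁.eval A M = t₂.eval A M
  | .not φ => ¬ φ.Holds A M
  | .or φ ψ => φ.Holds A M ∨ ψ.Holds A M
  | .and φ ψ => φ.Holds A M ∧ ψ.Holds A M
  | .imp φ ψ => φ.Holds A M → ψ.Holds A M

/-- The variables occurring in a quantifier-free formula. -/
def QF.vars : QF S → List (Var O)
  | .eq t₁ t₂ => t₁.vars ++ t₂.vars
  | .not φ => φ.vars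
  | .or φ ψ => φ.vars ++ ψ.vars
  | .and φ ψ => φ.vars ++ ψ.vars
  | .imp φ ψ => φ.vars ++ ψ.vars

/-- The assignment that sends every variable to zero. -/
def Struct.zeroAssignment (A : Struct.{w} S) : A.Assignment := fun x => A.zero x.1

/-- The structure over `S` obtained from a structure over `S'` along maps of symbols. -/
def Struct.reduct {S S' : Signature O} (c' : ∀ {s}, S.Con s → S'.Con s)
    (f' : ∀ {d ds s}, S.Fun d ds s → S'.Fun d ds s) (B : Struct.{w} S') : Struct.{w} S where
  dom := B.dom
  nonempty := B.nonempty
  con c := B.con (c' c)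
  zero := B.zero
  neg := B.neg
  add := B.add
  mul := B.mul
  app f := B.app (f' f)

mutual
theorem Term.eval_congr (A : Struct.{w} S) {M M' : A.Assignment} :
    ∀ {s : Srt O} (t : Term S s), (∀ x ∈ t.vars, M x = M' x) → t.eval A M = t.eval A M'
  | s, .var n, h => h (s, n) (by simp [Term.vars])
  | _, .con c, _ => rfl
  | _, .zero, _ => rfl
  | _, .neg t, h => congrArg A.neg (Term.eval_congr A t h)
  | _, .add t₁ t₂, h => by
    simp only [Term.vars, List.mem_append] at h
    exact congrArg₂ A.add (Term.eval_congr A t₁ fun x hx => h x (Or.inl hx))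
      (Term.eval_congr A t₂ fun x hx => h x (Or.inr hx))
  | _, .mul t₁ t₂, h => by
    simp only [Term.vars, List.mem_append] at h
    exact congrArg₂ A.mul (Term.eval_congr A t₁ fun x hx => h x (Or.inl hx))
      (Term.eval_congr A t₂ fun x hx => h x (Or.inr hx))
  | _, .app f a, h => congrArg (A.app f) (Args.eval_congr A a h)
theorem Args.eval_congr (A : Struct.{w} S) {M M' : A.Assignment} :
    ∀ {l : List (Srt O)} (a : Args S l), (∀ x ∈ a.vars, M x = M' x) → a.eval A M = a.eval A M'
  | _, .nil, _ => rfl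
  | _, .cons t a, h => by
    simp only [Args.vars, List.mem_append] at h
    exact congrArg₂ Prod.mk (Term.eval_congr A t fun x hx => h x (Or.inl hx))
      (Args.eval_congr A a fun x hx => h x (Or.inr hx))
end

mutual
theorem Term.eval_subst (A : Struct.{w} S) (M : A.Assignment) (θ : Subst S) :
    ∀ {s : Srt O} (t : Term S s),
      (t.subst θ).eval A M = t.eval A (fun x => (θ x).eval A M)
  | _, .var _ => rfl
  | _, .con _ => rfl
  | _, .zero => rfl
  | _, .neg t => congrArg A.neg (Term.eval_subst A M θ t)
  | _, .add t₁ t₂ => congrArg₂ A.add (Term.eval_subst A M θ t₁) (Term.eval_subst A M θ t₂)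
  | _, .mul t₁ t₂ => congrArg₂ A.mul (Term.eval_subst A M θ t₁) (Term.eval_subst A M θ t₂)
  | _, .app f a => congrArg (A.app f) (Args.eval_subst A M θ a)
theorem Args.eval_subst (A : Struct.{w} S) (M : A.Assignment) (θ : Subst S) :
    ∀ {l : List (Srt O)} (a : Args S l),
      (a.subst θ).eval A M = a.eval A (fun x => (θ x).eval A M)
  | _, .nil => rfl
  | _, .cons t a => congrArg₂ Prod.mk (Term.eval_subst A M θ t) (Args.eval_subst A M θ a)
end

mutual
theorem Term.eval_map {S S' : Signature O} (c' : ∀ {s}, S.Con s → S'.Con s)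
    (f' : ∀ {d ds s}, S.Fun d ds s → S'.Fun d ds s) (B : Struct.{w} S') (M : B.Assignment) :
    ∀ {s : Srt O} (t : Term S s), (t.map c' f').eval B M = t.eval (B.reduct c' f') M
  | _, .var _ => rfl
  | _, .con _ => rfl
  | _, .zero => rfl
  | _, .neg t => congrArg B.neg (Term.eval_map c' f' B M t)
  | _, .add t₁ t₂ => congrArg₂ B.add (Term.eval_map c' f' B M t₁) (Term.eval_map c' f' B M t₂)
  | _, .mul t₁ t₂ => congrArg₂ B.mul (Term.eval_map c' f' B M t₁) (Term.eval_map c' f' B M t₂)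
  | _, .app f a => congrArg (B.app (f' f)) (Args.eval_map c' f' B M a)
theorem Args.eval_map {S S' : Signature O} (c' : ∀ {s}, S.Con s → S'.Con s)
    (f' : ∀ {d ds s}, S.Fun d ds s → S'.Fun d ds s) (B : Struct.{w} S') (M : B.Assignment) :
    ∀ {l : List (Srt O)} (a : Args S l), (a.map c' f').eval B M = a.eval (B.reduct c' f') M
  | _, .nil => rfl
  | _, .cons t a => congrArg₂ Prod.mk (Term.eval_map c' f' B M t) (Args.eval_map c' f' B M a)
end

mutual
theorem Term.mem_vars_subst (θ : Subst S) {x : Var O} :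
    ∀ {s : Srt O} (t : Term S s), x ∈ (t.subst θ).vars → ∃ y ∈ t.vars, x ∈ (θ y).vars
  | s, .var n, h => ⟨(s, n), by simp [Term.vars], h⟩
  | _, .con _, h => by simp [Term.subst, Term.vars] at h
  | _, .zero, h => by simp [Term.subst, Term.vars] at h
  | _, .neg t, h => Term.mem_vars_subst θ t h
  | _, .add t₁ t₂, h => by
    simp only [Term.subst, Term.vars, List.mem_append] at h ⊢
    rcases h with h | h
    · obtain ⟨y, hy, hx⟩ := Term.mem_vars_subst θ t₁ h
      exact ⟨y, Or.inl hy, hx⟩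
    · obtain ⟨y, hy, hx⟩ := Term.mem_vars_subst θ t₂ h
      exact ⟨y, Or.inr hy, hx⟩
  | _, .mul t₁ t₂, h => by
    simp only [Term.subst, Term.vars, List.mem_append] at h ⊢
    rcases h with h | h
    · obtain ⟨y, hy, hx⟩ := Term.mem_vars_subst θ t₁ h
      exact ⟨y, Or.inl hy, hx⟩
    · obtain ⟨y, hy, hx⟩ := Term.mem_vars_subst θ t₂ h
      exact ⟨y, Or.inr hy, hx⟩
  | _, .app f a, h => Args.mem_vars_subst θ a h
theorem Args.mem_vars_subst (θ : Subst S) {x : Var O} :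
    ∀ {l : List (Srt O)} (a : Args S l), x ∈ (a.subst θ).vars → ∃ y ∈ a.vars, x ∈ (θ y).vars
  | _, .nil, h => by simp [Args.subst, Args.vars] at h
  | _, .cons t a, h => by
    simp only [Args.subst, Args.vars, List.mem_append] at h ⊢
    rcases h with h | h
    · obtain ⟨y, hy, hx⟩ := Term.mem_vars_subst θ t h
      exact ⟨y, Or.inl hy, hx⟩
    · obtain ⟨y, hy, hx⟩ := Args.mem_vars_subst θ a h
      exact ⟨y, Or.inr hy, hx⟩
end

theorem QF.holds_congr (A : Struct.{w} S) {M M' : A.Assignment} (m : QF S)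
    (h : ∀ x ∈ m.vars, M x = M' x) : m.Holds A M ↔ m.Holds A M' := by
  induction m with
  | eq t₁ t₂ =>
    simp only [QF.vars, List.mem_append] at h
    rw [QF.Holds, QF.Holds, t₁.eval_congr A fun x hx => h x (Or.inl hx),
      t₂.eval_congr A fun x hx => h x (Or.inr hx)]
  | not φ ih => exact not_congr (ih h)
  | or φ ψ ih₁ ih₂ | and φ ψ ih₁ ih₂ | imp φ ψ ih₁ ih₂ =>
    simp only [QF.vars, List.mem_append] at h
    simp only [QF.Holds, ih₁ fun x hx => h x (Or.inl hx), ih₂ fun x hx => h x (Or.inr hx)]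

theorem QF.holds_subst (A : Struct.{w} S) (M : A.Assignment) (θ : Subst S) (m : QF S) :
    (m.subst θ).Holds A M ↔ m.Holds A (fun x => (θ x).eval A M) := by
  induction m with
  | eq t₁ t₂ => simp only [QF.subst, QF.Holds, Term.eval_subst]
  | not φ ih => simp only [QF.subst, QF.Holds, ih]
  | or φ ψ ih₁ ih₂ | and φ ψ ih₁ ih₂ | imp φ ψ ih₁ ih₂ =>
    simp only [QF.subst, QF.Holds, ih₁, ih₂]

theorem QF.holds_map {S S' : Signature O} (c' : ∀ {s}, S.Con s → S'.Con s)
    (f' : ∀ {d ds s}, S.Fun d ds s → S'.Fun d ds s) (B : Struct.{w} S') (M : B.Assignment)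
    (m : QF S) : (m.map c' f').Holds B M ↔ m.Holds (B.reduct c' f') M := by
  induction m with
  | eq t₁ t₂ => simp only [QF.map, QF.Holds, Term.eval_map]; exact Iff.rfl
  | not φ ih => simp only [QF.map, QF.Holds, ih]
  | or φ ψ ih₁ ih₂ | and φ ψ ih₁ ih₂ | imp φ ψ ih₁ ih₂ =>
    simp only [QF.map, QF.Holds, ih₁, ih₂]

theorem Formula.holds_congr [DecidableEq O] (A : Struct.{w} S) (φ : Formula S)
    {M M' : A.Assignment} (h : ∀ x ∈ φ.freeVars, M x = M' x) : φ.Holds A M ↔ φ.Holds A M' := by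
  induction φ generalizing M M' with
  | eq t₁ t₂ =>
    simp only [Formula.freeVars, List.mem_append] at h
    rw [Formula.Holds, Formula.Holds, t₁.eval_congr A fun x hx => h x (Or.inl hx),
      t₂.eval_congr A fun x hx => h x (Or.inr hx)]
  | not φ ih => exact not_congr (ih h)
  | or φ ψ ih₁ ih₂ | and φ ψ ih₁ ih₂ | imp φ ψ ih₁ ih₂ =>
    simp only [Formula.freeVars, List.mem_append] at h
    simp only [Formula.Holds, ih₁ fun x hx => h x (Or.inl hx), ih₂ fun x hx => h x (Or.inr hx)]
  | ex s n φ ih =>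
    refine exists_congr fun a => ih fun x hx => ?_
    by_cases hxs : x = (s, n)
    · subst hxs; simp
    · rw [Function.update_of_ne hxs, Function.update_of_ne hxs]
      exact h x (by simp [Formula.freeVars, hx, hxs])
  | all s n φ ih =>
    refine forall_congr' fun a => ih fun x hx => ?_
    by_cases hxs : x = (s, n)
    · subst hxs; simp
    · rw [Function.update_of_ne hxs, Function.update_of_ne hxs]
      exact h x (by simp [Formula.freeVars, hx, hxs])

/-- The structure is a preadditive semicategory. -/
structure Struct.IsPreadditive (A : Struct.{w} S) : Prop where
  mul_assoc : ∀ {u u' v' v : O} (a : A.dom (v', v)) (b : A.dom (u', v')) (c : A.dom (u, u')),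
    A.mul a (A.mul b c) = A.mul (A.mul a b) c
  add_assoc : ∀ {s : Srt O} (a b c : A.dom s), A.add a (A.add b c) = A.add (A.add a b) c
  add_zero : ∀ {s : Srt O} (a : A.dom s), A.add a (A.zero s) = a
  add_neg : ∀ {s : Srt O} (a : A.dom s), A.add a (A.neg a) = A.zero s
  add_comm : ∀ {s : Srt O} (a b : A.dom s), A.add a b = A.add b a
  mul_add : ∀ {u v' v : O} (a : A.dom (v', v)) (b c : A.dom (u, v')),
    A.mul a (A.add b c) = A.add (A.mul a b) (A.mul a c)
  add_mul : ∀ {u v' v : O} (a b : A.dom (v', v)) (c : A.dom (u, v')),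
    A.mul (A.add a b) c = A.add (A.mul a c) (A.mul b c)

theorem holds_axiomsAt_iff [DecidableEq O] (A : Struct.{w} S) (M : A.Assignment)
    (u u' v v' : O) :
    (∀ α ∈ axiomsAt S u u' v v', α.Holds A M) ↔
      (∀ (a : A.dom (v', v)) (b : A.dom (u', v')) (c : A.dom (u, u')),
        A.mul a (A.mul b c) = A.mul (A.mul a b) c) ∧
      (∀ a b c : A.dom (u, v), A.add a (A.add b c) = A.add (A.add a b) c) ∧
      (∀ a : A.dom (u, v), A.add a (A.zero (u, v)) = a) ∧
      (∀ a : A.dom (u, v), A.add a (A.neg a) = A.zero (u, v)) ∧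
      (∀ a b : A.dom (u, v), A.add a b = A.add b a) ∧
      (∀ (a : A.dom (v', v)) (b c : A.dom (u, v')),
        A.mul a (A.add b c) = A.add (A.mul a b) (A.mul a c)) ∧
      (∀ (a b : A.dom (v', v)) (c : A.dom (u, v')),
        A.mul (A.add a b) c = A.add (A.mul a c) (A.mul b c)) := by
  simp [axiomsAt, Formula.Holds, Term.eval, Function.update_of_ne]

theorem holds_axioms_iff [DecidableEq O] (A : Struct.{w} S) (M : A.Assignment) :
    (∀ α ∈ axioms S, α.Holds A M) ↔ A.IsPreadditive := by
  have h : (∀ α ∈ axioms S, α.Holds A M) ↔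
      ∀ u u' v v', ∀ α ∈ axiomsAt S u u' v v', α.Holds A M := by
    simp only [axioms, Set.mem_iUnion]
    exact ⟨fun h u u' v v' α hα => h α ⟨u, u', v, v', hα⟩,
      fun h α ⟨u, u', v, v', hα⟩ => h u u' v v' α hα⟩
  rw [h]
  simp only [holds_axiomsAt_iff]
  constructor
  · intro h
    -- Each axiom involves only some of the four objects; the remaining ones are filled with objects
    -- at hand.
    exact {
      mul_assoc := fun {u u' v' v} => (h u u' v v').1
      add_assoc := fun {s} => (h s.1 s.1 s.2 s.2).2.1
      add_zero := fun {s} => (h s.1 s.1 s.2 s.2).2.2.1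
      add_neg := fun {s} => (h s.1 s.1 s.2 s.2).2.2.2.1
      add_comm := fun {s} => (h s.1 s.1 s.2 s.2).2.2.2.2.1
      mul_add := fun {u v' v} => (h u u v v').2.2.2.2.2.1
      add_mul := fun {u v' v} => (h u u v v').2.2.2.2.2.2 }
  · intro h u u' v v'
    exact ⟨h.mul_assoc, h.add_assoc, h.add_zero, h.add_neg, h.add_comm, h.mul_add, h.add_mul⟩

theorem entails_axioms_iff [DecidableEq O] (φ : Formula S) :
    Entails.{w} (axioms S) φ ↔
      ∀ A : Struct.{w} S, A.IsPreadditive → ∀ M : A.Assignment, φ.Holds A M := by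
  simp only [Entails, holds_axioms_iff]
  exact ⟨fun h A hA M => h A M hA, fun h A M hA => h A hA M⟩

end Semantics

/-! ### Universal closure and prenex normal form -/

section Prenex

variable {O : Type} {S : Signature O}

theorem mem_dualPrefix {p : List (Quant × Var O)} {r : Quant × Var O} (h : r ∈ dualPrefix p) :
    ∃ q ∈ p, q.2 = r.2 := by
  obtain ⟨q, hq, rfl⟩ := List.mem_map.1 h
  exact ⟨q, hq, rfl⟩

theorem Term.mem_vars_rename {ρ : Var O → ℕ} {x : Var O} {s : Srt O} {t : Term S s}
    (h : x ∈ (t.subst fun x => .var (ρ x)).vars) : ∃ y ∈ t.vars, x = (y.1, ρ y) := by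
  obtain ⟨y, hy, hx⟩ := Term.mem_vars_subst _ t h
  exact ⟨y, hy, by simpa [Term.vars] using hx⟩

variable [DecidableEq O]

theorem Formula.mem_freeVars_foldr_all {x : Var O} (l : List (Var O)) (φ : Formula S) :
    x ∈ (l.foldr (fun x ψ => Formula.all x.1 x.2 ψ) φ).freeVars ↔ x ∈ φ.freeVars ∧ x ∉ l := by
  induction l with
  | nil => simp
  | cons y l ih =>
    rw [List.foldr_cons, Formula.freeVars, List.mem_filter, ih]
    simp only [Prod.mk.eta, decide_eq_true_eq, List.mem_cons, not_or]
    tauto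

theorem Formula.freeVars_closure (φ : Formula S) : φ.closure.freeVars = [] := by
  rw [List.eq_nil_iff_forall_not_mem]
  intro x hx
  rw [Formula.closure, Formula.mem_freeVars_foldr_all, List.mem_dedup] at hx
  exact hx.2 hx.1

theorem Formula.holds_foldr_all (A : Struct.{w} S) (l : List (Var O)) (φ : Formula S)
    (M : A.Assignment) :
    (l.foldr (fun x ψ => Formula.all x.1 x.2 ψ) φ).Holds A M ↔
      ∀ M' : A.Assignment, (∀ x ∉ l, M' x = M x) → φ.Holds A M' := by
  induction l generalizing M with
  | nil =>
    simp only [List.foldr_nil, List.not_mem_nil, not_false_eq_true, forall_const]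
    exact ⟨fun h M' hM => (funext hM : M' = M) ▸ h, fun h => h M fun _ => rfl⟩
  | cons y l ih =>
    simp only [List.foldr_cons, Formula.Holds, ih, List.mem_cons, not_or]
    constructor
    · intro h M' hM
      refine h (M' y) M' fun x hx => ?_
      by_cases hxy : x = y
      · subst hxy; simp
      · rw [Function.update_of_ne (by simpa using hxy)]
        exact hM x ⟨hxy, hx⟩
    · intro h a M' hM
      refine h M' fun x hx => ?_
      rw [hM x hx.2, Function.update_of_ne (by simpa using hx.1)]

theorem Formula.holds_closure (A : Struct.{w} S) (φ : Formula S) (M : A.Assignment) :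
    φ.closure.Holds A M ↔ ∀ M' : A.Assignment, φ.Holds A M' := by
  rw [Formula.closure, Formula.holds_foldr_all]
  refine ⟨fun h M' => ?_, fun h M' _ => h M'⟩
  -- The closure only permits changes of `M` on the free variables, so `M'` is replaced by the
  -- assignment that follows it there and equals `M` elsewhere.
  refine (Formula.holds_congr A φ (M := fun x => if x ∈ φ.freeVars then M' x else M x)
    fun x hx => if_pos hx).1 (h _ fun x hx => if_neg ?_)
  rwa [List.mem_dedup] at hx

/-- The predicate on assignments obtained by quantifying `X` along a prefix. -/
def prefixHolds (D : Srt O → Type w) :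
    List (Quant × Var O) → ((∀ x : Var O, D x.1) → Prop) → (∀ x : Var O, D x.1) → Prop
  | [], X, M => X M
  | (.ex, x) :: p, X, M => ∃ a, prefixHolds D p X (Function.update M x a)
  | (.all, x) :: p, X, M => ∀ a, prefixHolds D p X (Function.update M x a)

/-- The predicate `X` on assignments does not depend on the value of the variable `x`. -/
def IndepOf {D : Srt O → Type w} (x : Var O) (X : (∀ x : Var O, D x.1) → Prop) : Prop :=
  ∀ M a, X (Function.update M x a) ↔ X M

variable {D : Srt O → Type w} {X Y : (∀ x : Var O, D x.1) → Prop}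

theorem QF.indepOf {A : Struct.{w} S} {m : QF S} {x : Var O} (h : x ∉ m.vars) :
    IndepOf x (D := A.dom) fun M => m.Holds A M := fun _ _ =>
  m.holds_congr A fun y hy =>
    Function.update_of_ne (fun e : y = x => h (by rwa [e] at hy)) _ _

theorem prefixHolds_append (p q : List (Quant × Var O)) (M : ∀ x : Var O, D x.1) :
    prefixHolds D (p ++ q) X M ↔ prefixHolds D p (prefixHolds D q X) M := by
  induction p generalizing M with
  | nil => rfl
  | cons a p ih =>
    obtain ⟨_ | _, x⟩ := a
    · exact exists_congr fun _ => ih _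
    · exact forall_congr' fun _ => ih _

theorem prefixHolds_congr (h : ∀ M, X M ↔ Y M) (p : List (Quant × Var O))
    (M : ∀ x : Var O, D x.1) : prefixHolds D p X M ↔ prefixHolds D p Y M := by
  rw [show X = Y from funext fun M => propext (h M)]

theorem IndepOf.prefixHolds {x : Var O} (h : IndepOf x X) (p : List (Quant × Var O)) :
    IndepOf x (prefixHolds D p X) := by
  induction p with
  | nil => exact h
  | cons b p ih =>
    have key : ∀ (y : Var O) (M : ∀ x : Var O, D x.1) a c,
        OperatorLogic.prefixHolds D p X (Function.update (Function.update M x a) y c) ↔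
          OperatorLogic.prefixHolds D p X (Function.update M y c) := by
      intro y M a c
      rcases eq_or_ne x y with rfl | hxy
      · rw [Function.update_idem]
      · rw [Function.update_comm hxy]
        exact ih _ _
    obtain ⟨_ | _, y⟩ := b
    · exact fun M a => exists_congr fun c => key y M a c
    · exact fun M a => forall_congr' fun c => key y M a c

/-- An independent disjunct leaves the scope of a quantifier; for `∃` this rests on the domains
being non-empty. -/
theorem prefixHolds_or (hD : ∀ s, Nonempty (D s)) (p : List (Quant × Var O))
    (hp : ∀ q ∈ p, IndepOf q.2 Y) (M : ∀ x : Var O, D x.1) :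
    prefixHolds D p (fun M => X M ∨ Y M) M ↔ prefixHolds D p X M ∨ Y M := by
  induction p generalizing M with
  | nil => rfl
  | cons b p ih =>
    have ih := ih fun q hq => hp q (List.mem_cons_of_mem _ hq)
    have hb := hp b List.mem_cons_self
    obtain ⟨_ | _, y⟩ := b
    · have := hD y.1
      simp only [prefixHolds, ih, hb M _, exists_or, exists_const]
    · have := hD y.1
      simp only [prefixHolds, ih, hb M _, forall_or_right]

/-- Dual situation: here it is `∀` that needs non-empty domains. -/
theorem prefixHolds_and (hD : ∀ s, Nonempty (D s)) (p : List (Quant × Var O))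
    (hp : ∀ q ∈ p, IndepOf q.2 Y) (M : ∀ x : Var O, D x.1) :
    prefixHolds D p (fun M => X M ∧ Y M) M ↔ prefixHolds D p X M ∧ Y M := by
  induction p generalizing M with
  | nil => rfl
  | cons b p ih =>
    have ih := ih fun q hq => hp q (List.mem_cons_of_mem _ hq)
    have hb := hp b List.mem_cons_self
    obtain ⟨_ | _, y⟩ := b
    · simp only [prefixHolds, ih, hb M _, exists_and_right]
    · have := hD y.1
      simp only [prefixHolds, ih, hb M _, forall_and, forall_const]

theorem prefixHolds_dualPrefix (p : List (Quant × Var O)) (M : ∀ x : Var O, D x.1) :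
    prefixHolds D (dualPrefix p) (fun M => ¬ X M) M ↔ ¬ prefixHolds D p X M := by
  induction p generalizing M with
  | nil => rfl
  | cons b p ih =>
    obtain ⟨_ | _, y⟩ := b
    · exact (forall_congr' fun a => ih _).trans not_exists.symm
    · exact (exists_congr fun a => ih _).trans not_forall.symm

theorem prefixHolds_append_or (hD : ∀ s, Nonempty (D s)) {p q : List (Quant × Var O)}
    (hp : ∀ r ∈ p, IndepOf r.2 Y) (hq : ∀ r ∈ q, IndepOf r.2 X) (M : ∀ x : Var O, D x.1) :
    prefixHolds D (p ++ q) (fun M => X M ∨ Y M) M ↔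
      prefixHolds D p X M ∨ prefixHolds D q Y M := by
  rw [prefixHolds_append, ← prefixHolds_or hD p fun r hr => (hp r hr).prefixHolds q]
  refine prefixHolds_congr (fun M => ?_) p M
  rw [prefixHolds_congr (fun M => or_comm), prefixHolds_or hD q hq, or_comm]

theorem prefixHolds_append_and (hD : ∀ s, Nonempty (D s)) {p q : List (Quant × Var O)}
    (hp : ∀ r ∈ p, IndepOf r.2 Y) (hq : ∀ r ∈ q, IndepOf r.2 X) (M : ∀ x : Var O, D x.1) :
    prefixHolds D (p ++ q) (fun M => X M ∧ Y M) M ↔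
      prefixHolds D p X M ∧ prefixHolds D q Y M := by
  rw [prefixHolds_append, ← prefixHolds_and hD p fun r hr => (hp r hr).prefixHolds q]
  refine prefixHolds_congr (fun M => ?_) p M
  rw [prefixHolds_congr (fun M => and_comm), prefixHolds_and hD q hq, and_comm]

theorem Formula.le_prenexAux (φ : Formula S) (ρ : Var O → ℕ) (k : ℕ) :
    k ≤ (φ.prenexAux ρ k).2.2 := by
  induction φ generalizing ρ k with
  | eq t₁ t₂ => exact le_rfl
  | not φ ih => exact ih ρ k
  | or φ ψ ih₁ ih₂ | and φ ψ ih₁ ih₂ | imp φ ψ ih₁ ih₂ => exact (ih₁ ρ k).trans (ih₂ ρ _)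
  | ex s n φ ih | all s n φ ih => exact (Nat.le_succ k).trans (ih _ _)

/-- The indices handed out lie in the half-open interval between the incoming and the outgoing
counter. Subformulas treated one after the other thus get disjoint bound variables, which is what
makes merging their prefixes capture-free. -/
theorem Formula.prenexAux_index_bounds (φ : Formula S) (ρ : Var O → ℕ) (k : ℕ) :
    ∀ q ∈ (φ.prenexAux ρ k).1, k ≤ q.2.2 ∧ q.2.2 < (φ.prenexAux ρ k).2.2 := by
  induction φ generalizing ρ k with
  | eq t₁ t₂ => intro q hq; simp [Formula.prenexAux] at hq
  | not φ ih =>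
    intro q hq
    obtain ⟨r, hr, hrq⟩ := mem_dualPrefix hq
    rw [← hrq]
    exact ih ρ k r hr
  | or φ ψ ih₁ ih₂ | and φ ψ ih₁ ih₂ =>
    intro q hq
    rcases List.mem_append.1 hq with hq | hq
    · exact ⟨(ih₁ _ _ q hq).1, (ih₁ _ _ q hq).2.trans_le (ψ.le_prenexAux _ _)⟩
    · exact ⟨(φ.le_prenexAux _ _).trans (ih₂ _ _ q hq).1, (ih₂ _ _ q hq).2⟩
  | imp φ ψ ih₁ ih₂ =>
    intro q hq
    rcases List.mem_append.1 hq with hq | hq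
    · obtain ⟨r, hr, hrq⟩ := mem_dualPrefix hq
      rw [← hrq]
      exact ⟨(ih₁ _ _ r hr).1, (ih₁ _ _ r hr).2.trans_le (ψ.le_prenexAux _ _)⟩
    · exact ⟨(φ.le_prenexAux _ _).trans (ih₂ _ _ q hq).1, (ih₂ _ _ q hq).2⟩
  | ex s n φ ih | all s n φ ih =>
    intro q hq
    rcases List.mem_cons.1 hq with rfl | hq
    · exact ⟨le_rfl, φ.le_prenexAux _ _⟩
    · exact ⟨(Nat.le_succ k).trans (ih _ _ q hq).1, (ih _ _ q hq).2⟩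

theorem Formula.prenexAux_pairwise (φ : Formula S) (ρ : Var O → ℕ) (k : ℕ) :
    (φ.prenexAux ρ k).1.Pairwise fun a b => a.2.2 < b.2.2 := by
  induction φ generalizing ρ k with
  | eq t₁ t₂ => exact List.Pairwise.nil
  | not φ ih => exact List.pairwise_map.2 (ih ρ k)
  | or φ ψ ih₁ ih₂ | and φ ψ ih₁ ih₂ =>
    exact List.pairwise_append.2 ⟨ih₁ _ _, ih₂ _ _, fun a ha b hb =>
      (φ.prenexAux_index_bounds _ _ a ha).2.trans_le (ψ.prenexAux_index_bounds _ _ b hb).1⟩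
  | imp φ ψ ih₁ ih₂ =>
    refine List.pairwise_append.2 ⟨List.pairwise_map.2 (ih₁ _ _), ih₂ _ _, fun a ha b hb => ?_⟩
    obtain ⟨r, hr, hra⟩ := mem_dualPrefix ha
    rw [← hra]
    exact (φ.prenexAux_index_bounds _ _ r hr).2.trans_le (ψ.prenexAux_index_bounds _ _ b hb).1
  | ex s n φ ih | all s n φ ih =>
    exact List.pairwise_cons.2 ⟨fun b hb => (φ.prenexAux_index_bounds _ _ b hb).1, ih _ _⟩

theorem Formula.mem_vars_prenexAux (φ : Formula S) (ρ : Var O → ℕ) (k : ℕ) {x : Var O}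
    (hx : x ∈ (φ.prenexAux ρ k).2.1.vars) :
    (∃ y ∈ φ.freeVars, x = (y.1, ρ y)) ∨ ∃ q ∈ (φ.prenexAux ρ k).1, q.2 = x := by
  induction φ generalizing ρ k with
  | eq t₁ t₂ =>
    simp only [Formula.freeVars, List.mem_append]
    rcases List.mem_append.1 hx with hx | hx
    · obtain ⟨y, hy, e⟩ := Term.mem_vars_rename hx
      exact Or.inl ⟨y, Or.inl hy, e⟩
    · obtain ⟨y, hy, e⟩ := Term.mem_vars_rename hx
      exact Or.inl ⟨y, Or.inr hy, e⟩
  | not φ ih =>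
    rcases ih ρ k hx with h | ⟨q, hq, e⟩
    · exact Or.inl h
    · exact Or.inr ⟨_, List.mem_map_of_mem hq, e⟩
  | or φ ψ ih₁ ih₂ | and φ ψ ih₁ ih₂ =>
    simp only [Formula.freeVars, Formula.prenexAux, List.mem_append]
    rcases List.mem_append.1 hx with hx | hx
    · rcases ih₁ _ _ hx with ⟨y, hy, e⟩ | ⟨q, hq, e⟩
      · exact Or.inl ⟨y, Or.inl hy, e⟩
      · exact Or.inr ⟨q, Or.inl hq, e⟩
    · rcases ih₂ _ _ hx with ⟨y, hy, e⟩ | ⟨q, hq, e⟩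
      · exact Or.inl ⟨y, Or.inr hy, e⟩
      · exact Or.inr ⟨q, Or.inr hq, e⟩
  | imp φ ψ ih₁ ih₂ =>
    simp only [Formula.freeVars, Formula.prenexAux, List.mem_append]
    rcases List.mem_append.1 hx with hx | hx
    · rcases ih₁ _ _ hx with ⟨y, hy, e⟩ | ⟨q, hq, e⟩
      · exact Or.inl ⟨y, Or.inl hy, e⟩
      · exact Or.inr ⟨_, Or.inl (List.mem_map_of_mem hq), e⟩
    · rcases ih₂ _ _ hx with ⟨y, hy, e⟩ | ⟨q, hq, e⟩
      · exact Or.inl ⟨y, Or.inr hy, e⟩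
      · exact Or.inr ⟨q, Or.inr hq, e⟩
  | ex s n φ ih | all s n φ ih =>
    rcases ih _ _ hx with ⟨y, hy, e⟩ | ⟨q, hq, e⟩
    · by_cases hys : y = (s, n)
      · subst hys
        exact Or.inr ⟨_, List.mem_cons_self, by simp [e]⟩
      · refine Or.inl ⟨y, by simp [Formula.freeVars, hy, hys], ?_⟩
        rw [e, Function.update_of_ne hys]
    · exact Or.inr ⟨q, List.mem_cons_of_mem _ hq, e⟩

/-- The bound variables of one prenexed formula do not occur in the matrix of another one whose
bound variables have different indices. -/
theorem Formula.notMem_vars_prenexAux {φ : Formula S} {ρ : Var O → ℕ} {k k' : ℕ} {x : Var O}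
    (h : ∀ y ∈ φ.freeVars, ρ y < k') (hk : k' ≤ x.2)
    (hx : x.2 < k ∨ (φ.prenexAux ρ k).2.2 ≤ x.2) : x ∉ (φ.prenexAux ρ k).2.1.vars := by
  intro hmem
  rcases φ.mem_vars_prenexAux ρ k hmem with ⟨y, hy, rfl⟩ | ⟨q, hq, rfl⟩
  · exact absurd (h y hy) (not_lt.2 hk)
  · have := φ.prenexAux_index_bounds ρ k q hq
    omega

/-- Induction with two assignments: `M` for the original variables and `M'` for the renamed ones,
matched along `ρ`. The condition `ρ x < k` keeps the fresh index `k` from colliding with a renamed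
free variable. -/
theorem Formula.holds_prenexAux (A : Struct.{w} S) (φ : Formula S) (ρ : Var O → ℕ) (k : ℕ)
    (hρ : ∀ x ∈ φ.freeVars, ρ x < k) {M M' : A.Assignment}
    (hM : ∀ x ∈ φ.freeVars, M x = M' (x.1, ρ x)) :
    φ.Holds A M ↔
      prefixHolds A.dom (φ.prenexAux ρ k).1 (fun M => (φ.prenexAux ρ k).2.1.Holds A M) M' := by
  induction φ generalizing ρ k M M' with
  | eq t₁ t₂ =>
    simp only [Formula.freeVars, List.mem_append] at hM
    simp only [Formula.prenexAux, prefixHolds, QF.Holds, Term.eval_subst, Formula.Holds]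
    rw [t₁.eval_congr A fun x hx => hM x (Or.inl hx),
      t₂.eval_congr A fun x hx => hM x (Or.inr hx)]
    rfl
  | not φ ih =>
    rw [Formula.Holds, ih ρ k hρ hM]
    exact (prefixHolds_dualPrefix _ _).symm
  | or φ ψ ih₁ ih₂ =>
    simp only [Formula.freeVars, List.mem_append] at hM hρ
    have hk := φ.le_prenexAux ρ k
    rw [Formula.Holds, ih₁ ρ k (fun x hx => hρ x (Or.inl hx)) fun x hx => hM x (Or.inl hx),
      ih₂ ρ _ (fun x hx => (hρ x (Or.inr hx)).trans_le hk) fun x hx => hM x (Or.inr hx)]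
    refine (prefixHolds_append_or A.nonempty (fun r hr => ?_) (fun r hr => ?_) M').symm
    · have := φ.prenexAux_index_bounds _ _ r hr
      exact QF.indepOf (Formula.notMem_vars_prenexAux (fun x hx => hρ x (Or.inr hx)) this.1
        (Or.inl this.2))
    · have := ψ.prenexAux_index_bounds _ _ r hr
      exact QF.indepOf (Formula.notMem_vars_prenexAux (fun x hx => hρ x (Or.inl hx))
        (hk.trans this.1) (Or.inr this.1))
  | and φ ψ ih₁ ih₂ =>
    simp only [Formula.freeVars, List.mem_append] at hM hρ
    have hk := φ.le_prenexAux ρ k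
    rw [Formula.Holds, ih₁ ρ k (fun x hx => hρ x (Or.inl hx)) fun x hx => hM x (Or.inl hx),
      ih₂ ρ _ (fun x hx => (hρ x (Or.inr hx)).trans_le hk) fun x hx => hM x (Or.inr hx)]
    refine (prefixHolds_append_and A.nonempty (fun r hr => ?_) (fun r hr => ?_) M').symm
    · have := φ.prenexAux_index_bounds _ _ r hr
      exact QF.indepOf (Formula.notMem_vars_prenexAux (fun x hx => hρ x (Or.inr hx)) this.1
        (Or.inl this.2))
    · have := ψ.prenexAux_index_bounds _ _ r hr
      exact QF.indepOf (Formula.notMem_vars_prenexAux (fun x hx => hρ x (Or.inl hx))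
        (hk.trans this.1) (Or.inr this.1))
  | imp φ ψ ih₁ ih₂ =>
    simp only [Formula.freeVars, List.mem_append] at hM hρ
    have hk := φ.le_prenexAux ρ k
    rw [Formula.Holds, ih₁ ρ k (fun x hx => hρ x (Or.inl hx)) fun x hx => hM x (Or.inl hx),
      ih₂ ρ _ (fun x hx => (hρ x (Or.inr hx)).trans_le hk) fun x hx => hM x (Or.inr hx),
      imp_iff_not_or, ← prefixHolds_dualPrefix]
    refine (prefixHolds_append_or A.nonempty (fun r hr => ?_) (fun r hr => ?_) M').symm.trans
      (prefixHolds_congr (fun M => imp_iff_not_or.symm) _ _)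
    · obtain ⟨q, hq, hqr⟩ := mem_dualPrefix hr
      rw [← hqr]
      have := φ.prenexAux_index_bounds _ _ q hq
      exact QF.indepOf (Formula.notMem_vars_prenexAux (fun x hx => hρ x (Or.inr hx)) this.1
        (Or.inl this.2))
    · have := ψ.prenexAux_index_bounds _ _ r hr
      intro M a
      exact not_congr (QF.indepOf (Formula.notMem_vars_prenexAux (fun x hx => hρ x (Or.inl hx))
        (hk.trans this.1) (Or.inr this.1)) M a)
  | ex s n φ ih =>
    refine exists_congr fun a => ih _ _ (fun x hx => ?_) fun x hx => ?_
    · by_cases hxs : x = (s, n)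
      · simp [hxs]
      · rw [Function.update_of_ne hxs]
        exact (hρ x (by simp [Formula.freeVars, hx, hxs])).trans (Nat.lt_succ_self k)
    · by_cases hxs : x = (s, n)
      · subst hxs
        -- Generalised over the index, because the renamed index equals `k` only propositionally
        -- while the type of the value depends on the variable.
        have : ∀ j, j = k → a = Function.update M' (s, k) a (s, j) := by rintro j rfl; simp
        rw [Function.update_self]
        exact this _ (Function.update_self ..)
      · have hx' : x ∈ (Formula.ex s n φ).freeVars := by simp [Formula.freeVars, hx, hxs]
        have hne : (x.1, ρ x) ≠ (s, k) := fun e => (hρ x hx').ne (congrArg Prod.snd e)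
        rw [Function.update_of_ne hxs, hM x hx', Function.update_of_ne hxs,
          Function.update_of_ne hne]
  | all s n φ ih =>
    refine forall_congr' fun a => ih _ _ (fun x hx => ?_) fun x hx => ?_
    · by_cases hxs : x = (s, n)
      · simp [hxs]
      · rw [Function.update_of_ne hxs]
        exact (hρ x (by simp [Formula.freeVars, hx, hxs])).trans (Nat.lt_succ_self k)
    · by_cases hxs : x = (s, n)
      · subst hxs
        have : ∀ j, j = k → a = Function.update M' (s, k) a (s, j) := by rintro j rfl; simp
        rw [Function.update_self]
        exact this _ (Function.update_self ..)
      · have hx' : x ∈ (Formula.all s n φ).freeVars := by simp [Formula.freeVars, hx, hxs]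
        have hne : (x.1, ρ x) ≠ (s, k) := fun e => (hρ x hx').ne (congrArg Prod.snd e)
        rw [Function.update_of_ne hxs, hM x hx', Function.update_of_ne hxs,
          Function.update_of_ne hne]

theorem Formula.holds_prenex (A : Struct.{w} S) {φ : Formula S} (hφ : φ.freeVars = [])
    (M : A.Assignment) :
    φ.Holds A M ↔ prefixHolds A.dom φ.prenex.1 (fun M => φ.prenex.2.Holds A M) M :=
  φ.holds_prenexAux A _ 0 (by simp [hφ]) (by simp [hφ])

/-- Indices increase strictly along the prefix, so its variables are distinct even across sorts. -/
theorem Formula.nodup_prenex (φ : Formula S) : (φ.prenex.1.map Prod.snd).Nodup :=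
  List.pairwise_map.2 ((φ.prenexAux_pairwise _ _).imp fun h e => h.ne (congrArg Prod.snd e))

end Prenex

/-! ### Herbrandisation preserves validity -/

section Herbrandisation

variable {O : Type} {S : Signature O}

theorem Struct.IsPreadditive.reduct {S S' : Signature O} {c' : ∀ {s}, S.Con s → S'.Con s}
    {f' : ∀ {d ds s}, S.Fun d ds s → S'.Fun d ds s} {B : Struct.{w} S'} (h : B.IsPreadditive) :
    (B.reduct c' f').IsPreadditive :=
  ⟨h.mul_assoc, h.add_assoc, h.add_zero, h.add_neg, h.add_comm, h.mul_add, h.add_mul⟩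

theorem varArgs_vars (xs : List (Var O)) : (varArgs S xs).vars = xs := by
  induction xs with
  | nil => rfl
  | cons x xs ih => simp [varArgs, Args.vars, Term.vars, ih]

/-- The tuple of the values of the listed variables. -/
def valueTup {D : Srt O → Type w} (M : ∀ x : Var O, D x.1) :
    (xs : List (Var O)) → Tup D (xs.map Prod.fst)
  | [] => PUnit.unit
  | x :: xs => (M x, valueTup M xs)

theorem eval_varArgs (A : Struct.{w} S) (M : A.Assignment) (xs : List (Var O)) :
    (varArgs S xs).eval A M = valueTup M xs := by
  induction xs with
  | nil => rfl
  | cons x xs ih => exact congrArg (Prod.mk (M x)) ih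

theorem eq_of_valueTup_eq {D : Srt O → Type w} {M M' : ∀ x : Var O, D x.1} (xs : List (Var O))
    (h : valueTup M xs = valueTup M' xs) : ∀ x ∈ xs, M x = M' x := by
  induction xs with
  | nil => simp
  | cons x xs ih =>
    have h1 := congrArg Prod.fst h
    have h2 := congrArg Prod.snd h
    intro z hz
    rcases List.mem_cons.1 hz with rfl | hz
    · exact h1
    · exact ih h2 z hz

variable [DecidableEq O]

/-- Setting `y` to `g M` commutes with the quantifiers, since none of them touches `y` or a variable
on which `g` depends. -/
theorem prefixHolds_update {D : Srt O → Type w} {X : (∀ x : Var O, D x.1) → Prop}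
    {p : List (Quant × Var O)} {y : Var O} {g : (∀ x : Var O, D x.1) → D y.1}
    (hy : ∀ q ∈ p, q.2 ≠ y) (hg : ∀ q ∈ p, ∀ M a, g (Function.update M q.2 a) = g M)
    (M : ∀ x : Var O, D x.1) :
    prefixHolds D p (fun M => X (Function.update M y (g M))) M ↔
      prefixHolds D p X (Function.update M y (g M)) := by
  induction p generalizing M with
  | nil => rfl
  | cons b p ih =>
    have ih := ih (fun q hq => hy q (List.mem_cons_of_mem _ hq))
      (fun q hq => hg q (List.mem_cons_of_mem _ hq))
    have hb := hg b List.mem_cons_self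
    have hyb := hy b List.mem_cons_self
    obtain ⟨_ | _, z⟩ := b
    · refine exists_congr fun a => ?_
      rw [ih, hb M a, Function.update_comm hyb]
    · refine forall_congr' fun a => ?_
      rw [ih, hb M a, Function.update_comm hyb]

theorem Subst.eval_single (A : Struct.{w} S) (M : A.Assignment) (y : Var O) (t : Term S y.1) :
    (fun x => (Subst.single y t x).eval A M) = Function.update M y (t.eval A M) := by
  funext x
  by_cases h : x = y
  · subst h; simp [Subst.single]
  · rw [Function.update_of_ne h, Subst.single, Function.update_of_ne h]
    rfl

theorem QF.holds_map_subst_single {S S' : Signature O} (c' : ∀ {s}, S.Con s → S'.Con s)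
    (f' : ∀ {d ds s}, S.Fun d ds s → S'.Fun d ds s) (B : Struct.{w} S') (M : B.Assignment)
    (m : QF S) (y : Var O) (t : Term S' y.1) :
    ((m.map c' f').subst (Subst.single y t)).Holds B M ↔
      m.Holds (B.reduct c' f') (Function.update M y (t.eval B M)) := by
  rw [QF.holds_subst, Subst.eval_single, QF.holds_map]
  rfl

/-- Semantics of a single Herbrandisation step: the substituted term acts as an assignment of its
value to `y`, made before the remaining quantifiers. -/
theorem prefixHolds_map_subst_single {S S' : Signature O} (c' : ∀ {s}, S.Con s → S'.Con s)
    (f' : ∀ {d ds s}, S.Fun d ds s → S'.Fun d ds s) (B : Struct.{w} S') (M : B.Assignment)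
    (m : QF S) (y : Var O) (t : Term S' y.1) (p : List (Quant × Var O))
    (hy : ∀ q ∈ p, q.2 ≠ y) (ht : ∀ q ∈ p, q.2 ∉ t.vars) :
    prefixHolds B.dom p (fun M => ((m.map c' f').subst (Subst.single y t)).Holds B M) M ↔
      prefixHolds B.dom p (fun M => m.Holds (B.reduct c' f') M)
        (Function.update M y (t.eval B M)) := by
  refine (prefixHolds_congr (fun M => QF.holds_map_subst_single c' f' B M m y t) p M).trans ?_
  refine prefixHolds_update (X := fun M => m.Holds (B.reduct c' f') M)
    (g := fun M => t.eval B M) hy (fun q hq M a => ?_) M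
  exact t.eval_congr B fun z hz =>
    Function.update_of_ne (fun e : z = q.2 => ht q hq (by rwa [e] at hz)) _ _

/-- Interpret the new constant symbol of `S.addCon r` by `c`. -/
def Struct.addCon (A : Struct.{w} S) {r : Srt O} (c : A.dom r) : Struct.{w} (S.addCon r) where
  dom := A.dom
  nonempty := A.nonempty
  con {s} := fun k : S.Con s ⊕ {_x : Unit // s = r} =>
    match k with
    | .inl k => A.con k
    | .inr ⟨_, h⟩ => h ▸ c
  zero := A.zero
  neg := A.neg
  add := A.add
  mul := A.mul
  app f := A.app (S := S) f

/-- Interpret the new function symbol of `S.addFun e es r` by `g`. -/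
def Struct.addFun (A : Struct.{w} S) {e : Srt O} {es : List (Srt O)} {r : Srt O}
    (g : Tup A.dom (e :: es) → A.dom r) : Struct.{w} (S.addFun e es r) where
  dom := A.dom
  nonempty := A.nonempty
  con k := A.con (S := S) k
  zero := A.zero
  neg := A.neg
  add := A.add
  mul := A.mul
  app {d ds s} := fun (f : S.Fun d ds s ⊕ {_x : Unit // d = e ∧ ds = es ∧ s = r}) t =>
    match f with
    | .inl f => A.app f t
    | .inr ⟨_, h⟩ => h.2.2 ▸ g (h.1 ▸ h.2.1 ▸ t)

theorem Struct.IsPreadditive.addCon {A : Struct.{w} S} (h : A.IsPreadditive) {r : Srt O}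
    (c : A.dom r) : (A.addCon c).IsPreadditive :=
  ⟨h.mul_assoc, h.add_assoc, h.add_zero, h.add_neg, h.add_comm, h.mul_add, h.add_mul⟩

theorem Struct.IsPreadditive.addFun {A : Struct.{w} S} (h : A.IsPreadditive) {e : Srt O}
    {es : List (Srt O)} {r : Srt O} (g : Tup A.dom (e :: es) → A.dom r) :
    (A.addFun g).IsPreadditive :=
  ⟨h.mul_assoc, h.add_assoc, h.add_zero, h.add_neg, h.add_comm, h.mul_add, h.add_mul⟩

/-- Validity in all preadditive semicategories of the sentence `∃ xs, p : m` (where variables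
that are not bound are read as zero). -/
def PrefixValid (S : Signature O) (xs : List (Var O)) (p : List (Quant × Var O)) (m : QF S) :
    Prop :=
  ∀ A : Struct.{w} S, A.IsPreadditive → ∃ M : A.Assignment, (∀ x ∉ xs, M x = A.zero x.1) ∧
    prefixHolds A.dom p (fun M => m.Holds A M) M

theorem prefixValid_ex (xs : List (Var O)) (x : Var O) (p : List (Quant × Var O)) (m : QF S) :
    PrefixValid.{w} S xs ((.ex, x) :: p) m ↔ PrefixValid.{w} S (xs ++ [x]) p m := by
  refine forall₂_congr fun A _ => ⟨?_, ?_⟩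
  · rintro ⟨M, hM, a, ha⟩
    refine ⟨_, fun z hz => ?_, ha⟩
    simp only [List.mem_append, List.mem_singleton, not_or] at hz
    rw [Function.update_of_ne hz.2, hM z hz.1]
  · rintro ⟨M, hM, h⟩
    -- The value of `x` becomes the witness of the quantifier, and `x` itself is reset to zero as an
    -- unbound variable must be.
    refine ⟨Function.update M x (A.zero x.1), fun z hz => ?_, M x, ?_⟩
    · by_cases hzx : z = x
      · subst hzx; simp
      · rw [Function.update_of_ne hzx]
        exact hM z (by simp [hz, hzx])
    · rwa [Function.update_idem, Function.update_eq_self]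

/-- A structure for the larger signature is a structure with a distinguished element; ranging over
all of them amounts to quantifying `y` universally. -/
theorem prefixValid_all_con (y : Var O) (p : List (Quant × Var O)) (m : QF S)
    (hy : ∀ q ∈ p, q.2 ≠ y) :
    PrefixValid.{w} S [] ((.all, y) :: p) m ↔
      PrefixValid.{w} (S.addCon y.1) [] p
        ((m.map (S := S) (S' := S.addCon y.1) Sum.inl id).subst
          (Subst.single y (.con (Sum.inr ⟨(), rfl⟩)))) := by
  have key : ∀ (B : Struct.{w} (S.addCon y.1)) (M : B.Assignment),
      prefixHolds B.dom p (fun M => ((m.map (S := S) (S' := S.addCon y.1) Sum.inl id).subst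
          (Subst.single y (.con (Sum.inr ⟨(), rfl⟩)))).Holds B M) M ↔
      prefixHolds B.dom p (fun M => m.Holds (B.reduct (S := S) (S' := S.addCon y.1) Sum.inl id) M)
        (Function.update M y (B.con (s := y.1) (Sum.inr ⟨(), rfl⟩))) := by
    intro B M
    refine prefixHolds_map_subst_single _ _ B M m y _ p hy fun q _ => ?_
    simp [Term.vars]
  constructor
  · intro h B hB
    obtain ⟨M, hM, hp⟩ := h (B.reduct (S := S) (S' := S.addCon y.1) Sum.inl id) hB.reduct
    exact ⟨M, hM, (key B M).2 (hp _)⟩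
  · intro h A hA
    refine ⟨A.zeroAssignment, fun _ _ => rfl, fun a => ?_⟩
    obtain ⟨M, hM, hp⟩ := h (A.addCon a) (hA.addCon a)
    have : M = A.zeroAssignment := funext fun x => hM x (by simp)
    subst this
    exact (key _ _).1 hp

/-- The easy direction specialises `y` to the value of the new symbol. For the other, a failure in
`A` provides a counterexample `G M` for every choice of the existential variables, and interpreting
the new symbol by `G` makes the Herbrandised sentence fail too. -/
theorem prefixValid_all_fun (x : Var O) (xs : List (Var O)) (y : Var O)
    (p : List (Quant × Var O)) (m : QF S) (hy : ∀ q ∈ p, q.2 ≠ y)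
    (hxs : ∀ q ∈ p, q.2 ∉ x :: xs) :
    PrefixValid.{w} S (x :: xs) ((.all, y) :: p) m ↔
      PrefixValid.{w} (S.addFun x.1 (xs.map Prod.fst) y.1) (x :: xs) p
        ((m.map (S := S) (S' := S.addFun x.1 (xs.map Prod.fst) y.1) id Sum.inl).subst
          (Subst.single y
            (.app (d := x.1) (ds := xs.map Prod.fst) (Sum.inr ⟨(), rfl, rfl, rfl⟩)
              (varArgs _ (x :: xs))))) := by
  set S' := S.addFun x.1 (xs.map Prod.fst) y.1
  let f : S'.Fun x.1 (xs.map Prod.fst) y.1 := Sum.inr ⟨(), rfl, rfl, rfl⟩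
  have key : ∀ (B : Struct.{w} S') (M : B.Assignment),
      prefixHolds B.dom p (fun M => ((m.map (S := S) (S' := S') id Sum.inl).subst
          (Subst.single y (.app f (varArgs _ (x :: xs))))).Holds B M) M ↔
      prefixHolds B.dom p (fun M => m.Holds (B.reduct (S := S) (S' := S') id Sum.inl) M)
        (Function.update M y (B.app f ((varArgs S' (x :: xs)).eval B M))) := by
    intro B M
    refine prefixHolds_map_subst_single _ _ B M m y _ p hy fun q hq => ?_
    rw [Term.vars, varArgs_vars]
    exact hxs q hq
  constructor
  · intro h B hB
    obtain ⟨M, hM, hp⟩ := h (B.reduct (S := S) (S' := S') id Sum.inl) hB.reduct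
    exact ⟨M, hM, (key B M).2 (hp _)⟩
  · intro h A hA
    by_contra hcon
    simp only [prefixHolds, not_exists, not_and, not_forall] at hcon
    choose G hG using hcon
    classical
    -- The new symbol must depend on a tuple of values, so an assignment realising the tuple is
    -- chosen first; tuples not realised get the irrelevant value zero.
    let B : Struct.{w} S' := A.addFun fun b =>
      if hb : ∃ M : A.Assignment, (∀ z ∉ x :: xs, M z = A.zero z.1) ∧
        valueTup M (x :: xs) = b then G hb.choose hb.choose_spec.1 else A.zero y.1
    obtain ⟨M, hM, hp⟩ := h B (hA.addFun _)
    have hb : ∃ M' : A.Assignment, (∀ z ∉ x :: xs, M' z = A.zero z.1) ∧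
      valueTup M' (x :: xs) = valueTup (D := A.dom) M (x :: xs) := ⟨M, hM, rfl⟩
    -- An assignment that vanishes off `x :: xs` is determined by its tuple of values, so the choice
    -- returns `M` itself.
    have hMM : hb.choose = M := by
      funext z
      by_cases hz : z ∈ x :: xs
      · exact eq_of_valueTup_eq _ hb.choose_spec.2 z hz
      · exact (hb.choose_spec.1 z hz).trans (hM z hz).symm
    have happ : B.app f ((varArgs S' (x :: xs)).eval B M) = G M hM := by
      rw [eval_varArgs]
      refine (dif_pos hb).trans ?_
      congr 1
    refine hG M hM ?_
    rw [← happ]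
    exact (key B M).1 hp

theorem prefixValid_herbrandise (p : List (Quant × Var O)) :
    ∀ (S : Signature O) (xs : List (Var O)) (m : QF S), (p.map Prod.snd).Nodup →
      (∀ q ∈ p, q.2 ∉ xs) →
      (PrefixValid.{w} S xs p m ↔ PrefixValid.{w} (herbrandise S xs p m).sig
        (herbrandise S xs p m).vars [] (herbrandise S xs p m).matrix) := by
  induction p with
  | nil => intro S xs m _ _; rw [herbrandise]
  | cons b p ih =>
    intro S xs m hnd hxs
    rw [List.map_cons, List.nodup_cons] at hnd
    have hb : ∀ q ∈ p, q.2 ≠ b.2 := fun q hq e => hnd.1 (e ▸ List.mem_map_of_mem hq)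
    have hxs' : ∀ q ∈ p, q.2 ∉ xs := fun q hq => hxs q (List.mem_cons_of_mem _ hq)
    obtain ⟨_ | _, y⟩ := b
    · rw [herbrandise, prefixValid_ex]
      refine ih _ _ _ hnd.2 fun q hq => ?_
      simpa using ⟨hxs' q hq, hb q hq⟩
    · cases xs with
      | nil =>
        rw [herbrandise, prefixValid_all_con _ _ _ hb]
        exact ih _ _ _ hnd.2 hxs'
      | cons x xs =>
        rw [herbrandise, prefixValid_all_fun _ _ _ _ _ hb hxs']
        exact ih _ _ _ hnd.2 hxs'

theorem entails_iff_prefixValid_herbrandForm (φ : Formula S) :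
    Entails.{w} (axioms S) φ ↔
      PrefixValid.{w} φ.herbrandForm.sig φ.herbrandForm.vars [] φ.herbrandForm.matrix := by
  rw [Formula.herbrandForm, ← prefixValid_herbrandise _ _ _ _ φ.closure.nodup_prenex (by simp),
    entails_axioms_iff]
  refine forall₂_congr fun A _ => ?_
  rw [← φ.holds_closure A A.zeroAssignment, Formula.holds_prenex A φ.freeVars_closure]
  constructor
  · exact fun h => ⟨_, fun _ _ => rfl, h⟩
  · rintro ⟨M, hM, h⟩
    have : M = A.zeroAssignment := funext fun x => hM x (by simp)
    rwa [this] at h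

end Herbrandisation

/-! ### Herbrand's theorem -/

section Herbrand

variable {O : Type} {S : Signature O}

/-- Terms are identified if their values at the zero assignment agree in almost all of the given
structures, with respect to a non-principal ultrafilter. -/
def limitSetoid (B : ℕ → Struct.{w} S) (s : Srt O) : Setoid (Term S s) where
  r t t' := ∀ᶠ n in (Filter.hyperfilter ℕ : Filter ℕ),
    t.eval (B n) (B n).zeroAssignment = t'.eval (B n) (B n).zeroAssignment
  iseqv := {
    refl := fun _ => Filter.Eventually.of_forall fun _ => rfl
    symm := fun h => h.mono fun _ => Eq.symm
    trans := fun h h' => by filter_upwards [h, h'] with n using Eq.trans }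

/-- The domains of the substructure generated by the constants in the ultraproduct. -/
abbrev LimitDom (B : ℕ → Struct.{w} S) (s : Srt O) : Type w :=
  ULift.{w} (Quotient (limitSetoid B s))

/-- The class of a term. -/
def limitClass (B : ℕ → Struct.{w} S) {s : Srt O} (t : Term S s) : LimitDom B s :=
  ⟨Quotient.mk _ t⟩

/-- A representative of a class of terms. -/
noncomputable def limitRep {B : ℕ → Struct.{w} S} {s : Srt O} (q : LimitDom B s) : Term S s :=
  q.down.out

/-- Representatives of a tuple of classes. -/
noncomputable def limitRepArgs {B : ℕ → Struct.{w} S} :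
    {l : List (Srt O)} → Tup (LimitDom B) l → Args S l
  | [], _ => .nil
  | _ :: _, q => .cons (limitRep q.1) (limitRepArgs q.2)

/-- The value of the representative in the `n`-th structure. -/
noncomputable def limitVal {B : ℕ → Struct.{w} S} {s : Srt O} (n : ℕ) (q : LimitDom B s) :
    (B n).dom s :=
  (limitRep q).eval (B n) (B n).zeroAssignment

/-- The substructure generated by the constants in the ultraproduct of the given structures. -/
noncomputable def limitStruct (B : ℕ → Struct.{w} S) : Struct.{w} S where
  dom := LimitDom B
  nonempty _ := ⟨limitClass B .zero⟩
  con c := limitClass B (.con c)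
  zero _ := limitClass B .zero
  neg a := limitClass B (.neg (limitRep a))
  add a b := limitClass B (.add (limitRep a) (limitRep b))
  mul a b := limitClass B (.mul (limitRep a) (limitRep b))
  app f a := limitClass B (.app f (limitRepArgs a))

variable {B : ℕ → Struct.{w} S}

/-- A chosen representative agrees with the original term in almost all structures. All operations
of `limitStruct` are defined through representatives, so this one fact computes each of them. -/
theorem limitVal_class {s : Srt O} (t : Term S s) :
    ∀ᶠ n in (Filter.hyperfilter ℕ : Filter ℕ),
      limitVal n (limitClass B t) = t.eval (B n) (B n).zeroAssignment :=
  Quotient.mk_out (s := limitSetoid B s) t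

theorem limit_eq_iff {s : Srt O} (a b : LimitDom B s) :
    a = b ↔ ∀ᶠ n in (Filter.hyperfilter ℕ : Filter ℕ), limitVal n a = limitVal n b := by
  rw [← ULift.down_inj, ← Quotient.out_equiv_out]
  rfl

theorem limitVal_zero (s : Srt O) : ∀ᶠ n in (Filter.hyperfilter ℕ : Filter ℕ),
    limitVal n ((limitStruct B).zero s) = (B n).zero s := limitVal_class _

theorem limitVal_neg {s : Srt O} (a : (limitStruct B).dom s) :
    ∀ᶠ n in (Filter.hyperfilter ℕ : Filter ℕ),
      limitVal n ((limitStruct B).neg a) = (B n).neg (limitVal n a) := limitVal_class _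

theorem limitVal_add {s : Srt O} (a b : (limitStruct B).dom s) :
    ∀ᶠ n in (Filter.hyperfilter ℕ : Filter ℕ),
      limitVal n ((limitStruct B).add a b) = (B n).add (limitVal n a) (limitVal n b) :=
  limitVal_class _

theorem limitVal_mul {u v o : O} (a : (limitStruct B).dom (o, v))
    (b : (limitStruct B).dom (u, o)) :
    ∀ᶠ n in (Filter.hyperfilter ℕ : Filter ℕ),
      limitVal n ((limitStruct B).mul a b) = (B n).mul (limitVal n a) (limitVal n b) :=
  limitVal_class _

/-- Every axiom is an equation true in all `B n`; intersecting finitely many large sets of indices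
transfers it. -/
theorem limitStruct_isPreadditive (hB : ∀ n, (B n).IsPreadditive) :
    (limitStruct B).IsPreadditive where
  mul_assoc a b c := by
    refine (limit_eq_iff _ _).2 ?_
    filter_upwards [limitVal_mul a ((limitStruct B).mul b c), limitVal_mul b c,
      limitVal_mul ((limitStruct B).mul a b) c, limitVal_mul a b] with n h₁ h₂ h₃ h₄
    rw [h₁, h₂, h₃, h₄, (hB n).mul_assoc]
  add_assoc a b c := by
    refine (limit_eq_iff _ _).2 ?_
    filter_upwards [limitVal_add a ((limitStruct B).add b c), limitVal_add b c,
      limitVal_add ((limitStruct B).add a b) c, limitVal_add a b] with n h₁ h₂ h₃ h₄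
    rw [h₁, h₂, h₃, h₄, (hB n).add_assoc]
  add_zero {s} a := by
    refine (limit_eq_iff _ _).2 ?_
    filter_upwards [limitVal_add a ((limitStruct B).zero s), limitVal_zero s] with n h₁ h₂
    rw [h₁, h₂, (hB n).add_zero]
  add_neg {s} a := by
    refine (limit_eq_iff _ _).2 ?_
    filter_upwards [limitVal_add a ((limitStruct B).neg a), limitVal_zero s, limitVal_neg a]
      with n h₁ h₂ h₃
    rw [h₁, h₂, h₃, (hB n).add_neg]
  add_comm a b := by
    refine (limit_eq_iff _ _).2 ?_
    filter_upwards [limitVal_add a b, limitVal_add b a] with n h₁ h₂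
    rw [h₁, h₂, (hB n).add_comm]
  mul_add a b c := by
    refine (limit_eq_iff _ _).2 ?_
    filter_upwards [limitVal_mul a ((limitStruct B).add b c), limitVal_add b c,
      limitVal_add ((limitStruct B).mul a b) ((limitStruct B).mul a c), limitVal_mul a b,
      limitVal_mul a c] with n h₁ h₂ h₃ h₄ h₅
    rw [h₁, h₂, h₃, h₄, h₅, (hB n).mul_add]
  add_mul a b c := by
    refine (limit_eq_iff _ _).2 ?_
    filter_upwards [limitVal_mul ((limitStruct B).add a b) c, limitVal_add a b,
      limitVal_add ((limitStruct B).mul a c) ((limitStruct B).mul b c), limitVal_mul a c,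
      limitVal_mul b c] with n h₁ h₂ h₃ h₄ h₅
    rw [h₁, h₂, h₃, h₄, h₅, (hB n).add_mul]

mutual
theorem Term.limitVal_eval {M : (limitStruct B).Assignment} {θ : Subst S}
    (hθ : ∀ x, limitClass B (θ x) = M x) : ∀ {s : Srt O} (t : Term S s),
      ∀ᶠ n in (Filter.hyperfilter ℕ : Filter ℕ), limitVal n (t.eval (limitStruct B) M) =
        (t.subst θ).eval (B n) (B n).zeroAssignment
  | s, .var k => by
    have := limitVal_class (B := B) (θ (s, k))
    rw [hθ] at this
    exact this
  | _, .con c => limitVal_class _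
  | _, .zero => limitVal_class _
  | _, .neg t => by
    filter_upwards [limitVal_neg (t.eval (limitStruct B) M), Term.limitVal_eval hθ t]
      with n h₁ h₂
    exact h₁.trans (congrArg _ h₂)
  | _, .add t₁ t₂ => by
    filter_upwards [limitVal_add (t₁.eval (limitStruct B) M) (t₂.eval (limitStruct B) M),
      Term.limitVal_eval hθ t₁, Term.limitVal_eval hθ t₂] with n h₁ h₂ h₃
    exact h₁.trans (congrArg₂ _ h₂ h₃)
  | _, .mul t₁ t₂ => by
    filter_upwards [limitVal_mul (t₁.eval (limitStruct B) M) (t₂.eval (limitStruct B) M),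
      Term.limitVal_eval hθ t₁, Term.limitVal_eval hθ t₂] with n h₁ h₂ h₃
    exact h₁.trans (congrArg₂ _ h₂ h₃)
  | _, .app f a => by
    filter_upwards [limitVal_class (B := B)
      (.app f (limitRepArgs (a.eval (limitStruct B) M))), Args.limitVal_eval hθ a] with n h₁ h₂
    exact h₁.trans (congrArg ((B n).app f) h₂)
theorem Args.limitVal_eval {M : (limitStruct B).Assignment} {θ : Subst S}
    (hθ : ∀ x, limitClass B (θ x) = M x) : ∀ {l : List (Srt O)} (a : Args S l),
      ∀ᶠ n in (Filter.hyperfilter ℕ : Filter ℕ),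
        (limitRepArgs (a.eval (limitStruct B) M)).eval (B n) (B n).zeroAssignment =
          (a.subst θ).eval (B n) (B n).zeroAssignment
  | _, .nil => Filter.Eventually.of_forall fun _ => rfl
  | _, .cons t a => by
    filter_upwards [Term.limitVal_eval hθ t, Args.limitVal_eval hθ a] with n h₁ h₂
    exact congrArg₂ Prod.mk h₁ h₂
end

/-- Łoś's theorem for quantifier-free formulas: an ultrafilter commutes with all connectives. The
substitution `θ` names the values of the variables by terms. -/
theorem QF.holds_limitStruct {M : (limitStruct B).Assignment} {θ : Subst S}
    (hθ : ∀ x, limitClass B (θ x) = M x) (m : QF S) :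
    m.Holds (limitStruct B) M ↔ ∀ᶠ n in (Filter.hyperfilter ℕ : Filter ℕ),
      (m.subst θ).Holds (B n) (B n).zeroAssignment := by
  induction m with
  | eq t₁ t₂ =>
    refine (limit_eq_iff _ _).trans (Filter.eventually_congr ?_)
    filter_upwards [Term.limitVal_eval hθ t₁, Term.limitVal_eval hθ t₂] with n h₁ h₂
    rw [h₁, h₂]
    rfl
  | not φ ih => exact (not_congr ih).trans Ultrafilter.eventually_not.symm
  | or φ ψ ih₁ ih₂ => exact (or_congr ih₁ ih₂).trans Ultrafilter.eventually_or.symm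
  | and φ ψ ih₁ ih₂ => exact (and_congr ih₁ ih₂).trans Filter.eventually_and.symm
  | imp φ ψ ih₁ ih₂ => exact (imp_congr ih₁ ih₂).trans Ultrafilter.eventually_imp.symm

/-- Without existential variables all members of the expansion coincide, so keeping `ψ` constant in
that case loses nothing. -/
theorem HerbrandForm.holds_psi {h : HerbrandForm O} {e : ℕ → QF h.sig} (he : h.IsEnumeration e)
    (A : Struct.{w} h.sig) (M : A.Assignment) (n : ℕ) :
    (h.psi e n).Holds A M ↔ ∃ i ≤ n, (e i).Holds A M := by
  induction n with
  | zero => simp [HerbrandForm.psi]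
  | succ n ih =>
    rw [HerbrandForm.psi]
    split
    · rename_i hv
      have hv' : h.vars = [] := List.isEmpty_iff.1 hv
      have hall : ∀ i, e i = h.matrix.subst fun x => .var x.2 := by
        intro i
        obtain ⟨θ, -, hθ, hi⟩ := he.subset (Set.mem_range_self i)
        rw [hi, show θ = fun x => .var x.2 from funext fun x => hθ x (by simp [hv'])]
      rw [ih]
      simp only [hall]
      exact ⟨fun ⟨_, _, hm⟩ => ⟨0, Nat.zero_le _, hm⟩, fun ⟨_, _, hm⟩ => ⟨0, Nat.zero_le _, hm⟩⟩
    · rw [QF.Holds, ih]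
      constructor
      · rintro (⟨i, hi, hm⟩ | hm)
        · exact ⟨i, by omega, hm⟩
        · exact ⟨n + 1, le_rfl, hm⟩
      · rintro ⟨i, hi, hm⟩
        rcases Nat.le_succ_iff.1 hi with hi | rfl
        · exact Or.inl ⟨i, hi, hm⟩
        · exact Or.inr hm

/-- Validity of a quantifier-free formula in all preadditive semicategories, where variables are
read as zero. -/
def QF.Valid (ψ : QF S) : Prop :=
  ∀ A : Struct.{w} S, A.IsPreadditive → ψ.Holds A A.zeroAssignment

theorem Term.isGround_subst_zero {s : Srt O} (t : Term S s) :
    (t.subst fun _ => .zero).IsGround := by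
  rw [Term.IsGround, List.eq_nil_iff_forall_not_mem]
  intro x hx
  obtain ⟨y, -, hy⟩ := Term.mem_vars_subst _ t hx
  simp [Term.vars] at hy

variable [DecidableEq O]

/-- Herbrand's theorem with compactness built in: countermodels of all `ψₙ` are glued by the
ultrafilter, and the elements of the resulting model are values of terms. -/
theorem HerbrandForm.prefixValid_iff {h : HerbrandForm O} {e : ℕ → QF h.sig}
    (he : h.IsEnumeration e) :
    PrefixValid.{w} h.sig h.vars [] h.matrix ↔ ∃ n, QF.Valid.{w} (h.psi e n) := by
  constructor
  · intro hv
    by_contra hcon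
    simp only [QF.Valid, not_exists, not_forall] at hcon
    choose B hB hψ using hcon
    obtain ⟨M, hM, hm⟩ := hv (limitStruct B) (limitStruct_isPreadditive hB)
    have hm : h.matrix.Holds (limitStruct B) M := hm
    -- Representatives may contain variables. These are read as zero anyway, so replacing them by
    -- the zero constant gives a ground term of the same class.
    let θ : Subst h.sig := fun x =>
      if x ∈ h.vars then (limitRep (M x)).subst fun _ => .zero else .var x.2
    have hθ : ∀ x, limitClass B (θ x) = M x := by
      intro x
      refine (limit_eq_iff _ _).2 ?_
      by_cases hx : x ∈ h.vars
      · filter_upwards [limitVal_class (B := B) (θ x)] with n hn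
        rw [hn]
        simp only [θ, if_pos hx, Term.eval_subst]
        rfl
      · rw [hM x hx]
        filter_upwards [limitVal_class (B := B) (θ x), limitVal_zero (B := B) x.1] with n hn hz
        rw [hn, hz]
        simp only [θ, if_neg hx]
        rfl
    rw [QF.holds_limitStruct hθ] at hm
    have hmem : h.matrix.subst θ ∈ Set.range e := by
      rw [he]
      refine ⟨θ, fun x hx => ?_, fun x hx => if_neg hx, rfl⟩
      simp only [θ, if_pos hx]
      exact Term.isGround_subst_zero _
    obtain ⟨j, hj⟩ := hmem
    -- Non-principality enters here: the instance `e j` is a disjunct of `ψ n` only from `n = j` on.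
    have hge : ∀ᶠ n in (Filter.hyperfilter ℕ : Filter ℕ), j ≤ n :=
      (Nat.hyperfilter_le_atTop) (Filter.eventually_ge_atTop j)
    obtain ⟨n, hn, hjn⟩ := (hm.and hge).exists
    refine hψ n ((HerbrandForm.holds_psi he _ _ n).2 ⟨j, hjn, ?_⟩)
    rwa [hj]
  · rintro ⟨n, hn⟩ A hA
    obtain ⟨i, -, hi⟩ := (HerbrandForm.holds_psi he _ _ n).1 (hn A hA)
    obtain ⟨θ, -, hθ, hei⟩ := he.subset (Set.mem_range_self i)
    rw [hei, QF.holds_subst] at hi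
    -- The witnesses are the values of the terms `θ x`; off `h.vars` the term is a variable, which
    -- has value zero.
    refine ⟨_, fun x hx => ?_, hi⟩
    rw [hθ x hx]
    rfl

end Herbrand

/-! ### Correctness of Ackermann's reduction -/

section Ackermann

variable {O : Type} {S : Signature O}

mutual
/-- The indices of the supplied new constants occurring in a term. -/
def Term.freshIdx : {s : Srt O} → Term S.fresh s → List ℕ
  | _, .var _ => []
  | _, .con (.inl _) => []
  | _, .con (.inr i) => [i]
  | _, .zero => []
  | _, .neg t => t.freshIdx
  | _, .add t₁ t₂ => t₁.freshIdx ++ t₂.freshIdx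
  | _, .mul t₁ t₂ => t₁.freshIdx ++ t₂.freshIdx
  | _, .app _ a => a.freshIdx
/-- The indices of the supplied new constants occurring in a tuple of terms. -/
def Args.freshIdx : {l : List (Srt O)} → Args S.fresh l → List ℕ
  | _, .nil => []
  | _, .cons t a => t.freshIdx ++ a.freshIdx
end

/-- The indices of the supplied new constants occurring in a quantifier-free formula. -/
def QF.freshIdx : QF S.fresh → List ℕ
  | .eq t₁ t₂ => t₁.freshIdx ++ t₂.freshIdx
  | .not φ => φ.freshIdx
  | .or φ ψ => φ.freshIdx ++ ψ.freshIdx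
  | .and φ ψ => φ.freshIdx ++ ψ.freshIdx
  | .imp φ ψ => φ.freshIdx ++ ψ.freshIdx

theorem conj_holds (A : Struct.{w} S) (M : A.Assignment) (φ : QF S) (l : List (QF S)) :
    (conj φ l).Holds A M ↔ φ.Holds A M ∧ ∀ ψ ∈ l, ψ.Holds A M := by
  induction l generalizing φ with
  | nil => simp [conj]
  | cons ψ l ih => simp [conj, QF.Holds, ih]

theorem impList_holds (A : Struct.{w} S) (M : A.Assignment) (l : List (QF S)) (ψ : QF S) :
    (impList l ψ).Holds A M ↔ ((∀ φ ∈ l, φ.Holds A M) → ψ.Holds A M) := by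
  cases l with
  | nil => simp [impList]
  | cons φ l => simp [impList, QF.Holds, conj_holds]

theorem argEqs_holds (A : Struct.{w} S) (M : A.Assignment) :
    ∀ {l : List (Srt O)} (a b : Args S l),
      (∀ φ ∈ argEqs a b, φ.Holds A M) ↔ a.eval A M = b.eval A M
  | _, .nil, .nil => by simp [argEqs]
  | _, .cons t a, .cons t' a' => by
    simp only [argEqs, List.forall_mem_cons, argEqs_holds A M a a', QF.Holds, Args.eval]
    exact Prod.mk_inj.symm

theorem mem_conj_syms {F : Sym S} {φ : QF S} {l : List (QF S)} (h : F ∈ (conj φ l).syms) :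
    F ∈ φ.syms ∨ ∃ ψ ∈ l, F ∈ ψ.syms := by
  induction l generalizing φ with
  | nil => exact Or.inl h
  | cons ψ l ih =>
    rcases List.mem_append.1 h with h | h
    · exact Or.inl h
    · rcases ih h with h | ⟨χ, hχ, h⟩
      · exact Or.inr ⟨ψ, List.mem_cons_self, h⟩
      · exact Or.inr ⟨χ, List.mem_cons_of_mem _ hχ, h⟩

theorem mem_impList_syms {F : Sym S} {l : List (QF S)} {ψ : QF S} (h : F ∈ (impList l ψ).syms) :
    (∃ φ ∈ l, F ∈ φ.syms) ∨ F ∈ ψ.syms := by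
  cases l with
  | nil => exact Or.inr h
  | cons φ l =>
    rcases List.mem_append.1 h with h | h
    · rcases mem_conj_syms h with h | ⟨χ, hχ, h⟩
      · exact Or.inl ⟨φ, List.mem_cons_self, h⟩
      · exact Or.inl ⟨χ, List.mem_cons_of_mem _ hχ, h⟩
    · exact Or.inr h

theorem mem_argEqs_syms {F : Sym S} : ∀ {l : List (Srt O)} {a b : Args S l} {φ : QF S},
    φ ∈ argEqs a b → F ∈ φ.syms → F ∈ a.syms ∨ F ∈ b.syms
  | _, .nil, .nil, _, h, _ => by simp [argEqs] at h
  | _, .cons t a, .cons t' a', φ, h, hF => by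
    simp only [Args.syms, List.mem_append]
    rcases List.mem_cons.1 h with rfl | h
    · rcases List.mem_append.1 hF with hF | hF
      · exact Or.inl (Or.inl hF)
      · exact Or.inr (Or.inl hF)
    · rcases mem_argEqs_syms h hF with hF | hF
      · exact Or.inl (Or.inr hF)
      · exact Or.inr (Or.inr hF)

theorem mem_conj_freshIdx {i : ℕ} {φ : QF S.fresh} {l : List (QF S.fresh)}
    (h : i ∈ (conj φ l).freshIdx) : i ∈ φ.freshIdx ∨ ∃ ψ ∈ l, i ∈ ψ.freshIdx := by
  induction l generalizing φ with
  | nil => exact Or.inl h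
  | cons ψ l ih =>
    rcases List.mem_append.1 h with h | h
    · exact Or.inl h
    · rcases ih h with h | ⟨χ, hχ, h⟩
      · exact Or.inr ⟨ψ, List.mem_cons_self, h⟩
      · exact Or.inr ⟨χ, List.mem_cons_of_mem _ hχ, h⟩

theorem mem_impList_freshIdx {i : ℕ} {l : List (QF S.fresh)} {ψ : QF S.fresh}
    (h : i ∈ (impList l ψ).freshIdx) : (∃ φ ∈ l, i ∈ φ.freshIdx) ∨ i ∈ ψ.freshIdx := by
  cases l with
  | nil => exact Or.inr h
  | cons φ l =>
    rcases List.mem_append.1 h with h | h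
    · rcases mem_conj_freshIdx h with h | ⟨χ, hχ, h⟩
      · exact Or.inl ⟨φ, List.mem_cons_self, h⟩
      · exact Or.inl ⟨χ, List.mem_cons_of_mem _ hχ, h⟩
    · exact Or.inr h

theorem mem_argEqs_freshIdx {i : ℕ} : ∀ {l : List (Srt O)} {a b : Args S.fresh l}
    {φ : QF S.fresh}, φ ∈ argEqs a b → i ∈ φ.freshIdx → i ∈ a.freshIdx ∨ i ∈ b.freshIdx
  | _, .nil, .nil, _, h, _ => by simp [argEqs] at h
  | _, .cons t a, .cons t' a', φ, h, hF => by
    simp only [Args.freshIdx, List.mem_append]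
    rcases List.mem_cons.1 h with rfl | h
    · rcases List.mem_append.1 hF with hF | hF
      · exact Or.inl (Or.inl hF)
      · exact Or.inr (Or.inl hF)
    · rcases mem_argEqs_freshIdx h hF with hF | hF
      · exact Or.inl (Or.inr hF)
      · exact Or.inr (Or.inr hF)

variable [DecidableEq O]

-- Nested instances of a function symbol

mutual
-- The list of instances is closed under nesting. Hence the arguments of listed instances can
-- themselves be flattened with the same list, as the consistency premises require.
theorem Term.insts_subset {F : Sym S} {b : SymArgs F} :
    ∀ {s : Srt O} (t : Term S s), b ∈ t.insts F → b.insts F ⊆ t.insts F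
  | _, .var _, h => by simp [Term.insts] at h
  | _, .con _, h => by simp [Term.insts] at h
  | _, .zero, h => by simp [Term.insts] at h
  | _, .neg t, h => Term.insts_subset t h
  | _, .add t₁ t₂, h => (List.mem_append.1 h).elim
      (fun h => List.subset_append_of_subset_left _ (Term.insts_subset t₁ h))
      (fun h => List.subset_append_of_subset_right _ (Term.insts_subset t₂ h))
  | _, .mul t₁ t₂, h => (List.mem_append.1 h).elim
      (fun h => List.subset_append_of_subset_left _ (Term.insts_subset t₁ h))
      (fun h => List.subset_append_of_subset_right _ (Term.insts_subset t₂ h))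
  | _, @Term.app _ _ d ds s f a, h => by
    have ih := Args.insts_subset (b := b) a
    rw [Term.insts] at h ⊢
    refine List.subset_append_of_subset_right _ ?_
    rcases List.mem_append.1 h with h | h
    · split at h
      · rename_i hF
        subst hF
        rw [List.mem_singleton] at h
        subst h
        exact List.Subset.refl _
      · simp at h
    · exact ih h
theorem Args.insts_subset {F : Sym S} {b : SymArgs F} :
    ∀ {l : List (Srt O)} (a : Args S l), b ∈ a.insts F → b.insts F ⊆ a.insts F
  | _, .nil, h => by simp [Args.insts] at h
  | _, .cons t a, h => (List.mem_append.1 h).elim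
      (fun h => List.subset_append_of_subset_left _ (Term.insts_subset t h))
      (fun h => List.subset_append_of_subset_right _ (Args.insts_subset a h))
end

mutual
theorem Term.syms_insts_subset {F : Sym S} {b : SymArgs F} :
    ∀ {s : Srt O} (t : Term S s), b ∈ t.insts F → b.syms ⊆ t.syms
  | _, .var _, h => by simp [Term.insts] at h
  | _, .con _, h => by simp [Term.insts] at h
  | _, .zero, h => by simp [Term.insts] at h
  | _, .neg t, h => Term.syms_insts_subset t h
  | _, .add t₁ t₂, h => (List.mem_append.1 h).elim
      (fun h => List.subset_append_of_subset_left _ (Term.syms_insts_subset t₁ h))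
      (fun h => List.subset_append_of_subset_right _ (Term.syms_insts_subset t₂ h))
  | _, .mul t₁ t₂, h => (List.mem_append.1 h).elim
      (fun h => List.subset_append_of_subset_left _ (Term.syms_insts_subset t₁ h))
      (fun h => List.subset_append_of_subset_right _ (Term.syms_insts_subset t₂ h))
  | _, @Term.app _ _ d ds s f a, h => by
    have ih := Args.syms_insts_subset (b := b) a
    rw [Term.insts] at h
    rw [Term.syms]
    refine List.subset_cons_of_subset _ ?_
    rcases List.mem_append.1 h with h | h
    · split at h
      · rename_i hF
        subst hF
        rw [List.mem_singleton] at h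
        subst h
        exact List.Subset.refl _
      · simp at h
    · exact ih h
theorem Args.syms_insts_subset {F : Sym S} {b : SymArgs F} :
    ∀ {l : List (Srt O)} (a : Args S l), b ∈ a.insts F → b.syms ⊆ a.syms
  | _, .nil, h => by simp [Args.insts] at h
  | _, .cons t a, h => (List.mem_append.1 h).elim
      (fun h => List.subset_append_of_subset_left _ (Term.syms_insts_subset t h))
      (fun h => List.subset_append_of_subset_right _ (Args.syms_insts_subset a h))
end

mutual
theorem Term.freshIdx_insts_subset {F : Sym S.fresh} {b : SymArgs F} :
    ∀ {s : Srt O} (t : Term S.fresh s), b ∈ t.insts F → b.freshIdx ⊆ t.freshIdx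
  | _, .var _, h => by simp [Term.insts] at h
  | _, .con _, h => by simp [Term.insts] at h
  | _, .zero, h => by simp [Term.insts] at h
  | _, .neg t, h => Term.freshIdx_insts_subset t h
  | _, .add t₁ t₂, h => (List.mem_append.1 h).elim
      (fun h => List.subset_append_of_subset_left _ (Term.freshIdx_insts_subset t₁ h))
      (fun h => List.subset_append_of_subset_right _ (Term.freshIdx_insts_subset t₂ h))
  | _, .mul t₁ t₂, h => (List.mem_append.1 h).elim
      (fun h => List.subset_append_of_subset_left _ (Term.freshIdx_insts_subset t₁ h))
      (fun h => List.subset_append_of_subset_right _ (Term.freshIdx_insts_subset t₂ h))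
  | _, @Term.app _ _ d ds s f a, h => by
    have ih := Args.freshIdx_insts_subset (b := b) a
    rw [Term.insts] at h
    rw [Term.freshIdx]
    rcases List.mem_append.1 h with h | h
    · split at h
      · rename_i hF
        subst hF
        rw [List.mem_singleton] at h
        subst h
        exact List.Subset.refl _
      · simp at h
    · exact ih h
theorem Args.freshIdx_insts_subset {F : Sym S.fresh} {b : SymArgs F} :
    ∀ {l : List (Srt O)} (a : Args S.fresh l), b ∈ a.insts F → b.freshIdx ⊆ a.freshIdx
  | _, .nil, h => by simp [Args.insts] at h
  | _, .cons t a, h => (List.mem_append.1 h).elim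
      (fun h => List.subset_append_of_subset_left _ (Term.freshIdx_insts_subset t h))
      (fun h => List.subset_append_of_subset_right _ (Args.freshIdx_insts_subset a h))
end

theorem QF.insts_subset {F : Sym S} {b : SymArgs F} (φ : QF S) (h : b ∈ φ.insts F) :
    b.insts F ⊆ φ.insts F := by
  induction φ with
  | eq t₁ t₂ =>
    exact (List.mem_append.1 h).elim
      (fun h => List.subset_append_of_subset_left _ (t₁.insts_subset h))
      (fun h => List.subset_append_of_subset_right _ (t₂.insts_subset h))
  | not φ ih => exact ih h
  | or φ ψ ih₁ ih₂ | and φ ψ ih₁ ih₂ | imp φ ψ ih₁ ih₂ =>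
    exact (List.mem_append.1 h).elim
      (fun h => List.subset_append_of_subset_left _ (ih₁ h))
      (fun h => List.subset_append_of_subset_right _ (ih₂ h))

theorem QF.syms_insts_subset {F : Sym S} {b : SymArgs F} (φ : QF S) (h : b ∈ φ.insts F) :
    b.syms ⊆ φ.syms := by
  induction φ with
  | eq t₁ t₂ =>
    exact (List.mem_append.1 h).elim
      (fun h => List.subset_append_of_subset_left _ (t₁.syms_insts_subset h))
      (fun h => List.subset_append_of_subset_right _ (t₂.syms_insts_subset h))
  | not φ ih => exact ih h
  | or φ ψ ih₁ ih₂ | and φ ψ ih₁ ih₂ | imp φ ψ ih₁ ih₂ =>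
    exact (List.mem_append.1 h).elim
      (fun h => List.subset_append_of_subset_left _ (ih₁ h))
      (fun h => List.subset_append_of_subset_right _ (ih₂ h))

theorem QF.freshIdx_insts_subset {F : Sym S.fresh} {b : SymArgs F} (φ : QF S.fresh)
    (h : b ∈ φ.insts F) : b.freshIdx ⊆ φ.freshIdx := by
  induction φ with
  | eq t₁ t₂ =>
    exact (List.mem_append.1 h).elim
      (fun h => List.subset_append_of_subset_left _ (t₁.freshIdx_insts_subset h))
      (fun h => List.subset_append_of_subset_right _ (t₂.freshIdx_insts_subset h))
  | not φ ih => exact ih h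
  | or φ ψ ih₁ ih₂ | and φ ψ ih₁ ih₂ | imp φ ψ ih₁ ih₂ =>
    exact (List.mem_append.1 h).elim
      (fun h => List.subset_append_of_subset_left _ (ih₁ h))
      (fun h => List.subset_append_of_subset_right _ (ih₂ h))

-- Symbols and new constants after flattening

section Flattening

variable {F : Sym S.fresh} {L : List (SymArgs F)} {k : ℕ}

mutual
-- Flattening introduces constants only, so an eliminated symbol never returns.
theorem Term.syms_ack {G : Sym S.fresh} : ∀ {s : Srt O} (t : Term S.fresh s),
    G ∈ (t.ack F L k).syms → G ∈ t.syms ∧ G ≠ F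
  | _, .var _, h => by simp [Term.ack, Term.syms] at h
  | _, .con _, h => by simp [Term.ack, Term.syms] at h
  | _, .zero, h => by simp [Term.ack, Term.syms] at h
  | _, .neg t, h => Term.syms_ack t h
  | _, .add t₁ t₂, h => (List.mem_append.1 h).elim
      (fun h => (Term.syms_ack t₁ h).imp_left (List.mem_append_left _))
      (fun h => (Term.syms_ack t₂ h).imp_left (List.mem_append_right _))
  | _, .mul t₁ t₂, h => (List.mem_append.1 h).elim
      (fun h => (Term.syms_ack t₁ h).imp_left (List.mem_append_left _))
      (fun h => (Term.syms_ack t₂ h).imp_left (List.mem_append_right _))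
  | _, .app f a, h => by
    have ih := Args.syms_ack (G := G) a
    rw [Term.ack] at h
    split at h
    · simp [freshCon, Term.syms] at h
    · rename_i hF
      rw [Term.syms] at h ⊢
      rcases List.mem_cons.1 h with rfl | h
      · exact ⟨List.mem_cons_self, hF⟩
      · exact (ih h).imp_left (List.mem_cons_of_mem _)
theorem Args.syms_ack {G : Sym S.fresh} : ∀ {l : List (Srt O)} (a : Args S.fresh l),
    G ∈ (a.ack F L k).syms → G ∈ a.syms ∧ G ≠ F
  | _, .nil, h => by simp [Args.ack, Args.syms] at h
  | _, .cons t a, h => (List.mem_append.1 h).elim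
      (fun h => (Term.syms_ack t h).imp_left (List.mem_append_left _))
      (fun h => (Args.syms_ack a h).imp_left (List.mem_append_right _))
end

theorem QF.syms_ack {G : Sym S.fresh} (φ : QF S.fresh) (h : G ∈ (φ.ack F L k).syms) :
    G ∈ φ.syms ∧ G ≠ F := by
  induction φ with
  | eq t₁ t₂ =>
    exact (List.mem_append.1 h).elim
      (fun h => (t₁.syms_ack h).imp_left (List.mem_append_left _))
      (fun h => (t₂.syms_ack h).imp_left (List.mem_append_right _))
  | not φ ih => exact ih h
  | or φ ψ ih₁ ih₂ | and φ ψ ih₁ ih₂ | imp φ ψ ih₁ ih₂ =>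
    exact (List.mem_append.1 h).elim
      (fun h => (ih₁ h).imp_left (List.mem_append_left _))
      (fun h => (ih₂ h).imp_left (List.mem_append_right _))

mutual
-- Only `L.length` indices are consumed because every instance met is listed: `List.idxOf` then
-- stays below the length.
theorem Term.freshIdx_ack : ∀ {s : Srt O} (t : Term S.fresh s), t.insts F ⊆ L →
    (∀ i ∈ t.freshIdx, i < k) → ∀ i ∈ (t.ack F L k).freshIdx, i < k + L.length
  | _, .var _, _, _ => by simp [Term.ack, Term.freshIdx]
  | _, .con (.inl _), _, _ => by simp [Term.ack, Term.freshIdx]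
  | _, .con (.inr j), _, h => by
    simp only [Term.ack, Term.freshIdx, List.mem_singleton, forall_eq] at h ⊢
    omega
  | _, .zero, _, _ => by simp [Term.ack, Term.freshIdx]
  | _, .neg t, hL, h => Term.freshIdx_ack t hL h
  | _, .add t₁ t₂, hL, h => by
    rw [Term.insts, List.append_subset] at hL
    rw [Term.freshIdx, List.forall_mem_append] at h
    rw [Term.ack, Term.freshIdx, List.forall_mem_append]
    exact ⟨Term.freshIdx_ack t₁ hL.1 h.1, Term.freshIdx_ack t₂ hL.2 h.2⟩
  | _, .mul t₁ t₂, hL, h => by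
    rw [Term.insts, List.append_subset] at hL
    rw [Term.freshIdx, List.forall_mem_append] at h
    rw [Term.ack, Term.freshIdx, List.forall_mem_append]
    exact ⟨Term.freshIdx_ack t₁ hL.1 h.1, Term.freshIdx_ack t₂ hL.2 h.2⟩
  | _, .app f a, hL, h => by
    rw [Term.insts, List.append_subset] at hL
    have ih := Args.freshIdx_ack a hL.2 h
    rw [Term.ack]
    split
    · rename_i hF
      rw [dif_pos hF] at hL
      simpa [freshCon, Term.freshIdx] using List.idxOf_lt_length_of_mem (hL.1 List.mem_cons_self)
    · exact ih
theorem Args.freshIdx_ack : ∀ {l : List (Srt O)} (a : Args S.fresh l), a.insts F ⊆ L →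
    (∀ i ∈ a.freshIdx, i < k) → ∀ i ∈ (a.ack F L k).freshIdx, i < k + L.length
  | _, .nil, _, _ => by simp [Args.ack, Args.freshIdx]
  | _, .cons t a, hL, h => by
    rw [Args.insts, List.append_subset] at hL
    rw [Args.freshIdx, List.forall_mem_append] at h
    rw [Args.ack, Args.freshIdx, List.forall_mem_append]
    exact ⟨Term.freshIdx_ack t hL.1 h.1, Args.freshIdx_ack a hL.2 h.2⟩
end

theorem QF.freshIdx_ack (φ : QF S.fresh) (hL : φ.insts F ⊆ L) (h : ∀ i ∈ φ.freshIdx, i < k) :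
    ∀ i ∈ (φ.ack F L k).freshIdx, i < k + L.length := by
  induction φ with
  | eq t₁ t₂ =>
    rw [QF.insts, List.append_subset] at hL
    rw [QF.freshIdx, List.forall_mem_append] at h
    rw [QF.ack, QF.freshIdx, List.forall_mem_append]
    exact ⟨t₁.freshIdx_ack hL.1 h.1, t₂.freshIdx_ack hL.2 h.2⟩
  | not φ ih => exact ih hL h
  | or φ ψ ih₁ ih₂ | and φ ψ ih₁ ih₂ | imp φ ψ ih₁ ih₂ =>
    rw [QF.insts, List.append_subset] at hL
    rw [QF.freshIdx, List.forall_mem_append] at h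
    rw [QF.ack, QF.freshIdx, List.forall_mem_append]
    exact ⟨ih₁ hL.1 h.1, ih₂ hL.2 h.2⟩

end Flattening

end Ackermann

-- Semantics of the reduction steps

section AckermannSemantics

variable {O : Type} {S : Signature O}

mutual
theorem Term.freshIdx_map : ∀ {s : Srt O} (t : Term S s),
    (t.map (S' := S.fresh) Sum.inl id).freshIdx = []
  | _, .var _ => rfl
  | _, .con _ => rfl
  | _, .zero => rfl
  | _, .neg t => Term.freshIdx_map t
  | _, .add t₁ t₂ => List.append_eq_nil_iff.2 ⟨Term.freshIdx_map t₁, Term.freshIdx_map t₂⟩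
  | _, .mul t₁ t₂ => List.append_eq_nil_iff.2 ⟨Term.freshIdx_map t₁, Term.freshIdx_map t₂⟩
  | _, .app _ a => Args.freshIdx_map a
theorem Args.freshIdx_map : ∀ {l : List (Srt O)} (a : Args S l),
    (a.map (S' := S.fresh) Sum.inl id).freshIdx = []
  | _, .nil => rfl
  | _, .cons t a => List.append_eq_nil_iff.2 ⟨Term.freshIdx_map t, Args.freshIdx_map a⟩
end

theorem QF.freshIdx_map (φ : QF S) : (φ.map (S' := S.fresh) Sum.inl id).freshIdx = [] := by
  induction φ with
  | eq t₁ t₂ => exact List.append_eq_nil_iff.2 ⟨t₁.freshIdx_map, t₂.freshIdx_map⟩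
  | not φ ih => exact ih
  | or φ ψ ih₁ ih₂ | and φ ψ ih₁ ih₂ | imp φ ψ ih₁ ih₂ =>
    exact List.append_eq_nil_iff.2 ⟨ih₁, ih₂⟩

/-- Interpret the supplied new constants by zero. -/
def Struct.fresh (A : Struct.{w} S) : Struct.{w} S.fresh where
  dom := A.dom
  nonempty := A.nonempty
  con {s} := fun c : S.Con s ⊕ ℕ =>
    match c with
    | .inl c => A.con c
    | .inr _ => A.zero s
  zero := A.zero
  neg := A.neg
  add := A.add
  mul := A.mul
  app f := A.app (S := S) f

theorem QF.valid_map_fresh_iff (φ : QF S) :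
    QF.Valid.{w} (φ.map (S' := S.fresh) Sum.inl id) ↔ QF.Valid.{w} φ := by
  constructor
  · intro h A hA
    exact (QF.holds_map (S' := S.fresh) Sum.inl id A.fresh _ φ).1 (h A.fresh
      ⟨hA.mul_assoc, hA.add_assoc, hA.add_zero, hA.add_neg, hA.add_comm, hA.mul_add,
        hA.add_mul⟩)
  · intro h A hA
    exact (QF.holds_map (S' := S.fresh) Sum.inl id A _ φ).2 (h _ hA.reduct)

variable [DecidableEq O]

/-- Reinterpret the new constants of sort `r` with indices at least `k`. -/
def Struct.setFresh (A : Struct.{w} S.fresh) (r : Srt O) (k : ℕ) (v : ℕ → A.dom r) :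
    Struct.{w} S.fresh where
  dom := A.dom
  nonempty := A.nonempty
  con {s} := fun c : S.Con s ⊕ ℕ =>
    match c with
    | .inl c => A.con (s := s) (Sum.inl c)
    | .inr j => if h : r = s ∧ k ≤ j then h.1 ▸ v (j - k) else A.con (s := s) (Sum.inr j)
  zero := A.zero
  neg := A.neg
  add := A.add
  mul := A.mul
  app := A.app

theorem Struct.setFresh_con_of_le (A : Struct.{w} S.fresh) {r : Srt O} {k j : ℕ}
    (v : ℕ → A.dom r) (h : k ≤ j) :
    (A.setFresh r k v).con (s := r) (Sum.inr j) = v (j - k) :=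
  dif_pos ⟨rfl, h⟩

theorem Struct.setFresh_con_of_lt (A : Struct.{w} S.fresh) {r s : Srt O} {k j : ℕ}
    (v : ℕ → A.dom r) (h : j < k) :
    (A.setFresh r k v).con (s := s) (Sum.inr j) = A.con (s := s) (Sum.inr j) :=
  dif_neg fun h' => absurd h (not_lt.2 h'.2)

theorem Struct.IsPreadditive.setFresh {A : Struct.{w} S.fresh} (h : A.IsPreadditive) (r : Srt O)
    (k : ℕ) (v : ℕ → A.dom r) : (A.setFresh r k v).IsPreadditive :=
  ⟨h.mul_assoc, h.add_assoc, h.add_zero, h.add_neg, h.add_comm, h.mul_add, h.add_mul⟩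

/-- The possible interpretations of the function symbol `F` in a structure with domains `D`. -/
abbrev SymInterp (D : Srt O → Type w) (F : Sym S) : Type w := Tup D (F.1 :: F.2.1) → D F.2.2.1

/-- Reinterpret one function symbol. -/
def Struct.setFun (A : Struct.{w} S) (F : Sym S) (g : SymInterp A.dom F) : Struct.{w} S where
  dom := A.dom
  nonempty := A.nonempty
  con := A.con
  zero := A.zero
  neg := A.neg
  add := A.add
  mul := A.mul
  app {d ds s} f :=
    if h : F = (⟨d, ds, s, f⟩ : Sym S) then
      cast (congrArg (SymInterp A.dom) h) g
    else A.app f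

theorem Struct.setFun_app_self (A : Struct.{w} S) (F : Sym S) (g : SymInterp A.dom F) :
    (A.setFun F g).app F.2.2.2 = g :=
  dif_pos rfl

theorem Struct.setFun_app_of_ne (A : Struct.{w} S) {F : Sym S} (g : SymInterp A.dom F)
    {d : Srt O} {ds : List (Srt O)} {s : Srt O} (f : S.Fun d ds s)
    (h : (⟨d, ds, s, f⟩ : Sym S) ≠ F) : (A.setFun F g).app f = A.app f :=
  dif_neg fun e => h e.symm

theorem Struct.IsPreadditive.setFun {A : Struct.{w} S} (h : A.IsPreadditive) (F : Sym S)
    (g : SymInterp A.dom F) : (A.setFun F g).IsPreadditive :=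
  ⟨h.mul_assoc, h.add_assoc, h.add_zero, h.add_neg, h.add_comm, h.mul_add, h.add_mul⟩

variable {F : Sym S.fresh} {L : List (SymArgs F)} {k : ℕ}

mutual
-- When each new constant carries the value of its instance, flattening does not change values. The
-- bound `i < k` protects the constants of earlier steps from the reinterpretation.
theorem Term.eval_ack_setFresh (A : Struct.{w} S.fresh) (M : A.Assignment)
    {v : ℕ → A.dom F.2.2.1}
    (hv : ∀ a ∈ L, v (L.idxOf a) = A.app F.2.2.2 (a.eval A M)) :
    ∀ {s : Srt O} (t : Term S.fresh s), t.insts F ⊆ L → (∀ i ∈ t.freshIdx, i < k) →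
      (t.ack F L k).eval (A.setFresh F.2.2.1 k v) M = t.eval A M
  | _, .var _, _, _ => rfl
  | _, .con (.inl _), _, _ => rfl
  | _, .con (.inr j), _, h => A.setFresh_con_of_lt v (h j (by simp [Term.freshIdx]))
  | _, .zero, _, _ => rfl
  | _, .neg t, hL, h => congrArg A.neg (Term.eval_ack_setFresh A M hv t hL h)
  | _, .add t₁ t₂, hL, h => by
    rw [Term.insts, List.append_subset] at hL
    rw [Term.freshIdx, List.forall_mem_append] at h
    exact congrArg₂ A.add (Term.eval_ack_setFresh A M hv t₁ hL.1 h.1)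
      (Term.eval_ack_setFresh A M hv t₂ hL.2 h.2)
  | _, .mul t₁ t₂, hL, h => by
    rw [Term.insts, List.append_subset] at hL
    rw [Term.freshIdx, List.forall_mem_append] at h
    exact congrArg₂ A.mul (Term.eval_ack_setFresh A M hv t₁ hL.1 h.1)
      (Term.eval_ack_setFresh A M hv t₂ hL.2 h.2)
  | _, @Term.app _ _ d ds s f a, hL, h => by
    rw [Term.insts, List.append_subset] at hL
    have ih := Args.eval_ack_setFresh A M hv a hL.2 h
    rw [Term.ack]
    split
    · rename_i hF
      rw [dif_pos hF] at hL
      have hmem := hL.1 List.mem_cons_self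
      clear ih
      subst hF
      have := hv _ hmem
      refine (A.setFresh_con_of_le v (Nat.le_add_right _ _)).trans ?_
      rw [Nat.add_sub_cancel_left]
      exact this
    · exact congrArg (A.app f) ih
theorem Args.eval_ack_setFresh (A : Struct.{w} S.fresh) (M : A.Assignment)
    {v : ℕ → A.dom F.2.2.1}
    (hv : ∀ a ∈ L, v (L.idxOf a) = A.app F.2.2.2 (a.eval A M)) :
    ∀ {l : List (Srt O)} (a : Args S.fresh l), a.insts F ⊆ L → (∀ i ∈ a.freshIdx, i < k) →
      (a.ack F L k).eval (A.setFresh F.2.2.1 k v) M = a.eval A M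
  | _, .nil, _, _ => rfl
  | _, .cons t a, hL, h => by
    rw [Args.insts, List.append_subset] at hL
    rw [Args.freshIdx, List.forall_mem_append] at h
    exact congrArg₂ Prod.mk (Term.eval_ack_setFresh A M hv t hL.1 h.1)
      (Args.eval_ack_setFresh A M hv a hL.2 h.2)
end

theorem QF.holds_ack_setFresh (A : Struct.{w} S.fresh) (M : A.Assignment)
    {v : ℕ → A.dom F.2.2.1}
    (hv : ∀ a ∈ L, v (L.idxOf a) = A.app F.2.2.2 (a.eval A M)) (φ : QF S.fresh)
    (hL : φ.insts F ⊆ L) (h : ∀ i ∈ φ.freshIdx, i < k) :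
    (φ.ack F L k).Holds (A.setFresh F.2.2.1 k v) M ↔ φ.Holds A M := by
  induction φ with
  | eq t₁ t₂ =>
    rw [QF.insts, List.append_subset] at hL
    rw [QF.freshIdx, List.forall_mem_append] at h
    exact iff_of_eq (congrArg₂ (Eq (α := A.dom _))
      (Term.eval_ack_setFresh A M hv t₁ hL.1 h.1) (Term.eval_ack_setFresh A M hv t₂ hL.2 h.2))
  | not φ ih => exact not_congr (ih hL h)
  | or φ ψ ih₁ ih₂ =>
    rw [QF.insts, List.append_subset] at hL
    rw [QF.freshIdx, List.forall_mem_append] at h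
    exact or_congr (ih₁ hL.1 h.1) (ih₂ hL.2 h.2)
  | and φ ψ ih₁ ih₂ =>
    rw [QF.insts, List.append_subset] at hL
    rw [QF.freshIdx, List.forall_mem_append] at h
    exact and_congr (ih₁ hL.1 h.1) (ih₂ hL.2 h.2)
  | imp φ ψ ih₁ ih₂ =>
    rw [QF.insts, List.append_subset] at hL
    rw [QF.freshIdx, List.forall_mem_append] at h
    exact imp_congr (ih₁ hL.1 h.1) (ih₂ hL.2 h.2)

mutual
-- Conversely, let `g` send flattened arguments to the new constants. By induction the arguments of
-- an instance already evaluate to their flattened values, so the instance evaluates to its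
-- constant.
theorem Term.eval_setFun (A : Struct.{w} S.fresh) (M : A.Assignment) {g : SymInterp A.dom F}
    (hg : ∀ a ∈ L, g ((a.ack F L k).eval A M) =
      A.con (s := F.2.2.1) (Sum.inr (k + L.idxOf a))) :
    ∀ {s : Srt O} (t : Term S.fresh s), t.insts F ⊆ L →
      t.eval (A.setFun F g) M = (t.ack F L k).eval A M
  | _, .var _, _ => rfl
  | _, .con _, _ => rfl
  | _, .zero, _ => rfl
  | _, .neg t, hL => congrArg A.neg (Term.eval_setFun A M hg t hL)
  | _, .add t₁ t₂, hL => by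
    rw [Term.insts, List.append_subset] at hL
    exact congrArg₂ A.add (Term.eval_setFun A M hg t₁ hL.1) (Term.eval_setFun A M hg t₂ hL.2)
  | _, .mul t₁ t₂, hL => by
    rw [Term.insts, List.append_subset] at hL
    exact congrArg₂ A.mul (Term.eval_setFun A M hg t₁ hL.1) (Term.eval_setFun A M hg t₂ hL.2)
  | _, @Term.app _ _ d ds s f a, hL => by
    rw [Term.insts, List.append_subset] at hL
    have ih := Args.eval_setFun A M hg a hL.2
    rw [Term.ack]
    split
    · rename_i hF
      rw [dif_pos hF] at hL
      have hmem := hL.1 List.mem_cons_self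
      subst hF
      have := hg _ hmem
      exact ((congrFun (A.setFun_app_self ⟨d, ds, s, f⟩ g) _).trans (congrArg g ih)).trans this
    · rename_i hF
      exact (congrFun (A.setFun_app_of_ne g f hF) _).trans (congrArg (A.app f) ih)
theorem Args.eval_setFun (A : Struct.{w} S.fresh) (M : A.Assignment) {g : SymInterp A.dom F}
    (hg : ∀ a ∈ L, g ((a.ack F L k).eval A M) =
      A.con (s := F.2.2.1) (Sum.inr (k + L.idxOf a))) :
    ∀ {l : List (Srt O)} (a : Args S.fresh l), a.insts F ⊆ L →
      a.eval (A.setFun F g) M = (a.ack F L k).eval A M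
  | _, .nil, _ => rfl
  | _, .cons t a, hL => by
    rw [Args.insts, List.append_subset] at hL
    exact congrArg₂ Prod.mk (Term.eval_setFun A M hg t hL.1) (Args.eval_setFun A M hg a hL.2)
end

theorem QF.holds_setFun (A : Struct.{w} S.fresh) (M : A.Assignment) {g : SymInterp A.dom F}
    (hg : ∀ a ∈ L, g ((a.ack F L k).eval A M) =
      A.con (s := F.2.2.1) (Sum.inr (k + L.idxOf a))) (φ : QF S.fresh) (hL : φ.insts F ⊆ L) :
    φ.Holds (A.setFun F g) M ↔ (φ.ack F L k).Holds A M := by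
  induction φ with
  | eq t₁ t₂ =>
    rw [QF.insts, List.append_subset] at hL
    exact iff_of_eq (congrArg₂ (Eq (α := A.dom _))
      (Term.eval_setFun A M hg t₁ hL.1) (Term.eval_setFun A M hg t₂ hL.2))
  | not φ ih => exact not_congr (ih hL)
  | or φ ψ ih₁ ih₂ =>
    rw [QF.insts, List.append_subset] at hL
    exact or_congr (ih₁ hL.1) (ih₂ hL.2)
  | and φ ψ ih₁ ih₂ =>
    rw [QF.insts, List.append_subset] at hL
    exact and_congr (ih₁ hL.1) (ih₂ hL.2)
  | imp φ ψ ih₁ ih₂ =>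
    rw [QF.insts, List.append_subset] at hL
    exact imp_congr (ih₁ hL.1) (ih₂ hL.2)

theorem consistency_holds_iff (A : Struct.{w} S.fresh) (M : A.Assignment)
    (r : List (SymArgs F × ℕ)) :
    (∀ φ ∈ consistency F L k r, φ.Holds A M) ↔
      r.Pairwise fun a b => (a.1.ack F L k).eval A M = (b.1.ack F L k).eval A M →
        A.con (s := F.2.2.1) (Sum.inr a.2) = A.con (s := F.2.2.1) (Sum.inr b.2) := by
  induction r with
  | nil => simp [consistency]
  | cons a r ih =>
    rw [consistency, List.forall_mem_append, ih, List.pairwise_cons, List.forall_mem_map]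
    simp only [impList_holds, argEqs_holds]
    rfl

theorem mem_zipIdx_iff_of_nodup {α : Type*} [DecidableEq α] {l : List α} (hl : l.Nodup) {k : ℕ}
    {p : α × ℕ} : p ∈ l.zipIdx k ↔ p.1 ∈ l ∧ p.2 = k + l.idxOf p.1 := by
  obtain ⟨a, i⟩ := p
  rw [List.mk_mem_zipIdx_iff_le_and_getElem?_sub]
  constructor
  · rintro ⟨hk, h⟩
    obtain ⟨hi, rfl⟩ := List.getElem?_eq_some_iff.1 h
    refine ⟨List.getElem_mem _, ?_⟩
    rw [hl.idxOf_getElem]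
    dsimp only
    omega
  · rintro ⟨ha, hi⟩
    dsimp only at ha hi
    refine ⟨by omega, ?_⟩
    rw [hi, Nat.add_sub_cancel_left, List.getElem?_eq_getElem (List.idxOf_lt_length_of_mem ha),
      List.getElem_idxOf]

/-- Only the pairs with `i < j` are listed, but the relation is symmetric and trivial on the
diagonal. Without repetitions the position of an instance is its `List.idxOf`. -/
theorem consistency_holds_iff_of_nodup (A : Struct.{w} S.fresh) (M : A.Assignment)
    (hL : L.Nodup) :
    (∀ φ ∈ consistency F L k (L.zipIdx k), φ.Holds A M) ↔
      ∀ a ∈ L, ∀ b ∈ L, (a.ack F L k).eval A M = (b.ack F L k).eval A M →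
        A.con (s := F.2.2.1) (Sum.inr (k + L.idxOf a)) =
          A.con (s := F.2.2.1) (Sum.inr (k + L.idxOf b)) := by
  rw [consistency_holds_iff]
  constructor
  · intro h a ha b hb
    have hsymm : Std.Symm fun a b : SymArgs F × ℕ =>
        (a.1.ack F L k).eval A M = (b.1.ack F L k).eval A M →
          A.con (s := F.2.2.1) (Sum.inr a.2) = A.con (s := F.2.2.1) (Sum.inr b.2) :=
      ⟨fun _ _ h e => (h e.symm).symm⟩
    exact List.Pairwise.forall_of_forall (fun _ _ _ => rfl) h
      ((mem_zipIdx_iff_of_nodup hL (p := (a, k + L.idxOf a))).2 ⟨ha, rfl⟩)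
      ((mem_zipIdx_iff_of_nodup hL (p := (b, k + L.idxOf b))).2 ⟨hb, rfl⟩)
  · intro h
    refine List.pairwise_of_forall_mem_list fun a ha b hb => ?_
    obtain ⟨ha, ha'⟩ := (mem_zipIdx_iff_of_nodup hL).1 ha
    obtain ⟨hb, hb'⟩ := (mem_zipIdx_iff_of_nodup hL).1 hb
    rw [ha', hb']
    exact h _ ha _ hb

/-- Forward: in any `A`, give the new constants the values of the instances; the premise then holds
because `f` is a function, and the flattened formula means the original one. Backward: constants
satisfying the premise define an interpretation of `f` under which the original formula means the
flattened one. -/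
theorem valid_ackStep_iff (p : ℕ × QF S.fresh) (hp : ∀ i ∈ p.2.freshIdx, i < p.1)
    (F : Sym S.fresh) : QF.Valid.{w} (ackStep p F).2 ↔ QF.Valid.{w} p.2 := by
  obtain ⟨k, φ⟩ := p
  dsimp only at hp
  have hnd := List.nodup_dedup (φ.insts F)
  have hsub : φ.insts F ⊆ (φ.insts F).dedup := fun a ha => List.mem_dedup.2 ha
  have hins : ∀ a ∈ (φ.insts F).dedup, a.insts F ⊆ (φ.insts F).dedup := fun a ha =>
    List.Subset.trans (φ.insts_subset (List.mem_dedup.1 ha)) hsub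
  have hfr : ∀ a ∈ (φ.insts F).dedup, ∀ i ∈ a.freshIdx, i < k := fun a ha i hi =>
    hp i (φ.freshIdx_insts_subset (List.mem_dedup.1 ha) hi)
  simp only [ackStep]
  generalize (φ.insts F).dedup = L at hnd hsub hins hfr
  constructor
  · intro h A hA
    -- Indices beyond the list belong to unused constants; they get zero.
    let v : ℕ → A.dom F.2.2.1 := fun i =>
      if hi : i < L.length then A.app F.2.2.2 (L[i].eval A A.zeroAssignment) else A.zero _
    have hv : ∀ a ∈ L, v (L.idxOf a) = A.app F.2.2.2 (a.eval A A.zeroAssignment) := by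
      intro a ha
      simp only [v, dif_pos (List.idxOf_lt_length_of_mem ha), List.getElem_idxOf]
    have hB := h _ (hA.setFresh F.2.2.1 k v)
    rw [impList_holds, consistency_holds_iff_of_nodup _ _ hnd] at hB
    refine (QF.holds_ack_setFresh A _ hv φ hsub hp).1 (hB fun a ha b hb hab => ?_)
    have hab' : a.eval A A.zeroAssignment = b.eval A A.zeroAssignment :=
      (Args.eval_ack_setFresh A _ hv a (hins a ha) (hfr a ha)).symm.trans
        (hab.trans (Args.eval_ack_setFresh A _ hv b (hins b hb) (hfr b hb)))
    rw [A.setFresh_con_of_le v (Nat.le_add_right _ _),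
      A.setFresh_con_of_le v (Nat.le_add_right _ _), Nat.add_sub_cancel_left,
      Nat.add_sub_cancel_left, hv a ha, hv b hb, hab']
  · intro h A hA
    rw [impList_holds, consistency_holds_iff_of_nodup _ _ hnd]
    intro hc
    classical
    -- Several instances may share the flattened value `t`; by consistency the choice among them is
    -- immaterial. Other tuples get zero.
    let g : SymInterp A.dom F := fun t =>
      if ht : ∃ a ∈ L, (a.ack F L k).eval A A.zeroAssignment = t then
        A.con (s := F.2.2.1) (Sum.inr (k + L.idxOf ht.choose)) else A.zero _
    have hg : ∀ a ∈ L, g ((a.ack F L k).eval A A.zeroAssignment) =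
        A.con (s := F.2.2.1) (Sum.inr (k + L.idxOf a)) := by
      intro a ha
      have ht : ∃ b ∈ L, (b.ack F L k).eval A A.zeroAssignment =
        (a.ack F L k).eval A A.zeroAssignment := ⟨a, ha, rfl⟩
      refine (dif_pos ht).trans ?_
      exact hc _ ht.choose_spec.1 a ha ht.choose_spec.2
    exact (QF.holds_setFun A _ hg φ hsub).1 (h _ (hA.setFun F g))

theorem mem_consistency {φ : QF S.fresh} {r : List (SymArgs F × ℕ)}
    (h : φ ∈ consistency F L k r) :
    ∃ a ∈ r, ∃ b ∈ r, φ = impList (argEqs (a.1.ack F L k) (b.1.ack F L k))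
      (.eq (freshCon S (s := F.2.2.1) a.2) (freshCon S (s := F.2.2.1) b.2)) := by
  induction r with
  | nil => simp [consistency] at h
  | cons a r ih =>
    rw [consistency] at h
    rcases List.mem_append.1 h with h | h
    · obtain ⟨b, hb, rfl⟩ := List.mem_map.1 h
      exact ⟨a, List.mem_cons_self, b, List.mem_cons_of_mem _ hb, rfl⟩
    · obtain ⟨a', ha, b, hb, rfl⟩ := ih h
      exact ⟨a', List.mem_cons_of_mem _ ha, b, List.mem_cons_of_mem _ hb, rfl⟩

theorem syms_ackStep {p : ℕ × QF S.fresh} {F G : Sym S.fresh} (h : G ∈ (ackStep p F).2.syms) :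
    G ∈ p.2.syms ∧ G ≠ F := by
  have key : ∀ a ∈ (p.2.insts F).dedup.zipIdx p.1,
      G ∈ (a.1.ack F (p.2.insts F).dedup p.1).syms → G ∈ p.2.syms ∧ G ≠ F := by
    intro a ha hG
    have ha := List.mem_dedup.1 ((mem_zipIdx_iff_of_nodup (List.nodup_dedup _)).1 ha).1
    exact (a.1.syms_ack hG).imp_left fun hG => p.2.syms_insts_subset ha hG
  rcases mem_impList_syms h with ⟨φ, hφ, h⟩ | h
  · obtain ⟨a, ha, b, hb, rfl⟩ := mem_consistency hφ
    rcases mem_impList_syms h with ⟨χ, hχ, h⟩ | h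
    · rcases mem_argEqs_syms hχ h with h | h
      · exact key a ha h
      · exact key b hb h
    · simp [QF.syms, freshCon, Term.syms] at h
  · exact p.2.syms_ack h

theorem freshIdx_ackStep {p : ℕ × QF S.fresh} (hp : ∀ i ∈ p.2.freshIdx, i < p.1)
    (F : Sym S.fresh) : ∀ i ∈ (ackStep p F).2.freshIdx, i < (ackStep p F).1 := by
  intro i h
  have key : ∀ a ∈ (p.2.insts F).dedup.zipIdx p.1, a.2 < (ackStep p F).1 ∧
      (i ∈ (a.1.ack F (p.2.insts F).dedup p.1).freshIdx → i < (ackStep p F).1) := by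
    intro a ha
    obtain ⟨ha, ha'⟩ := (mem_zipIdx_iff_of_nodup (List.nodup_dedup _)).1 ha
    have hlt := List.idxOf_lt_length_of_mem ha
    refine ⟨by rw [ha', ackStep]; dsimp only; omega, ?_⟩
    have hmem := List.mem_dedup.1 ha
    refine a.1.freshIdx_ack (fun b hb => List.mem_dedup.2 (p.2.insts_subset hmem hb))
      (fun j hj => hp j (p.2.freshIdx_insts_subset hmem hj)) i
  rcases mem_impList_freshIdx h with ⟨φ, hφ, h⟩ | h
  · obtain ⟨a, ha, b, hb, rfl⟩ := mem_consistency hφ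
    rcases mem_impList_freshIdx h with ⟨χ, hχ, h⟩ | h
    · rcases mem_argEqs_freshIdx hχ h with h | h
      · exact (key a ha).2 h
      · exact (key b hb).2 h
    · have hi : i = a.2 ∨ i = b.2 := by simpa [QF.freshIdx, freshCon, Term.freshIdx] using h
      rcases hi with rfl | rfl
      · exact (key a ha).1
      · exact (key b hb).1
  · exact p.2.freshIdx_ack (fun b hb => List.mem_dedup.2 hb) hp i h

/-- The bound on used indices is the invariant that keeps successive steps from reusing constants.
-/
theorem foldl_ackStep (Fs : List (Sym S.fresh)) (p : ℕ × QF S.fresh)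
    (hp : ∀ i ∈ p.2.freshIdx, i < p.1) :
    (QF.Valid.{w} (Fs.foldl ackStep p).2 ↔ QF.Valid.{w} p.2) ∧
      ∀ G ∈ (Fs.foldl ackStep p).2.syms, G ∈ p.2.syms ∧ G ∉ Fs := by
  induction Fs generalizing p with
  | nil => exact ⟨Iff.rfl, fun G hG => ⟨hG, by simp⟩⟩
  | cons F Fs ih =>
    obtain ⟨h₁, h₂⟩ := ih _ (freshIdx_ackStep hp F)
    refine ⟨h₁.trans (valid_ackStep_iff p hp F), fun G hG => ?_⟩
    obtain ⟨hG, hn⟩ := h₂ G hG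
    obtain ⟨hG, hne⟩ := syms_ackStep hG
    exact ⟨hG, by simp [hne, hn]⟩

theorem QF.valid_ackermann_iff (φ : QF S) : QF.Valid.{w} φ.ackermann ↔ QF.Valid.{w} φ := by
  rw [← QF.valid_map_fresh_iff φ]
  refine (foldl_ackStep _ _ ?_).1
  simp [QF.freshIdx_map]

theorem QF.syms_ackermann (φ : QF S) : φ.ackermann.syms = [] := by
  rw [List.eq_nil_iff_forall_not_mem]
  intro G hG
  -- Only the syntactic half is used, so any universe for the structures will do.
  obtain ⟨h, hn⟩ := (foldl_ackStep.{0} _ _ (by simp [QF.freshIdx_map])).2 G hG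
  exact hn (List.mem_dedup.2 h)

end AckermannSemantics

/-! ### Conjunctive normal form -/

section Cnf

variable {O : Type} {S : Signature O}

/-- The truth value of a literal. -/
def Literal.Holds (A : Struct.{w} S) (M : A.Assignment) (l : Literal S) : Prop :=
  l.lhs.eval A M = l.rhs.eval A M ↔ l.positive = true

/-- If some `C` and some `D` contain no literal with `p`, then neither does `C ++ D`. This is
distributivity for an arbitrary predicate in place of truth. -/
theorem forall_mem_distribute {p : Literal S → Prop} (A B : List (List (Literal S))) :
    (∀ E ∈ distribute A B, ∃ l ∈ E, p l) ↔
      (∀ C ∈ A, ∃ l ∈ C, p l) ∨ ∀ D ∈ B, ∃ l ∈ D, p l := by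
  simp only [distribute, List.mem_flatMap, List.mem_map]
  constructor
  · intro h
    by_contra! hcon
    obtain ⟨⟨C, hC, hC'⟩, D, hD, hD'⟩ := hcon
    obtain ⟨l, hl, hp⟩ := h _ ⟨C, hC, D, hD, rfl⟩
    rcases List.mem_append.1 hl with hl | hl
    · exact hC' l hl hp
    · exact hD' l hl hp
  · rintro (h | h) E ⟨C, hC, D, hD, rfl⟩
    · obtain ⟨l, hl, hp⟩ := h C hC
      exact ⟨l, List.mem_append_left _ hl, hp⟩
    · obtain ⟨l, hl, hp⟩ := h D hD
      exact ⟨l, List.mem_append_right _ hl, hp⟩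

theorem QF.cnf_holds (A : Struct.{w} S) (M : A.Assignment) (ψ : QF S) (b : Bool) :
    (∀ C ∈ ψ.cnf b, ∃ l ∈ C, l.Holds A M) ↔ (ψ.Holds A M ↔ b = true) := by
  induction ψ generalizing b with
  | eq t₁ t₂ => cases b <;> simp [QF.cnf, QF.Holds, Literal.Holds]
  | not φ ih =>
    rw [QF.cnf, ih, QF.Holds]
    cases b <;> simp
  | or φ ψ ih₁ ih₂ =>
    cases b
    · rw [QF.cnf, List.forall_mem_append, ih₁, ih₂, QF.Holds]; simp
    · rw [QF.cnf, forall_mem_distribute, ih₁, ih₂, QF.Holds]; simp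
  | and φ ψ ih₁ ih₂ =>
    cases b
    · rw [QF.cnf, forall_mem_distribute, ih₁, ih₂, QF.Holds]; simp; tauto
    · rw [QF.cnf, List.forall_mem_append, ih₁, ih₂, QF.Holds]; simp
  | imp φ ψ ih₁ ih₂ =>
    cases b
    · rw [QF.cnf, List.forall_mem_append, ih₁, ih₂, QF.Holds]; simp
    · rw [QF.cnf, forall_mem_distribute, ih₁, ih₂, QF.Holds]; simp; tauto

theorem mem_literal_distribute {A B : List (List (Literal S))} {E : List (Literal S)}
    (hE : E ∈ distribute A B) {l : Literal S} (hl : l ∈ E) :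
    (∃ C ∈ A, l ∈ C) ∨ ∃ D ∈ B, l ∈ D := by
  simp only [distribute, List.mem_flatMap, List.mem_map] at hE
  obtain ⟨C, hC, D, hD, rfl⟩ := hE
  rcases List.mem_append.1 hl with hl | hl
  · exact Or.inl ⟨C, hC, hl⟩
  · exact Or.inr ⟨D, hD, hl⟩

theorem QF.cnf_syms {ψ : QF S} {b : Bool} (hψ : ψ.syms = []) {C : List (Literal S)}
    (hC : C ∈ ψ.cnf b) {l : Literal S} (hl : l ∈ C) : l.lhs.syms = [] ∧ l.rhs.syms = [] := by
  induction ψ generalizing b C with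
  | eq t₁ t₂ =>
    rw [QF.cnf, List.mem_singleton] at hC
    subst hC
    rw [List.mem_singleton] at hl
    subst hl
    exact List.append_eq_nil_iff.1 hψ
  | not φ ih =>
    rw [QF.cnf] at hC
    exact ih hψ hC hl
  | or φ ψ ih₁ ih₂ | and φ ψ ih₁ ih₂ | imp φ ψ ih₁ ih₂ =>
    obtain ⟨h₁, h₂⟩ := List.append_eq_nil_iff.1 hψ
    cases b <;> rw [QF.cnf] at hC
    all_goals
      first
      | rcases List.mem_append.1 hC with hC | hC
        · exact ih₁ h₁ hC hl
        · exact ih₂ h₂ hC hl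
      | rcases mem_literal_distribute hC hl with ⟨D, hD, hl⟩ | ⟨D, hD, hl⟩
        · exact ih₁ h₁ hD hl
        · exact ih₂ h₂ hD hl

end Cnf

/-! ### A faithful representation of preadditive semicategories -/

section Representation

variable {O : Type} [DecidableEq O] {G : Srt O → Type w} [∀ s, AddCommGroup (G s)]

/-- The column with the entry `a` in the row of its target, if `a` starts in `u₀`. -/
def column (u₀ : O) {s : Srt O} : G s →+ ∀ v, G (u₀, v) :=
  AddMonoidHom.pi fun v => (Pi.evalAddMonoidHom G (u₀, v)).comp (AddMonoidHom.single G s)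

theorem column_apply (u₀ : O) {s : Srt O} (a : G s) (v : O) :
    column u₀ a v = Pi.single s a (u₀, v) := rfl

variable (mul : ∀ {u v o : O}, G (o, v) →+ G (u, o) →+ G (u, v))

/-- Multiplication of a column by `a`. -/
def mulColumn (u₀ : O) {s : Srt O} (a : G s) : (∀ v, G (u₀, v)) →+ ∀ v, G (u₀, v) :=
  (AddMonoidHom.single (fun v => G (u₀, v)) s.2).comp
    ((mul (o := s.1) (v := s.2) a).comp (Pi.evalAddMonoidHom (fun v => G (u₀, v)) s.1))

/-- The action of a morphism on the columns of morphisms that start in `u₀`, with an identity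
of `u₀` adjoined. -/
def columnAction (u₀ : O) {s : Srt O} (a : G s) : AddMonoid.End ((∀ v, G (u₀, v)) × ℤ) where
  toFun x := (mulColumn mul u₀ a x.1 + x.2 • column u₀ a, 0)
  map_zero' := by simp
  map_add' x y := by
    ext1
    · simp only [Prod.fst_add, Prod.snd_add, map_add, add_smul]
      abel
    · simp

theorem columnAction_add (u₀ : O) {s : Srt O} (a b : G s) :
    columnAction mul u₀ (a + b) = columnAction mul u₀ a + columnAction mul u₀ b := by
  refine AddMonoidHom.ext fun x => ?_
  have h : mulColumn mul u₀ (a + b) x.1 = mulColumn mul u₀ a x.1 + mulColumn mul u₀ b x.1 := by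
    simp [mulColumn, Pi.single_add]
  change (mulColumn mul u₀ (a + b) x.1 + x.2 • column u₀ (a + b), (0 : ℤ)) =
    (mulColumn mul u₀ a x.1 + x.2 • column u₀ a, (0 : ℤ)) +
      (mulColumn mul u₀ b x.1 + x.2 • column u₀ b, (0 : ℤ))
  rw [h, map_add, smul_add, Prod.mk_add_mk, add_zero]
  congr 1
  abel

theorem columnAction_zero (u₀ : O) (s : Srt O) : columnAction mul u₀ (0 : G s) = 0 := by
  simpa using columnAction_add mul u₀ (0 : G s) 0

theorem columnAction_neg (u₀ : O) {s : Srt O} (a : G s) :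
    columnAction mul u₀ (-a) = -columnAction mul u₀ a := by
  rw [eq_neg_iff_add_eq_zero, ← columnAction_add, neg_add_cancel, columnAction_zero]

/-- After `b` has acted the `ℤ`-component is zero, so `a` acts on a column only. The identity then
reduces to associativity and to the fact that the column of a product is the product with the
column. -/
theorem columnAction_mul
    (hmul : ∀ {u u' v' v : O} (a : G (v', v)) (b : G (u', v')) (c : G (u, u')),
      mul a (mul b c) = mul (mul a b) c)
    (u₀ : O) {u v o : O} (a : G (o, v)) (b : G (u, o)) :
    columnAction mul u₀ (mul a b) = columnAction mul u₀ a * columnAction mul u₀ b := by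
  refine AddMonoidHom.ext fun x => ?_
  have h₁ : mulColumn mul u₀ (mul a b) x.1 = mulColumn mul u₀ a (mulColumn mul u₀ b x.1) := by
    simp [mulColumn, hmul]
  -- Both sides vanish unless `b` starts in `u₀`, and then have the single entry `mul a b` in row
  -- `v`.
  have h₂ : column u₀ (mul a b) = mulColumn mul u₀ a (column u₀ b) := by
    funext v'
    change Pi.single (u, v) (mul a b) (u₀, v') =
      Pi.single (M := fun v => G (u₀, v)) v (mul a (Pi.single (u, o) b (u₀, o))) v'
    by_cases hu : u = u₀
    · subst hu
      rw [Pi.single_eq_same]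
      by_cases hv : v' = v
      · subst hv
        simp
      · rw [Pi.single_eq_of_ne hv, Pi.single_eq_of_ne (by simpa using hv)]
    · rw [Pi.single_eq_of_ne (by simpa using fun h _ => hu h.symm),
        Pi.single_eq_of_ne (i := (u, o)) (by simpa using fun h => hu h.symm), map_zero,
        Pi.single_zero, Pi.zero_apply]
  change (mulColumn mul u₀ (mul a b) x.1 + x.2 • column u₀ (mul a b), (0 : ℤ)) =
    (mulColumn mul u₀ a (mulColumn mul u₀ b x.1 + x.2 • column u₀ b) + (0 : ℤ) • column u₀ a,
      (0 : ℤ))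
  rw [h₁, h₂, map_add, map_zsmul, zero_smul, add_zero]

/-- The adjoined identity `(0, 1)` is sent to the column of `a`, whose entry in the row of its
target is `a`. This is why the `ℤ`-component is there: a semicategory may have no identities to test
on. -/
theorem eq_zero_of_columnAction_eq_zero {s : Srt O} {a : G s}
    (h : columnAction mul s.1 a = 0) : a = 0 := by
  have h₁ : (mulColumn mul s.1 a 0 + (1 : ℤ) • column s.1 a, (0 : ℤ)) = 0 :=
    DFunLike.congr_fun h ((0 : ∀ v, G (s.1, v)), (1 : ℤ))
  have h₂ := congrFun (congrArg Prod.fst h₁) s.2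
  rw [map_zero, zero_add, one_smul] at h₂
  simpa [column_apply] using h₂

end Representation

/-! ### Correctness of the idealisation -/

section Idealisation

variable {O : Type} {S : Signature O}

/-- The group structure on the domains of a preadditive semicategory. -/
abbrev Struct.IsPreadditive.addCommGroup {A : Struct.{w} S} (hA : A.IsPreadditive) (s : Srt O) :
    AddCommGroup (A.dom s) where
  add := A.add
  zero := A.zero s
  neg := A.neg
  add_assoc a b c := (hA.add_assoc a b c).symm
  zero_add a := (hA.add_comm _ _).trans (hA.add_zero a)
  add_zero a := hA.add_zero a
  neg_add_cancel a := (hA.add_comm _ _).trans (hA.add_neg a)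
  add_comm := hA.add_comm
  nsmul := @nsmulRec _ ⟨A.zero s⟩ ⟨A.add⟩
  zsmul := @zsmulRec _ ⟨A.zero s⟩ ⟨A.add⟩ ⟨A.neg⟩ (@nsmulRec _ ⟨A.zero s⟩ ⟨A.add⟩)

variable [Encodable O]

theorem Literal.toFree_toPoly (l : Literal S) :
    l.toPoly.toFree = l.lhs.toPoly.toFree - l.rhs.toPoly.toFree := by
  rw [Literal.toPoly, Poly.toFree_append, Poly.toFree_neg, sub_eq_add_neg]

/-- Two evaluations in `R` that agree on symbols and operations agree on all arithmetic terms;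
variables count as zero on both sides. -/
theorem Term.map_eval_eq {A : Struct.{w} S} {R : Type w} [Ring R] {π : FreeAlgebra ℤ ℕ →+* R}
    {ρ : ∀ s, A.dom s → R}
    (hcon : ∀ {s} (c : S.Con s),
      ρ s (A.con c) = π (FreeAlgebra.ι ℤ (Encodable.encode (⟨s, c⟩ : (s : Srt O) × S.Con s))))
    (hzero : ∀ s, ρ s (A.zero s) = 0) (hneg : ∀ {s} (a : A.dom s), ρ s (A.neg a) = -ρ s a)
    (hadd : ∀ {s} (a b : A.dom s), ρ s (A.add a b) = ρ s a + ρ s b)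
    (hmul : ∀ {u v o : O} (a : A.dom (o, v)) (b : A.dom (u, o)),
      ρ _ (A.mul a b) = ρ _ a * ρ _ b) :
    ∀ {s : Srt O} (t : Term S s), t.syms = [] →
      ρ s (t.eval A A.zeroAssignment) = π t.toPoly.toFree
  | s, .var _, _ => by
    rw [Term.toPoly, Poly.toFree_nil, map_zero]
    exact hzero s
  | _, .con c, _ => by
    rw [Term.toPoly, Term.eval, hcon]
    simp [Poly.toFree]
  | s, .zero, _ => by
    rw [Term.toPoly, Poly.toFree_nil, map_zero]
    exact hzero s
  | _, .neg t, h => by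
    rw [Term.toPoly, Poly.toFree_neg, map_neg, Term.eval, hneg,
      Term.map_eval_eq hcon hzero hneg hadd hmul t h]
  | _, .add t₁ t₂, h => by
    obtain ⟨h₁, h₂⟩ := List.append_eq_nil_iff.1 h
    rw [Term.toPoly, Poly.toFree_append, map_add, Term.eval, hadd,
      Term.map_eval_eq hcon hzero hneg hadd hmul t₁ h₁,
      Term.map_eval_eq hcon hzero hneg hadd hmul t₂ h₂]
  | _, .mul t₁ t₂, h => by
    obtain ⟨h₁, h₂⟩ := List.append_eq_nil_iff.1 h
    rw [Term.toPoly, Poly.toFree_mul, map_mul, Term.eval, hmul,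
      Term.map_eval_eq hcon hzero hneg hadd hmul t₁ h₁,
      Term.map_eval_eq hcon hzero hneg hadd hmul t₂ h₂]
  | _, .app f a, h => by simp [Term.syms] at h

/-- Every morphism of a preadditive semicategory is determined by a value of the polynomials in
some ring. -/
theorem Struct.IsPreadditive.exists_ring_representation [DecidableEq O] {A : Struct.{w} S}
    (hA : A.IsPreadditive) (s₀ : Srt O) :
    ∃ (R : Type w) (_ : Ring R) (π : FreeAlgebra ℤ ℕ →+* R) (ρ : ∀ s, A.dom s → R),
      (∀ {s : Srt O} (t : Term S s), t.syms = [] →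
        ρ s (t.eval A A.zeroAssignment) = π t.toPoly.toFree) ∧
      Function.Injective (ρ s₀) := by
  let _ := hA.addCommGroup
  let mul : ∀ {u v o : O}, A.dom (o, v) →+ A.dom (u, o) →+ A.dom (u, v) := fun {u v o} =>
    AddMonoidHom.mk' (fun a => AddMonoidHom.mk' (A.mul a) (hA.mul_add a))
      fun a b => AddMonoidHom.ext fun c => hA.add_mul a b c
  let ρ : ∀ s, A.dom s → AddMonoid.End ((∀ v, A.dom (s₀.1, v)) × ℤ) := fun s a =>
    columnAction mul s₀.1 a
  -- Indeterminates that encode no constant symbol may go anywhere; zero is chosen.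
  let x : ℕ → AddMonoid.End ((∀ v, A.dom (s₀.1, v)) × ℤ) := fun n =>
    match (Encodable.decode n : Option ((s : Srt O) × S.Con s)) with
    | some c => ρ c.1 (A.con c.2)
    | none => 0
  refine ⟨_, inferInstance, (FreeAlgebra.lift ℤ x).toRingHom, ρ, ?_, ?_⟩
  · have hadd : ∀ {s} (a b : A.dom s), ρ s (A.add a b) = ρ s a + ρ s b :=
      fun a b => columnAction_add mul s₀.1 a b
    have hneg : ∀ {s} (a : A.dom s), ρ s (A.neg a) = -ρ s a :=
      fun a => columnAction_neg mul s₀.1 a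
    have hzero : ∀ s, ρ s (A.zero s) = 0 := fun s => columnAction_zero mul s₀.1 s
    have hmul : ∀ {u v o : O} (a : A.dom (o, v)) (b : A.dom (u, o)),
        ρ _ (A.mul a b) = ρ _ a * ρ _ b := fun a b =>
      columnAction_mul mul (fun a b c => hA.mul_assoc a b c) s₀.1 a b
    have hcon : ∀ {s} (c : S.Con s), ρ s (A.con c) = (FreeAlgebra.lift ℤ x).toRingHom
        (FreeAlgebra.ι ℤ (Encodable.encode (⟨s, c⟩ : (s : Srt O) × S.Con s))) := by
      intro s c
      change _ = FreeAlgebra.lift ℤ x _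
      rw [FreeAlgebra.lift_ι_apply]
      simp only [x, Encodable.encodek]
    exact fun {_} t ht => Term.map_eval_eq hcon hzero hneg hadd hmul t ht
  · intro a b hab
    have : ρ s₀ (a - b) = 0 := by
      rw [sub_eq_add_neg]
      change columnAction mul s₀.1 (a + -b) = 0
      rw [columnAction_add, columnAction_neg, ← sub_eq_add_neg, sub_eq_zero]
      exact hab
    exact sub_eq_zero.1 (eq_zero_of_columnAction_eq_zero mul this)

/-- The idealisation of a clause: the polynomial of some positive literal lies in the ideal
generated by the polynomials of the negative literals. -/
def ClauseIdealisation (C : List (Literal S)) : Prop :=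
  ∃ l ∈ C, l.positive = true ∧
    Query.Holds ⟨(C.filter fun l' => !l'.positive).map Literal.toPoly, l.toPoly⟩

/-- If every literal failed, the equations of the negative ones would hold, so `π` would kill their
ideal and hence the polynomial of `l`. As `ρ` is injective on the sort of `l`, that literal would
hold after all. -/
theorem ClauseIdealisation.exists_holds [DecidableEq O] {C : List (Literal S)}
    (hC : ClauseIdealisation C) (hsyms : ∀ l ∈ C, l.lhs.syms = [] ∧ l.rhs.syms = [])
    {A : Struct.{w} S} (hA : A.IsPreadditive) : ∃ l ∈ C, l.Holds A A.zeroAssignment := by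
  obtain ⟨l, hl, hpos, hmem⟩ := hC
  by_contra! hcon
  obtain ⟨R, _, π, ρ, hρ, hinj⟩ := hA.exists_ring_representation l.sort
  have hle : TwoSidedIdeal.span {f : FreeAlgebra ℤ ℕ | ∃ g ∈
      (C.filter fun l' => !l'.positive).map Literal.toPoly, f = g.toFree} ≤
      TwoSidedIdeal.ker π := by
    rw [TwoSidedIdeal.span_le]
    rintro f ⟨g, hg, rfl⟩
    obtain ⟨l', hl', rfl⟩ := List.mem_map.1 hg
    obtain ⟨hl', hneg⟩ := List.mem_filter.1 hl'
    have hneg' : l'.positive = false := by simpa using hneg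
    have heq : l'.lhs.eval A A.zeroAssignment = l'.rhs.eval A A.zeroAssignment := by
      have := hcon l' hl'
      simpa [Literal.Holds, hneg'] using this
    rw [SetLike.mem_coe, TwoSidedIdeal.mem_ker, Literal.toFree_toPoly, map_sub,
      ← hρ _ (hsyms l' hl').1, ← hρ _ (hsyms l' hl').2, heq, sub_self]
  have h0 := hle hmem
  rw [TwoSidedIdeal.mem_ker] at h0
  dsimp only at h0
  rw [Literal.toFree_toPoly, map_sub, ← hρ _ (hsyms l hl).1, ← hρ _ (hsyms l hl).2,
    sub_eq_zero] at h0
  exact hcon l hl (by simp [Literal.Holds, hpos, hinj h0])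

/-- The preadditive semicategory all of whose morphism sets are the same ring. -/
def ringStruct (S : Signature O) {R : Type w} [Ring R] (π : FreeAlgebra ℤ ℕ →+* R) :
    Struct.{w} S where
  dom _ := R
  nonempty _ := ⟨0⟩
  con {s} c := π (FreeAlgebra.ι ℤ (Encodable.encode (⟨s, c⟩ : (s : Srt O) × S.Con s)))
  zero _ := 0
  neg a := -a
  add a b := a + b
  mul a b := a * b
  app _ _ := 0

theorem ringStruct_isPreadditive {R : Type w} [Ring R] (π : FreeAlgebra ℤ ℕ →+* R) :
    (ringStruct S π).IsPreadditive where
  mul_assoc (a b c : R) := (mul_assoc a b c).symm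
  add_assoc (a b c : R) := (add_assoc a b c).symm
  add_zero (a : R) := add_zero a
  add_neg (a : R) := add_neg_cancel a
  add_comm (a b : R) := add_comm a b
  mul_add (a b c : R) := mul_add a b c
  add_mul (a b c : R) := add_mul a b c

theorem eval_ringStruct {R : Type w} [Ring R] (π : FreeAlgebra ℤ ℕ →+* R) {s : Srt O}
    (t : Term S s) (ht : t.syms = []) :
    t.eval (ringStruct S π) (ringStruct S π).zeroAssignment = π t.toPoly.toFree :=
  Term.map_eval_eq (A := ringStruct S π) (ρ := fun _ a => a) (fun _ => rfl) (fun _ => rfl)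
    (fun _ => rfl) (fun _ _ => rfl) (fun _ _ => rfl) t ht

/-- The quotient ring by the ideal `I` of the negative literals is a generic model: an equation
holds in it exactly when its polynomial is in `I`. All negative literals are false there, so the
true literal is a positive one. One model thus selects one disjunct. -/
theorem clauseIdealisation_of_valid {C : List (Literal S)}
    (hsyms : ∀ l ∈ C, l.lhs.syms = [] ∧ l.rhs.syms = [])
    (hC : ∀ A : Struct.{w} S, A.IsPreadditive → ∃ l ∈ C, l.Holds A A.zeroAssignment) :
    ClauseIdealisation C := by
  let I := TwoSidedIdeal.span {f : FreeAlgebra ℤ ℕ | ∃ g ∈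
      (C.filter fun l' => !l'.positive).map Literal.toPoly, f = g.toFree}
  -- Lifted so that the quotient serves as a domain in the universe of the structures.
  let π : FreeAlgebra ℤ ℕ →+* ULift.{w} I.ringCon.Quotient :=
    (ULift.ringEquiv.symm : I.ringCon.Quotient ≃+* _).toRingHom.comp I.ringCon.mk'
  have hπ : ∀ l : Literal S, π l.lhs.toPoly.toFree = π l.rhs.toPoly.toFree ↔
      l.toPoly.toFree ∈ I := by
    intro l
    rw [Literal.toFree_toPoly, ← TwoSidedIdeal.rel_iff]
    exact (ULift.ringEquiv.symm.injective.eq_iff).trans (RingCon.eq _)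
  obtain ⟨l, hl, hh⟩ := hC (ringStruct S π) (ringStruct_isPreadditive π)
  have hh' : l.toPoly.toFree ∈ I ↔ l.positive = true := by
    rw [← hπ, ← eval_ringStruct π _ (hsyms l hl).1, ← eval_ringStruct π _ (hsyms l hl).2]
    exact hh
  have hpos : l.positive = true := by
    by_contra hneg
    refine hneg (hh'.1 (TwoSidedIdeal.subset_span ⟨_, List.mem_map_of_mem ?_, rfl⟩))
    exact List.mem_filter.2 ⟨hl, by simpa using hneg⟩
  exact ⟨l, hl, hpos, hh'.2 hpos⟩

theorem QF.valid_iff_forall_clauseIdealisation [DecidableEq O] {ψ : QF S} (hψ : ψ.syms = []) :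
    QF.Valid.{w} ψ ↔ ∀ C ∈ ψ.cnf true, ClauseIdealisation C := by
  have key : ∀ A : Struct.{w} S, ψ.Holds A A.zeroAssignment ↔
      ∀ C ∈ ψ.cnf true, ∃ l ∈ C, l.Holds A A.zeroAssignment := fun A => by
    rw [QF.cnf_holds]
    simp
  constructor
  · intro h C hC
    exact clauseIdealisation_of_valid (fun l hl => QF.cnf_syms hψ hC hl)
      fun A hA => (key A).1 (h A hA) C hC
  · intro h A hA
    exact (key A).2 fun C hC => (h C hC).exists_holds (fun l hl => QF.cnf_syms hψ hC hl) hA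

theorem exists_verifiesClause_iff {P : MembershipProcedure} (hP : P.IsSemiDecision)
    (C : List (Literal S)) : (∃ n, verifiesClause P n C = true) ↔ ClauseIdealisation C := by
  simp only [verifiesClause, List.any_eq_true, Bool.and_eq_true]
  constructor
  · rintro ⟨n, l, hl, hpos, hv⟩
    exact ⟨l, hl, hpos, (hP _).1 ⟨n, hv⟩⟩
  · rintro ⟨l, hl, hpos, hh⟩
    obtain ⟨n, hn⟩ := (hP _).2 hh
    exact ⟨n, l, hl, hpos, hn⟩

theorem verifiesClause_mono {P : MembershipProcedure} {n n' : ℕ} (h : n ≤ n')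
    {C : List (Literal S)} (hC : verifiesClause P n C = true) : verifiesClause P n' C = true := by
  simp only [verifiesClause, List.any_eq_true, Bool.and_eq_true] at hC ⊢
  obtain ⟨l, hl, hpos, hv⟩ := hC
  exact ⟨l, hl, hpos, P.verifies_mono h hv⟩

theorem verifiesIdealisation_mono {P : MembershipProcedure} {n n' : ℕ} (h : n ≤ n')
    {ψ : QF S} (hψ : verifiesIdealisation P n ψ = true) : verifiesIdealisation P n' ψ = true :=
  List.all_eq_true.2 fun C hC => verifiesClause_mono h (List.all_eq_true.1 hψ C hC)

/-- There are finitely many clauses and verification is monotone, so the maximum of their bounds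
serves all. -/
theorem exists_verifiesIdealisation_iff {P : MembershipProcedure} (hP : P.IsSemiDecision)
    (ψ : QF S) : (∃ n, verifiesIdealisation P n ψ = true) ↔
      ∀ C ∈ ψ.cnf true, ClauseIdealisation C := by
  simp only [← exists_verifiesClause_iff hP, verifiesIdealisation, List.all_eq_true]
  generalize ψ.cnf true = Cs
  constructor
  · rintro ⟨n, hn⟩ C hC
    exact ⟨n, hn C hC⟩
  · intro h
    induction Cs with
    | nil => exact ⟨0, by simp⟩
    | cons C Cs ih =>
      obtain ⟨n, hn⟩ := ih fun D hD => h D (List.mem_cons_of_mem _ hD)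
      obtain ⟨m, hm⟩ := h C List.mem_cons_self
      refine ⟨max n m, List.forall_mem_cons.2 ⟨verifiesClause_mono (le_max_right _ _) hm,
        fun D hD => verifiesClause_mono (le_max_left _ _) (hn D hD)⟩⟩

end Idealisation

/-! ### The procedure -/

section Procedure

variable {O : Type} [DecidableEq O] [Encodable O] {S : Signature O}

theorem Formula.run_succ (φ : Formula S) (e : ℕ → QF φ.herbrandForm.sig)
    (P : MembershipProcedure) (N : ℕ) :
    φ.run e P (N + 1) = φ.herbrandForm.step e P (φ.run e P N) :=
  Function.iterate_succ_apply' _ _ _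

/-- Every inner loop is finite, so a run that never stops passes through all configurations. -/
theorem Formula.exists_run_eq_running {φ : Formula S} {e : ℕ → QF φ.herbrandForm.sig}
    {P : MembershipProcedure} (h : ¬ φ.ReturnsTop e P) (n : ℕ) :
    ∀ k ≤ n + 1, ∃ N, φ.run e P N = .running (n + 1) k := by
  have inner : ∀ n, (∃ N, φ.run e P N = .running n 0) →
      ∀ k ≤ n, ∃ N, φ.run e P N = .running n k := by
    intro n h0 k
    induction k with
    | zero => exact fun _ => h0
    | succ k ih =>
      intro hk
      obtain ⟨N, hN⟩ := ih (by omega)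
      have hs := φ.run_succ e P N
      rw [hN, HerbrandForm.step, if_pos (by omega)] at hs
      split at hs
      · exact absurd ⟨_, hs⟩ h
      · exact ⟨_, hs⟩
  induction n with
  | zero => exact inner _ ⟨0, rfl⟩
  | succ n ih =>
    refine inner _ ?_
    obtain ⟨N, hN⟩ := ih (n + 1) le_rfl
    have hs := φ.run_succ e P N
    rw [hN, HerbrandForm.step, if_neg (lt_irrefl _)] at hs
    exact ⟨_, hs⟩

theorem Formula.returnsTop_iff (φ : Formula S) (e : ℕ → QF φ.herbrandForm.sig)
    (P : MembershipProcedure) :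
    φ.ReturnsTop e P ↔
      ∃ k n, verifiesIdealisation P n (φ.herbrandForm.psi e k).ackermann = true := by
  constructor
  · rintro ⟨N, hN⟩
    induction N with
    | zero => cases hN
    | succ N ih =>
      rw [φ.run_succ] at hN
      cases hc : φ.run e P N with
      | returnedTop => exact ih hc
      | running n k =>
        rw [hc, HerbrandForm.step] at hN
        split at hN
        · split at hN
          · rename_i hv
            exact ⟨k, n, hv⟩
          · cases hN
        · cases hN
  · rintro ⟨k, n, hv⟩
    by_contra hcon
    -- Round `n + k + 1` is late enough on both counts: it grants at least `n` operations, and its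
    -- inner loop reaches `k`.
    obtain ⟨N, hN⟩ := Formula.exists_run_eq_running hcon (n + k) k (by omega)
    refine hcon ⟨N + 1, ?_⟩
    rw [φ.run_succ, hN, HerbrandForm.step, if_pos (by omega),
      if_pos (verifiesIdealisation_mono (by omega) hv)]

theorem Formula.returnsTop_iff_entails (φ : Formula S) {e : ℕ → QF φ.herbrandForm.sig}
    (he : φ.herbrandForm.IsEnumeration e) {P : MembershipProcedure} (hP : P.IsSemiDecision) :
    φ.ReturnsTop e P ↔ Entails.{w} (axioms S) φ := by
  rw [φ.returnsTop_iff, entails_iff_prefixValid_herbrandForm, HerbrandForm.prefixValid_iff he]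
  refine exists_congr fun k => ?_
  rw [exists_verifiesIdealisation_iff hP, ← QF.valid_ackermann_iff,
    QF.valid_iff_forall_clauseIdealisation (QF.syms_ackermann _)]

end Procedure

end OperatorLogic

theorem theorem3p8 :
    OperatorLogic.certificateSearch.IsSemiDecision ∧
    ∀ (O : Type) [DecidableEq O] [Encodable O] (S : OperatorLogic.Signature O)
      (φ : OperatorLogic.Formula S),
      φ.herbrandForm.IsEnumeration φ.herbrandForm.enumerate ∧
      ∀ (e : ℕ → OperatorLogic.QF φ.herbrandForm.sig) (P : OperatorLogic.MembershipProcedure),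
        φ.herbrandForm.IsEnumeration e → P.IsSemiDecision →
        (φ.ReturnsTop e P ↔ OperatorLogic.Entails.{w} (OperatorLogic.axioms S) φ) :=
  ⟨OperatorLogic.certificateSearch_isSemiDecision, fun _ _ _ _ φ =>
    ⟨φ.herbrandForm.isEnumeration_enumerate, fun _ _ he hP => φ.returnsTop_iff_entails he hP⟩⟩
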